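/- Let $R_o$ be an irreducible simply-laced finite root system of rank $\ell$ with a base and highest root $\theta$. Let $Q^\vee=Q_o^\vee\oplus\mathbb Z\mathbf c$ be the coroot lattice of its untwisted affinization, where $\mathbf c$ is the minimal imaginary coroot. The simple affine coroots are the simple coroots $a_1^\vee,\dots,a_\ell^\vee$ of $R_o$ and $a_{\ell+1}^\vee=\mathbf c-\theta^\vee$; let $\Pi=\{a_1,\dots,a_{\ell+1}\}$ be the set of simple affine roots, and $W$ the affine Weyl group, generated by the simple reflections $w_a$, $a\in\Pi$. The coroots are the real ones $\alpha^\vee+n\mathbf c$ ($\alpha\in R_o$, $n\in\mathbb Z$), of multiplicity $m=1$, and the imaginary ones $n\mathbf c$ ($n\ne0$), of multiplicity $m=\ell$; let $R_+^\vee$ be the set of positive ones, i.e. those in $Q^\vee_+=\sum_i\mathbb Z_{\ge0}a_i^\vee$. Let $v$ be a formal variable, $\mathcal Q_v=\mathbb C[[v^{-1}]][[Q^\vee_-]]$ and $\mathcal Q_v^{fin}=\mathbb C[v^{-1}][[Q_-^\vee]]$ the rings of formal power series in the $e^{-a_i^\vee}$, and let $\mathcal Q^{fin}_v[W]^\vee$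 be the space of formal, possibly infinite, sums $\sum_{w\in W}f_w[w]$ with $f_w\in\mathcal Q^{fin}_v$. Let $R$ be the field of rational functions in the $e^x$, $x\in Q^\vee$, over $\mathbb C[v^{-1}]$, with its $W$-action $f\mapsto f^w$, and $R[W]$ the group algebra with $[w]f=f^w[w]$. For $a\in\Pi$ put $$T_a=\frac{1-v^{-1}e^{-a^\vee}}{1-e^{a^\vee}}[w_a]+\frac{v^{-1}-1}{1-e^{a^\vee}}[1]\in R[W],$$ and $T_w=T_{b_1}\cdots T_{b_r}$ for a reduced decomposition $w=w_{b_1}\cdots w_{b_r}$ with $b_1,\dots,b_r\in\Pi$. Rational functions are expanded in negative powers of the coroots. Put $$\mathfrak D=\prod_{\beta\in R_+^\vee}(1-e^{-\beta})^{m(\beta)},\qquad \mathfrak D_v=\prod_{\beta\in R_+^\vee}(1-v^{-1}e^{-\beta})^{m(\beta)},\qquad \Big(\frac1{\mathfrak D}\Big)^w=\prod_{\beta\in R_+^\vee}(1-e^{-w\beta})^{-m(\beta)},$$ so that $[w]\frac1{\mathfrak D}=\big(\frac1{\mathfrak D}\big)^w[w]$. Then $T_w$ does not depend on the reduced decomposition,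 and $T_w=\sum_u C_u(w)[u]$ with all $C_u(w)$ expanding in $\mathcal Q_v^{fin}$; the infinite products $\mathfrak D_v$ and $(1/\mathfrak D)^w$ converge in $\mathcal Q_v^{fin}$. For every $u\in W$ the sum $C_u=\sum_{w\in W}C_u(w)$ is well defined in $\mathcal Q_v$ (each monomial $v^{-d}e^{-\beta}$ occurs in only finitely many $C_u(w)$) and lies in $\mathcal Q_v^{fin}$. Moreover there is a $W$-invariant element $\mathfrak c(v)\in\mathbb C[v^{-1}][[e^{-\mathbf c}]]$ such that, in $\mathcal Q_v^{fin}[W]^\vee$, $$\mathcal P:=\sum_{w\in W}T_w=\sum_{u\in W}C_u[u]=\mathfrak c(v)\,\mathfrak D_v\sum_{w\in W}[w]\frac1{\mathfrak D}.$$ -/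

import Mathlib

open Polynomial

noncomputable section

namespace AffineCS

/-! ### Laurent polynomials, rational functions and their expansions

`I` indexes the simple affine coroots, `I →₀ ℤ` is the affine coroot lattice in the basis of the
simple affine coroots, and the polynomial variable `X : ℂ[X]` is the formal variable `v⁻¹`. -/

section Rings

variable (I : Type*)

/-- The group algebra `ℂ[v⁻¹][Q^∨]` of the coroot lattice. -/
abbrev Laurent : Type _ := AddMonoidAlgebra ℂ[X] (I →₀ ℤ)

/-- Rational functions in the `e^x`, `x ∈ Q^∨`, with coefficients in `ℂ[v⁻¹]`. -/
abbrev RatFun : Type _ := FractionRing (Laurent I)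

/-- The completion `ℂ[v⁻¹][[Q^∨_-]]`: the variable attached to `i : I` is `e^{-a_i^∨}`, so that the
monomial with exponent `n : I →₀ ℕ` is `e^{-n}`. -/
abbrev Qfin : Type _ := MvPowerSeries I ℂ[X]

/-- The completion `ℂ[[v⁻¹]][[Q^∨_-]]`. -/
abbrev Qv : Type _ := MvPowerSeries I (PowerSeries ℂ)

variable {I}

/-- The inclusion `ℂ[v⁻¹][[Q^∨_-]] ⊆ ℂ[[v⁻¹]][[Q^∨_-]]`. -/
def toQv : Qfin I →+* Qv I := MvPowerSeries.map Polynomial.coeToPowerSeries.ringHom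

/-- The inclusion `Q^∨_+ ⊆ Q^∨`. -/
def toLattice (n : I →₀ ℕ) : I →₀ ℤ := n.mapRange Nat.cast Nat.cast_zero

/-- The exponential `e^x` as a rational function. -/
def rexp (x : I →₀ ℤ) : RatFun I := algebraMap (Laurent I) (RatFun I) (AddMonoidAlgebra.single x 1)

/-- `v⁻¹` as a rational function. -/
def vinv : RatFun I := algebraMap (Laurent I) (RatFun I) (AddMonoidAlgebra.single 0 X)

instance instIsDomainQfin : IsDomain (Qfin I) := NoZeroDivisors.to_isDomain _

/-- The variable `e^{-a_i^∨}` in the fraction field of `ℂ[v⁻¹][[Q^∨_-]]`. -/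
def var (i : I) : FractionRing (Qfin I) :=
  algebraMap (Qfin I) (FractionRing (Qfin I)) (MvPowerSeries.X i)

lemma var_ne_zero (i : I) : var i ≠ 0 := by
  intro h
  have h2 : (MvPowerSeries.X i : Qfin I) = 0 :=
    IsFractionRing.injective (Qfin I) (FractionRing (Qfin I)) (by simpa [var] using h)
  have := congrArg (MvPowerSeries.coeff (Finsupp.single i 1)) h2
  simp at this

/-- The element `e^x = ∏ i, (e^{-a_i^∨}) ^ (-x_i)` in the fraction field of the completion. -/
def expo : Multiplicative (I →₀ ℤ) →* FractionRing (Qfin I) where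
  toFun x := (Multiplicative.toAdd x).prod fun i k => var i ^ (-k)
  map_one' := by simp
  map_mul' x y := by
    rw [toAdd_mul, Finsupp.prod_add_index']
    · simp
    · intro i a c
      rw [neg_add, zpow_add₀ (var_ne_zero i)]

/-- Laurent polynomials inside the fraction field of the completion. -/
def laurentToFrac : Laurent I →+* FractionRing (Qfin I) :=
  (AddMonoidAlgebra.lift ℂ[X] (FractionRing (Qfin I)) (I →₀ ℤ) expo).toRingHom


lemma expo_mul_pow (x : I →₀ ℤ) (N : ℕ) (s : Finset I) (hs : x.support ⊆ s)
    (hN : ∀ i, x i ≤ N) :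
    expo (Multiplicative.ofAdd x) * ∏ i ∈ s, var i ^ N =
      algebraMap (Qfin I) (FractionRing (Qfin I))
        (MvPowerSeries.monomial (Finsupp.indicator s fun i _ => ((N : ℤ) - x i).toNat) 1) := by
  classical
  have h1 : expo (Multiplicative.ofAdd x) = ∏ i ∈ s, var i ^ (-(x i)) := by
    change x.prod (fun i k => var i ^ (-k)) = _
    exact Finsupp.prod_of_support_subset x hs _ (by simp)
  rw [h1, ← Finset.prod_mul_distrib, MvPowerSeries.monomial_one_eq,
    Finsupp.prod_of_support_subset (s := s) _ (Finsupp.support_indicator_subset _ _) _ (by simp),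
    map_prod]
  refine Finset.prod_congr rfl fun i hi => ?_
  rw [Finsupp.indicator_of_mem hi, map_pow]
  change _ = var i ^ _
  rw [← zpow_natCast (var i) N, ← zpow_add₀ (var_ne_zero i), ← zpow_natCast,
    Int.toNat_of_nonneg (by have := hN i; omega)]
  congr 1
  ring

lemma laurentToFrac_injective : Function.Injective (laurentToFrac (I := I)) := by
  classical
  rw [injective_iff_map_eq_zero]
  intro p hp
  set T : Finset (I →₀ ℤ) := p.coeff.support with hT
  set s : Finset I := T.biUnion fun x => x.support with hs
  set N : ℕ := T.sup fun x => x.support.sup fun i => (x i).natAbs with hN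
  have hxs : ∀ x ∈ T, x.support ⊆ s := fun x hx =>
    Finset.subset_biUnion_of_mem (fun x : I →₀ ℤ => x.support) hx
  have hxN : ∀ x ∈ T, ∀ i, x i ≤ N := by
    intro x hx i
    by_cases hi : i ∈ x.support
    · have h1 : (x i).natAbs ≤ x.support.sup fun i => (x i).natAbs :=
        Finset.le_sup (f := fun i => (x i).natAbs) hi
      have h2 : (x.support.sup fun i => (x i).natAbs) ≤ N :=
        Finset.le_sup (f := fun x : I →₀ ℤ => x.support.sup fun i => (x i).natAbs) hx
      omega
    · rw [Finsupp.notMem_support_iff.mp hi]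
      positivity
  set φ : (I →₀ ℤ) → (I →₀ ℕ) := fun x => Finsupp.indicator s fun i _ => ((N : ℤ) - x i).toNat
    with hφ
  have hφinj : ∀ x ∈ T, ∀ y ∈ T, φ x = φ y → x = y := by
    intro x hx y hy hxy
    ext i
    by_cases hi : i ∈ s
    · have h := DFunLike.congr_fun hxy i
      simp only [hφ, Finsupp.indicator_of_mem hi] at h
      have h1 := hxN x hx i
      have h2 := hxN y hy i
      omega
    · rw [Finsupp.notMem_support_iff.mp fun h => hi (hxs x hx h),
        Finsupp.notMem_support_iff.mp fun h => hi (hxs y hy h)]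
  have hsum : laurentToFrac p = ∑ x ∈ T, (p.coeff x) • expo (Multiplicative.ofAdd x) := by
    change AddMonoidAlgebra.lift ℂ[X] (FractionRing (Qfin I)) (I →₀ ℤ) expo p = _
    rw [AddMonoidAlgebra.lift_apply]
    rfl
  have hzero : algebraMap (Qfin I) (FractionRing (Qfin I))
      (∑ x ∈ T, p.coeff x • MvPowerSeries.monomial (φ x) 1) = 0 := by
    have : laurentToFrac p * ∏ i ∈ s, var i ^ N = 0 := by rw [hp, zero_mul]
    rw [hsum, Finset.sum_mul] at this
    rw [map_sum, ← this]
    refine Finset.sum_congr rfl fun x hx => ?_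
    rw [smul_mul_assoc, expo_mul_pow x N s (hxs x hx) (hxN x hx)]
    exact map_smul (IsScalarTower.toAlgHom ℂ[X] (Qfin I) (FractionRing (Qfin I))) _ _
  have hz : (∑ x ∈ T, p.coeff x • MvPowerSeries.monomial (φ x) (1 : ℂ[X])) = 0 :=
    IsFractionRing.injective (Qfin I) (FractionRing (Qfin I)) (by rw [hzero, map_zero])
  ext1
  refine Finsupp.ext fun y => ?_
  by_contra hy
  have hyT : y ∈ T := Finsupp.mem_support_iff.mpr hy
  have h := congrArg (MvPowerSeries.coeff (φ y)) hz
  rw [map_sum, Finset.sum_eq_single y] at h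
  · simp at h
    exact hy h
  · intro x hx hxy
    rw [map_smul, MvPowerSeries.coeff_monomial, if_neg, smul_zero]
    exact fun h => hxy (hφinj x hx y hyT h.symm)
  · exact fun h => absurd hyT h

/-- Rational functions inside the fraction field of the completion: the formal expansion of rational
functions in negative powers of the coroots. -/
def ratToFrac : RatFun I →+* FractionRing (Qfin I) :=
  IsFractionRing.lift laurentToFrac_injective

/-- `g` is the expansion of the rational function `f` in negative powers of the coroots. -/
def Expands (f : RatFun I) (g : Qfin I) : Prop :=
  ratToFrac f = algebraMap (Qfin I) (FractionRing (Qfin I)) g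

open Classical in
/-- The expansion of a rational function in `ℂ[v⁻¹][[Q^∨_-]]` (`0` if it has none there). -/
def expansion (f : RatFun I) : Qfin I := if h : ∃ g, Expands f g then h.choose else 0

/-- Automorphisms of the lattice act on its group algebra by `g • e^x = e^{g x}`. -/
instance instActionLaurent : MulSemiringAction ((I →₀ ℤ) ≃ₗ[ℤ] (I →₀ ℤ)) (Laurent I) where
  smul g f := AddMonoidAlgebra.domCongr ℂ[X] ℂ[X] g.toAddEquiv f
  one_smul f := by
    change AddMonoidAlgebra.domCongr ℂ[X] ℂ[X] (AddEquiv.refl _) f = f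
    simp
  mul_smul g h f := by
    change AddMonoidAlgebra.domCongr ℂ[X] ℂ[X] (h.toAddEquiv.trans g.toAddEquiv) f =
      AddMonoidAlgebra.domCongr ℂ[X] ℂ[X] g.toAddEquiv
        (AddMonoidAlgebra.domCongr ℂ[X] ℂ[X] h.toAddEquiv f)
    rw [← AddMonoidAlgebra.trans_domCongr_domCongr]
    rfl
  smul_zero g := map_zero (AddMonoidAlgebra.domCongr ℂ[X] ℂ[X] g.toAddEquiv)
  smul_add g := map_add (AddMonoidAlgebra.domCongr ℂ[X] ℂ[X] g.toAddEquiv)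
  smul_one g := map_one (AddMonoidAlgebra.domCongr ℂ[X] ℂ[X] g.toAddEquiv)
  smul_mul g := map_mul (AddMonoidAlgebra.domCongr ℂ[X] ℂ[X] g.toAddEquiv)

/-- The induced action on rational functions. -/
instance instActionRatFun : MulSemiringAction ((I →₀ ℤ) ≃ₗ[ℤ] (I →₀ ℤ)) (RatFun I) :=
  IsFractionRing.mulSemiringAction _ (Laurent I) (RatFun I)

/-- The rational function `c(x) = (1 - v⁻¹ e^{-x}) / (1 - e^x)`. -/
def cFun (x : I →₀ ℤ) : RatFun I := (1 - vinv * rexp (-x)) / (1 - rexp x)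

/-- The rational function `b(x) = (v⁻¹ - 1) / (1 - e^x)`. -/
def bFun (x : I →₀ ℤ) : RatFun I := (vinv - 1) / (1 - rexp x)

/-- `F` is the infinite sum of the `f j`, formed coefficient by coefficient: for every monomial
`e^{-n} v^{-d}` only finitely many `f j` involve it, and its coefficients add up to that in `F`. -/
def HasFormalSum {J : Type*} (f : J → Qfin I) (F : Qv I) : Prop :=
  ∀ (n : I →₀ ℕ) (d : ℕ),
    {j | (MvPowerSeries.coeff n (f j)).coeff d ≠ 0}.Finite ∧
    PowerSeries.coeff d (MvPowerSeries.coeff n F) =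
      ∑ᶠ j, (MvPowerSeries.coeff n (f j)).coeff d

/-- `F` is the infinite product of the `f j`: every coefficient of the finite partial products is
eventually constant, equal to the coefficient of `F`. -/
def HasFormalProd {J : Type*} (f : J → Qfin I) (F : Qfin I) : Prop :=
  ∀ n : I →₀ ℕ, ∀ᶠ s : Finset J in Filter.atTop,
    MvPowerSeries.coeff n (∏ j ∈ s, f j) = MvPowerSeries.coeff n F

open Classical in
/-- The infinite product of the `f j` (`1` if it does not converge). -/
def formalProd {J : Type*} (f : J → Qfin I) : Qfin I :=
  if h : ∃ F, HasFormalProd f F then h.choose else 1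

open Classical in
/-- The coefficient of `e^x` in an element of `ℂ[v⁻¹][[Q^∨_-]]`, for an arbitrary `x ∈ Q^∨`. -/
def coeffExp (f : Qfin I) (x : I →₀ ℤ) : ℂ[X] :=
  if h : ∃ n : I →₀ ℕ, toLattice n = -x then MvPowerSeries.coeff h.choose f else 0

end Rings

/-! ### The untwisted affinization of a finite root system -/

section Affine

variable {ι k M N : Type*} [Field k] [AddCommGroup M] [Module k M]
  [AddCommGroup N] [Module k N] {P : RootPairing ι k M N} (b : P.Base)

/-- `θ` is the (index of the) highest root. -/
def IsHighestRoot (θ : ι) : Prop :=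
  ∀ i, P.root θ - P.root i ∈ AddSubmonoid.closure (P.root '' b.support)

/-- The index set of the simple affine (co)roots: `some i` is a simple (co)root of the finite root
system, `none` is the additional affine node. -/
abbrev Idx : Type _ := Option b.support

/-- The affine coroot lattice `Q^∨`, in the basis of the simple affine coroots. -/
abbrev Lattice : Type _ := Idx b →₀ ℤ

variable (θ : ι)

/-- The finite part of a simple affine (co)root: the affine node is `-θ` up to imaginary (co)roots. -/
def node : Idx b → ι
  | some i => i
  | none => P.reflectionPerm θ θ

/-- The simple affine coroot `a_i^∨`. -/
def simpleCoroot (i : Idx b) : Lattice b := Finsupp.single i 1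

/-- The projection of `Q^∨` to the finite coroot lattice, with kernel `ℤ c`: the coroot `a_i^∨` goes
to the simple coroot `i`, and the affine simple coroot `c - θ^∨` to `-θ^∨`. -/
def finPart : Lattice b →ₗ[ℤ] N :=
  Finsupp.linearCombination ℤ fun i => P.coroot (node b θ i)

lemma exists_corootCoord :
    ∃ f : b.support →₀ ℤ, Finsupp.linearCombination ℤ (fun i : b.support => P.coroot i) f =
      P.coroot θ := by
  have h := b.coroot_mem_span_int θ
  rw [Set.image_eq_range] at h
  exact (Finsupp.mem_span_range_iff_exists_finsupp).mp h

/-- The minimal imaginary coroot `c = a_0^∨ + θ^∨`, with `a_0^∨` the coroot of the affine node. -/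
def minImag : Lattice b :=
  simpleCoroot b none + (exists_corootCoord b θ).choose.embDomain Function.Embedding.some

lemma finPart_minImag : finPart b θ (minImag b θ) = 0 := by
  rw [minImag, map_add, Finsupp.embDomain_eq_mapDomain, finPart,
    Finsupp.linearCombination_mapDomain]
  have h := (exists_corootCoord b θ).choose_spec
  have h2 : ((fun i => P.coroot (node b θ i)) ∘ (Function.Embedding.some : b.support ↪ Idx b)) =
      fun i : b.support => P.coroot i := rfl
  rw [h2, h]
  simp [simpleCoroot, node]

/-- The affine coroots: modulo `c` they are a coroot of the finite root system (real coroots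
`α^∨ + n c`) or zero (imaginary coroots `n c`, `n ≠ 0`). -/
def IsAffineCoroot (x : Lattice b) : Prop :=
  x ≠ 0 ∧ (finPart b θ x ∈ Set.range P.coroot ∨ finPart b θ x = 0)

/-- The positive affine coroots. -/
abbrev PosCoroot : Type _ := {n : Idx b →₀ ℕ // IsAffineCoroot b θ (toLattice n)}

open Classical in
/-- The multiplicity of a coroot: the rank of the finite root system for imaginary coroots, and `1`
for real ones. -/
def mult (n : PosCoroot b θ) : ℕ :=
  if finPart b θ (toLattice n.1) = 0 then b.support.card else 1

variable [CharZero k] [P.IsCrystallographic]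

/-- The pairing `⟨a_i, x⟩` of a simple affine root with an element of `Q^∨`. -/
def simplePairing (i : Idx b) : Lattice b →ₗ[ℤ] ℤ :=
  Finsupp.linearCombination ℤ fun j => P.pairingIn ℤ (node b θ i) (node b θ j)

lemma simplePairing_self (i : Idx b) : simplePairing b θ i (simpleCoroot b i) = 2 := by
  simp [simplePairing, simpleCoroot]

/-- The simple reflection `x ↦ x - ⟨a_i, x⟩ a_i^∨` of `Q^∨`. -/
def simpleReflection (i : Idx b) : Lattice b ≃ₗ[ℤ] Lattice b :=
  Module.reflection (simplePairing_self b θ i)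

/-- The affine Weyl group, in its (faithful) action on `Q^∨`. -/
def weyl : Subgroup (Lattice b ≃ₗ[ℤ] Lattice b) :=
  Subgroup.closure (Set.range (simpleReflection b θ))

/-- The simple reflections as elements of the affine Weyl group. -/
def gen (i : Idx b) : weyl b θ :=
  ⟨simpleReflection b θ i, Subgroup.subset_closure (Set.mem_range_self i)⟩

/-- `l` is a reduced word of `w`. -/
def IsReducedWord (l : List (Idx b)) (w : weyl b θ) : Prop :=
  (l.map (gen b θ)).prod = w ∧
    ∀ l' : List (Idx b), (l'.map (gen b θ)).prod = w → l.length ≤ l'.length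

lemma gen_inv (i : Idx b) : (gen b θ i)⁻¹ = gen b θ i := by
  rw [inv_eq_iff_mul_eq_one]
  refine Subtype.ext (LinearEquiv.ext fun x => ?_)
  exact Module.involutive_reflection (simplePairing_self b θ i) x

lemma exists_word (w : weyl b θ) : ∃ l : List (Idx b), (l.map (gen b θ)).prod = w := by
  obtain ⟨w, hw⟩ := w
  induction hw using Subgroup.closure_induction with
  | mem x hx => obtain ⟨i, rfl⟩ := hx; exact ⟨[i], by simp [gen]⟩
  | one => exact ⟨[], rfl⟩
  | mul x y hx hy h1 h2 =>
    obtain ⟨l1, h1⟩ := h1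
    obtain ⟨l2, h2⟩ := h2
    exact ⟨l1 ++ l2, by rw [List.map_append, List.prod_append, h1, h2]; rfl⟩
  | inv x hx h =>
    obtain ⟨l, h⟩ := h
    refine ⟨l.reverse, ?_⟩
    have h3 : (fun g => g⁻¹) ∘ gen b θ = gen b θ := funext fun i => gen_inv b θ i
    have := congrArg (fun g => g⁻¹) h
    simp only [List.prod_inv_reverse, List.map_map, ← List.map_reverse, h3] at this
    rw [this]
    rfl

lemma exists_reducedWord (w : weyl b θ) : ∃ l, IsReducedWord b θ l w := by
  classical
  have h : ∃ n : ℕ, ∃ l : List (Idx b), (l.map (gen b θ)).prod = w ∧ l.length = n := by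
    obtain ⟨l, hl⟩ := exists_word b θ w
    exact ⟨_, l, hl, rfl⟩
  obtain ⟨l, hl, hn⟩ := Nat.find_spec h
  exact ⟨l, hl, fun l' hl' => hn ▸ Nat.find_min' h ⟨l', hl', rfl⟩⟩

/-- The group algebra of the affine Weyl group over the rational functions, with the commutation
relation `[w] f = f^w [w]`. -/
abbrev RW : Type _ := SkewMonoidAlgebra (RatFun (Idx b)) (weyl b θ)

/-- The Demazure-Lusztig operator `T_a = c(a^∨) [w_a] + b(a^∨) [1]` of a simple affine root. -/
def simpleT (i : Idx b) : RW b θ :=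
  SkewMonoidAlgebra.single (gen b θ i) (cFun (simpleCoroot b i)) +
    SkewMonoidAlgebra.single 1 (bFun (simpleCoroot b i))

/-- The product `T_{i_1} ⋯ T_{i_r}` along a word. -/
def wordT (l : List (Idx b)) : RW b θ := (l.map (simpleT b θ)).prod

/-- The element `T_w`, the product of the `T_a` along a reduced word of `w`. -/
def elemT (w : weyl b θ) : RW b θ := wordT b θ (exists_reducedWord b θ w).choose

/-- The coefficient `C_u(w)` of `[u]` in `T_w`, expanded in negative powers of the coroots. -/
def coeffC (u w : weyl b θ) : Qfin (Idx b) := expansion ((elemT b θ w).coeff u)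

/-- The factor `(1 - v⁻¹ e^{-β})^{m(β)}` of the deformed Weyl-Kac denominator. -/
def denomFactor (n : PosCoroot b θ) : Qfin (Idx b) :=
  (1 - MvPowerSeries.monomial n.1 X) ^ mult b θ n

/-- The `v`-deformed Weyl-Kac denominator `D_v = ∏ (1 - v⁻¹ e^{-β})^{m(β)}`, over all positive
affine coroots `β`. -/
def denomV : Qfin (Idx b) := formalProd (denomFactor b θ)

/-- The rational function `((1 - e^{-β})⁻¹)^w = (1 - e^{-wβ})⁻¹`. -/
def invFactorRat (w : weyl b θ) (n : PosCoroot b θ) : RatFun (Idx b) :=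
  w • (1 - rexp (-toLattice n.1))⁻¹

/-- The factor `(1 - e^{-wβ})^{-m(β)}` of `(1/D)^w`, expanded in negative powers of the coroots. -/
def invFactor (w : weyl b θ) (n : PosCoroot b θ) : Qfin (Idx b) :=
  expansion (invFactorRat b θ w n) ^ mult b θ n

/-- The translate `(1/D)^w` of the inverse of the Weyl-Kac denominator
`D = ∏ (1 - e^{-β})^{m(β)}`, i.e. the coefficient of `[w]` in `[w] (1/D) = (1/D)^w [w]`. -/
def invDenom (w : weyl b θ) : Qfin (Idx b) := formalProd (invFactor b θ w)

/-- The subring `ℂ[v⁻¹][[e^{-c}]]` of `ℂ[v⁻¹][[Q^∨_-]]`: only the powers `e^{-j c}` occur. -/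
def IsImagSeries (f : Qfin (Idx b)) : Prop :=
  ∀ n, MvPowerSeries.coeff n f ≠ 0 → ∃ j : ℕ, toLattice n = j • minImag b θ

end Affine

end AffineCS

end

set_option linter.unusedSectionVars false

noncomputable section

namespace AffineCS

/-! Expanding a product of the `T_a` gives a sum over paths in `W`: on reading the letter `i` a path
at `u` stays, with coefficient `b(u a_i^∨)`, or moves to `u s_i`, with coefficient `c(u a_i^∨)`. Put
`invWt u = ∏ (-e^{-β})` over the positive real coroots `β` with `u⁻¹β < 0`; this is `(-1)^{ℓ(u)}
e^{uρ-ρ}`. Pulling it out of the coefficient of `[u]` leaves the path sum `pathC w u`, whose step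
weights are power series satisfying `1 + stay = move` (`one_add_stayWt`). Hence `pathC w t + pathC
(w s_i) t` is symmetric under `t ↔ t s_i` (`pathC_add_symm`), and after summation over `w` the total
does not depend on `t` (`tsum_pathC`). So `C_u = invWt u * L` with one series `L = pathLimit`. Since
also `(1/D)^u = invWt u * (1/D)` (`invDenom_eq`), the formula holds with `c = L D / D_v`.

The sum over `w` converges because a nonzero coefficient of `e^{-n}` in `pathC w u` forces `ℓ(w) ≤
ℓ(u) + 2 ht n` (`le_of_coeff_foldl_ne_zero`): staying can shorten the product of the current
position and the unread part of the word, but only at the price of a factor `e^{-β}`, and the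
reflection in `β` has length at most `2 ht β`. The bound does not involve the power of `v⁻¹`, so
`C_u` has polynomial coefficients.

It remains to see that `c` is `W`-invariant. Let everything act on `1`, that is, add up the
coefficients of the `[u]`. Each `T_w` then gives a Laurent polynomial, and summing in the two orders
gives `∑_w T_w(1) = (∑_u invWt u) L` (`hasSum_augSeries`). Pairing `w` with `s_i w` brings in `(1 +
T_i) p = (1 - v⁻¹e^{-a})/(1 - e^{-a}) * (p - e^{-a} s_i p)` for `a = a_i^∨`, so the sum divided by
`1 - v⁻¹e^{-a}` is `s_i`-invariant. Likewise `∑_u invWt u`, `D` and `D_v` are `s_i`-invariant after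
removal of their factors `1 - e^{-a}`, `1 - e^{-a}` and `1 - v⁻¹e^{-a}`. These factors cancel in `c`
(`translates_of_denomV_mul`); only the skew symmetry of the alternating sum is needed, not the
denominator identity. Finally an invariant series supported in `Q^∨_-` involves only powers of
`e^{-c}`, `c` the imaginary coroot (`isImagSeries_of_invariant`).

The group does not act on the completion, so invariance is expressed through coefficient functions
on all of `Q^∨` (`coeffExp`, `Translates`). Expansion does not commute with the action on rational
functions, but on Laurent polynomials it preserves coefficients (`coeffExp_of_expands_laurent`),
hence the passage through them. -/

/-- The standing hypotheses on a base `b` and the index `θ`: the root system is simply laced, and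
`θ` is its highest root. -/
class SimplyLacedAffine {ι k M N : Type*} [Field k] [AddCommGroup M] [Module k M]
    [AddCommGroup N] [Module k N] {P : RootPairing ι k M N} [CharZero k] [P.IsCrystallographic]
    (b : P.Base) (θ : ι) : Prop where
  isSimplyLaced : b.cartanMatrix.IsSimplyLaced
  isHighestRoot : IsHighestRoot b θ

/-! ### Identification of roots and coroots in the simply-laced case -/

section RootSystem

variable {ι k M N : Type*} [Finite ι] [Field k] [CharZero k] [AddCommGroup M] [Module k M]
  [AddCommGroup N] [Module k N] {P : RootPairing ι k M N} [P.IsRootSystem] [P.IsCrystallographic]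
  [P.IsReduced] (b : P.Base)

/-- The linear isomorphism sending simple roots to simple coroots. -/
def rootToCoroot : M ≃ₗ[k] N := b.toWeightBasis.equiv b.toCoweightBasis (Equiv.refl _)

lemma rootToCoroot_simple (i : b.support) : rootToCoroot b (P.root i) = P.coroot i := by
  rw [rootToCoroot, ← b.toWeightBasis_apply, Module.Basis.equiv_apply]
  simp

lemma pairing_simple_comm (hsl : b.cartanMatrix.IsSimplyLaced) (i j : b.support) :
    P.pairing i j = P.pairing j i := by
  rcases eq_or_ne i j with rfl | hij
  · rfl
  have h1 := hsl hij
  have h2 := hsl hij.symm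
  have h0 := b.cartanMatrix_apply_eq_zero_iff_symm (i := i) (j := j)
  have h3 : b.cartanMatrix i j = b.cartanMatrix j i := by
    rcases h1 with h1 | h1
    · rw [h1, h0.mp h1]
    · rcases h2 with h2 | h2
      · rw [h2, h0.mpr h2]
      · rw [h1, h2]
  have h4 : P.pairingIn ℤ i j = P.pairingIn ℤ j i := h3
  rw [← P.algebraMap_pairingIn ℤ, ← P.algebraMap_pairingIn ℤ, h4]

lemma toLinearMap_rootToCoroot_comm (hsl : b.cartanMatrix.IsSimplyLaced) (x y : M) :
    P.toLinearMap x (rootToCoroot b y) = P.toLinearMap y (rootToCoroot b x) := by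
  have h : P.toLinearMap.compl₁₂ LinearMap.id (rootToCoroot b).toLinearMap =
      (P.toLinearMap.compl₁₂ LinearMap.id (rootToCoroot b).toLinearMap).flip := by
    refine b.toWeightBasis.ext fun i => b.toWeightBasis.ext fun j => ?_
    simpa [rootToCoroot_simple] using pairing_simple_comm b hsl i j
  exact LinearMap.congr_fun₂ h x y

/-- Every root is reached from simple ones by simple reflections, and the reflections of roots and
of coroots subtract the same multiple because the pairing transported by `rootToCoroot` is
symmetric. -/
lemma rootToCoroot_root (hsl : b.cartanMatrix.IsSimplyLaced) (i : ι) :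
    rootToCoroot b (P.root i) = P.coroot i := by
  refine b.induction_reflect (p := fun i => rootToCoroot b (P.root i) = P.coroot i) i ?_ ?_ ?_
  · intro i hi
    rw [P.root_reflectionPerm, P.coroot_reflectionPerm, P.reflection_apply_self,
      P.coreflection_apply_self, map_neg, hi]
  · intro i hi
    exact rootToCoroot_simple b ⟨i, hi⟩
  · intro i j hi hj
    rw [P.root_reflectionPerm, P.coroot_reflectionPerm, P.reflection_apply_root,
      P.coreflection_apply_coroot, map_sub, map_smul, hi, rootToCoroot_simple b ⟨j, hj⟩]
    have h := toLinearMap_rootToCoroot_comm b hsl (P.root i) (P.root j)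
    rw [hi, rootToCoroot_simple b ⟨j, hj⟩] at h
    change P.pairing i j = P.pairing j i at h
    rw [h]

end RootSystem

/-! ### The invariant form on the affine coroot lattice and real coroots -/

section Affine

variable {ι k M N : Type*} [Finite ι] [Field k] [CharZero k] [AddCommGroup M] [Module k M]
  [AddCommGroup N] [Module k N] {P : RootPairing ι k M N} [P.IsRootSystem] [P.IsCrystallographic]
  [P.IsReduced] (b : P.Base) (θ : ι)

/-- The invariant bilinear form on the affine coroot lattice. -/
def form : Lattice b →ₗ[ℤ] Lattice b →ₗ[ℤ] ℤ :=
  Finsupp.linearCombination ℤ (simplePairing b θ)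

lemma form_simple (i : Idx b) (y : Lattice b) :
    form b θ (simpleCoroot b i) y = simplePairing b θ i y := by
  simp [form, simpleCoroot]

lemma form_eq_sum (x y : Lattice b) : form b θ x y = x.sum fun i a => a * simplePairing b θ i y := by
  simp [form, Finsupp.linearCombination_apply, Finsupp.sum]

lemma finPart_simple (i : Idx b) : finPart b θ (simpleCoroot b i) = P.coroot (node b θ i) := by
  simp [finPart, simpleCoroot]

lemma simpleReflection_apply (i : Idx b) (x : Lattice b) :
    simpleReflection b θ i x = x - simplePairing b θ i x • simpleCoroot b i := by
  rw [simpleReflection, Module.reflection_apply]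

/-- The real elements: those which are coroots modulo the imaginary direction. -/
def IsReal (x : Lattice b) : Prop := finPart b θ x ∈ Set.range P.coroot

lemma isReal_simple (i : Idx b) : IsReal b θ (simpleCoroot b i) :=
  ⟨_, (finPart_simple b θ i).symm⟩

variable {b θ}

lemma IsReal.neg {x : Lattice b} (hx : IsReal b θ x) : IsReal b θ (-x) := by
  obtain ⟨α, hα⟩ := hx
  exact ⟨P.reflectionPerm α α, by
    rw [P.coroot_reflectionPerm, P.coreflection_apply_self, map_neg, hα]⟩

lemma IsReal.finPart_ne_zero {x : Lattice b} (hx : IsReal b θ x) : finPart b θ x ≠ 0 := by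
  obtain ⟨α, hα⟩ := hx
  rw [← hα]
  exact P.flip.ne_zero α

lemma IsReal.ne_zero {x : Lattice b} (hx : IsReal b θ x) : x ≠ 0 := by
  rintro rfl
  exact hx.finPart_ne_zero (map_zero _)

variable [hS : SimplyLacedAffine b θ]

include hS in
lemma symm_coroot (α : ι) :
    (rootToCoroot b).symm (P.coroot α) = P.root α := by
  rw [LinearEquiv.symm_apply_eq, rootToCoroot_root b hS.isSimplyLaced]

/-- The form factors through the finite part. Symmetry, norm 2 of real coroots and the imaginary
radical are all read off from this. -/
lemma form_cast (x y : Lattice b) : ((form b θ x y : ℤ) : k) =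
    P.toLinearMap ((rootToCoroot b).symm (finPart b θ x)) (finPart b θ y) := by
  have h1 : ∀ i y, ((simplePairing b θ i y : ℤ) : k) =
      P.toLinearMap (P.root (node b θ i)) (finPart b θ y) := by
    intro i y
    induction y using Finsupp.induction_linear with
    | zero => simp
    | add f g hf hg => simp [hf, hg]
    | single j a =>
      have h := P.algebraMap_pairingIn ℤ (node b θ i) (node b θ j)
      simp only [algebraMap_int_eq, eq_intCast] at h
      simp only [simplePairing, finPart, Finsupp.linearCombination_single, smul_eq_mul,
        Int.cast_mul, h]
      rw [map_zsmul, zsmul_eq_mul]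
      rfl
  induction x using Finsupp.induction_linear with
  | zero => simp
  | add f g hf hg => simp [hf, hg]
  | single i a =>
    have : (Finsupp.single i a : Lattice b) = a • simpleCoroot b i := by simp [simpleCoroot]
    rw [this, map_zsmul, map_zsmul, LinearMap.smul_apply, form_simple, finPart_simple, map_zsmul,
      symm_coroot (θ := θ), map_zsmul, LinearMap.smul_apply, ← h1]
    simp

lemma form_comm (x y : Lattice b) : form b θ x y = form b θ y x := by
  have h := toLinearMap_rootToCoroot_comm b hS.isSimplyLaced
    ((rootToCoroot b).symm (finPart b θ x)) ((rootToCoroot b).symm (finPart b θ y))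
  rw [LinearEquiv.apply_symm_apply, LinearEquiv.apply_symm_apply, ← form_cast, ← form_cast] at h
  exact_mod_cast h

lemma form_self {x : Lattice b} (hx : IsReal b θ x) : form b θ x x = 2 := by
  obtain ⟨α, hα⟩ := hx
  have h := form_cast (θ := θ) x x
  rw [← hα, symm_coroot (θ := θ)] at h
  have h2 : P.toLinearMap (P.root α) (P.coroot α) = 2 := P.root_coroot_two α
  rw [h2] at h
  exact_mod_cast h

lemma form_eq_zero_of_finPart {x : Lattice b} (hx : finPart b θ x = 0) (y : Lattice b) :
    form b θ x y = 0 := by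
  have h := form_cast (θ := θ) x y
  rw [hx] at h
  simpa using h

lemma finPart_sub_form_smul {x : Lattice b} {α : ι} (hα : P.coroot α = finPart b θ x)
    (y : Lattice b) :
    finPart b θ (y - form b θ x y • x) = P.coreflection α (finPart b θ y) := by
  have h := form_cast (θ := θ) x y
  rw [← hα, symm_coroot (θ := θ)] at h
  rw [P.coreflection_apply, map_sub, map_zsmul, ← hα]
  congr 1
  change _ = (P.toLinearMap (P.root α) (finPart b θ y)) • _
  rw [← h, Int.cast_smul_eq_zsmul]

/-- The reflection in a real element. -/
def realReflection (b : P.Base) (θ : ι) (x y : Lattice b) : Lattice b := y - form b θ x y • x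

lemma IsReal.realReflection {x y : Lattice b} (hx : IsReal b θ x) (hy : IsReal b θ y) :
    IsReal b θ (realReflection b θ x y) := by
  obtain ⟨α, hα⟩ := hx
  obtain ⟨β, hβ⟩ := hy
  refine ⟨P.reflectionPerm α β, ?_⟩
  rw [AffineCS.realReflection, finPart_sub_form_smul hα, ← hβ, P.coroot_reflectionPerm]

lemma realReflection_simple (i : Idx b) (y : Lattice b) :
    realReflection b θ (simpleCoroot b i) y = simpleReflection b θ i y := by
  rw [simpleReflection_apply, realReflection, form_simple]

lemma isReal_simpleReflection (i : Idx b) {x : Lattice b} (hx : IsReal b θ x) :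
    IsReal b θ (simpleReflection b θ i x) := by
  rw [← realReflection_simple]
  exact (isReal_simple b θ i).realReflection hx

lemma form_realReflection {x : Lattice b} (hx : IsReal b θ x) (y z : Lattice b) :
    form b θ (realReflection b θ x y) (realReflection b θ x z) = form b θ y z := by
  have h := form_self hx
  have h2 := form_comm (b := b) (θ := θ) y x
  simp only [realReflection, map_sub, map_smul, LinearMap.sub_apply, LinearMap.smul_apply,
    smul_eq_mul, h, h2]
  ring

lemma form_weyl (w : weyl b θ) (y z : Lattice b) :
    form b θ (w.1 y) (w.1 z) = form b θ y z := by
  obtain ⟨w, hw⟩ := w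
  induction hw using Subgroup.closure_induction generalizing y z with
  | mem x hx =>
    obtain ⟨i, rfl⟩ := hx
    simp only [← realReflection_simple]
    exact form_realReflection (isReal_simple b θ i) y z
  | one => rfl
  | mul u v hu hv h1 h2 => exact (h1 _ _).trans (h2 _ _)
  | inv u hu h =>
    rw [← h]
    congr 2
    · exact u.apply_symm_apply y
    · exact u.apply_symm_apply z

lemma isReal_weyl (w : weyl b θ) {x : Lattice b} (hx : IsReal b θ x) : IsReal b θ (w.1 x) := by
  obtain ⟨l, rfl⟩ := exists_word b θ w
  induction l with
  | nil => exact hx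
  | cons i l ih =>
    rw [List.map_cons, List.prod_cons]
    exact isReal_simpleReflection i ih

/-- The imaginary direction is the radical of the form, so no simple reflection moves it. -/
lemma weyl_apply_of_finPart_eq_zero (w : weyl b θ) {x : Lattice b} (hx : finPart b θ x = 0) :
    w.1 x = x := by
  obtain ⟨l, rfl⟩ := exists_word b θ w
  induction l with
  | nil => rfl
  | cons i l ih =>
    rw [List.map_cons, List.prod_cons]
    change simpleReflection b θ i ((l.map (gen b θ)).prod.1 x) = x
    rw [ih, simpleReflection_apply, ← form_simple, form_comm, form_eq_zero_of_finPart hx, zero_smul,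
      sub_zero]

lemma finPart_weyl_eq_zero (w : weyl b θ) {x : Lattice b} :
    finPart b θ (w.1 x) = 0 ↔ finPart b θ x = 0 := by
  constructor
  · intro h
    have h1 := weyl_apply_of_finPart_eq_zero w⁻¹ h
    have h2 : (w⁻¹).1 (w.1 x) = x := w.1.symm_apply_apply x
    rw [← h2, h1, h]
  · intro h
    rw [weyl_apply_of_finPart_eq_zero w h, h]

end Affine

/-! ### Signs of real affine coroots -/

section Positivity
variable {ι k M N : Type*} [Finite ι] [Field k] [CharZero k] [AddCommGroup M] [Module k M]
  [AddCommGroup N] [Module k N] {P : RootPairing ι k M N} [P.IsRootSystem] [P.IsCrystallographic]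
  [P.IsReduced] {b : P.Base} {θ : ι} [hS : SimplyLacedAffine b θ]

lemma finPart_eq_sum (y : Lattice b) (hy : y none = 0) :
    finPart b θ y = ∑ i : b.support, y (some i) • P.coroot i := by
  classical
  rw [finPart, Finsupp.linearCombination_apply, Finsupp.sum_fintype _ _ (by simp),
    Fintype.sum_option]
  simp [hy, node]

lemma eq_zero_of_finPart_eq_zero {y : Lattice b} (hy : y none = 0) (h : finPart b θ y = 0) :
    y = 0 := by
  have hli : LinearIndependent ℤ (fun i : b.support => P.coroot i) :=
    b.linearIndepOn_coroot.restrict_scalars' ℤ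
  rw [finPart_eq_sum y hy] at h
  have h2 := Fintype.linearIndependent_iff.mp hli _ h
  ext i
  cases i with
  | none => exact hy
  | some i => exact h2 i

lemma finPart_injOn {x y : Lattice b} (hxy : x none = y none) (h : finPart b θ x = finPart b θ y) :
    x = y :=
  sub_eq_zero.mp (eq_zero_of_finPart_eq_zero (θ := θ) (by simp [hxy]) (by simp [h]))

variable (θ) in
lemma exists_lift_of_mem_closure {m : M} (hm : m ∈ AddSubmonoid.closure (P.root '' b.support)) :
    ∃ y : Lattice b, 0 ≤ y ∧ y none = 0 ∧ finPart b θ y = rootToCoroot b m := by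
  induction hm using AddSubmonoid.closure_induction with
  | mem x hx =>
    obtain ⟨i, hi, rfl⟩ := hx
    refine ⟨simpleCoroot b (some ⟨i, hi⟩), ?_, ?_, ?_⟩
    · rw [simpleCoroot, Finsupp.single_nonneg]
      exact zero_le_one
    · simp [simpleCoroot]
    · rw [finPart_simple, rootToCoroot_simple b ⟨i, hi⟩]
      rfl
  | zero => exact ⟨0, le_rfl, rfl, by simp⟩
  | add x y _ _ hx hy =>
    obtain ⟨x', h1, h2, h3⟩ := hx
    obtain ⟨y', h4, h5, h6⟩ := hy
    exact ⟨x' + y', add_nonneg h1 h4, by simp [h2, h5], by simp [h3, h6]⟩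

variable (b θ) in
/-- The highest coroot inside the affine coroot lattice. -/
def highest : Lattice b := minImag b θ - simpleCoroot b none

lemma highest_none : highest b θ none = 0 := by
  rw [highest, minImag, add_sub_cancel_left]
  exact Finsupp.embDomain_of_notMem_range _ _ _ (by simp)

lemma minImag_none : minImag b θ none = 1 := by
  have h := highest_none (b := b) (θ := θ)
  rw [highest] at h
  simp only [simpleCoroot, Finsupp.coe_sub, Pi.sub_apply, Finsupp.single_eq_same] at h
  linarith

lemma finPart_highest : finPart b θ (highest b θ) = P.coroot θ := by
  rw [highest, map_sub, finPart_minImag, finPart_simple, node, P.coroot_reflectionPerm,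
    P.coreflection_apply_self]
  simp

/-- The highest coroot dominates every finite coroot. -/
lemma exists_highest_sub (α : ι) :
    ∃ y : Lattice b, 0 ≤ y ∧ y none = 0 ∧ finPart b θ y = P.coroot θ - P.coroot α := by
  obtain ⟨y, h1, h2, h3⟩ := exists_lift_of_mem_closure θ (hS.isHighestRoot α)
  refine ⟨y, h1, h2, ?_⟩
  rw [h3, map_sub, rootToCoroot_root b hS.isSimplyLaced, rootToCoroot_root b hS.isSimplyLaced]

/-- The highest coroot dominates each simple coroot, so every simple coroot occurs in it. -/
lemma one_le_minImag (i : Idx b) : 1 ≤ minImag b θ i := by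
  cases i with
  | none => rw [minImag_none]
  | some i =>
    obtain ⟨y, h1, h2, h3⟩ := exists_highest_sub (b := b) (θ := θ) i
    have h : highest b θ = simpleCoroot b (some i) + y := by
      refine finPart_injOn (θ := θ) ?_ ?_
      · rw [highest_none]
        simp [h2, simpleCoroot]
      · rw [map_add, h3, finPart_highest, finPart_simple]
        simp [node]
    have h4 := DFunLike.congr_fun h (some i)
    have h5 : 0 ≤ y (some i) := h1 _
    simp only [highest, simpleCoroot, Finsupp.coe_sub, Pi.sub_apply, Finsupp.coe_add, Pi.add_apply,
      Finsupp.single_eq_same, ne_eq, reduceCtorEq, not_false_eq_true,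
      Finsupp.single_eq_of_ne] at h4
    omega

lemma minImag_nonneg : 0 ≤ minImag b θ := fun i => zero_le_one.trans (one_le_minImag i)

lemma eq_smul_minImag {x : Lattice b} (hx : finPart b θ x = 0) : x = x none • minImag b θ :=
  finPart_injOn (θ := θ) (by simp [minImag_none]) (by rw [hx, map_smul, finPart_minImag, smul_zero])

/-- If `-α^∨` is the finite part of `x`, then `x = (m - 1) c + a_0^∨ + (θ^∨ - α^∨)` with `m` the
affine coordinate, and all three summands are nonnegative. -/
lemma IsReal.nonneg_of_none_pos {x : Lattice b} (hx : IsReal b θ x) (h : 1 ≤ x none) : 0 ≤ x := by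
  obtain ⟨α, hα⟩ := hx.neg
  obtain ⟨y, h1, h2, h3⟩ := exists_highest_sub (b := b) (θ := θ) α
  have h4 : x = (x none - 1) • minImag b θ + simpleCoroot b none + y := by
    refine finPart_injOn (θ := θ) ?_ ?_
    · simp [minImag_none, simpleCoroot, h2]
    · rw [map_add, map_add, map_smul, finPart_minImag, h3, hα, finPart_simple, node,
        P.coroot_reflectionPerm, P.coreflection_apply_self, map_neg]
      simp
  rw [h4]
  refine add_nonneg (add_nonneg (smul_nonneg (by omega) minImag_nonneg) ?_) h1
  rw [simpleCoroot, Finsupp.single_nonneg]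
  exact zero_le_one

lemma IsReal.nonneg_or_nonpos {x : Lattice b} (hx : IsReal b θ x) : 0 ≤ x ∨ x ≤ 0 := by
  rcases lt_trichotomy (x none) 0 with h | h | h
  · right
    have := hx.neg.nonneg_of_none_pos (by simp; omega)
    simpa using this
  · obtain ⟨α, hα⟩ := hx
    rcases b.root_mem_or_neg_mem α with h1 | h1
    · obtain ⟨y, h2, h3, h4⟩ := exists_lift_of_mem_closure θ h1
      rw [rootToCoroot_root b hS.isSimplyLaced, hα] at h4
      left
      rwa [finPart_injOn (by rw [h, h3]) h4.symm]
    · obtain ⟨y, h2, h3, h4⟩ := exists_lift_of_mem_closure θ h1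
      rw [map_neg, rootToCoroot_root b hS.isSimplyLaced, hα, ← map_neg] at h4
      right
      rw [← neg_nonneg]
      rwa [finPart_injOn (by simp [h, h3]) h4.symm]
  · exact Or.inl (hx.nonneg_of_none_pos h)

lemma IsReal.not_nonneg_iff {x : Lattice b} (hx : IsReal b θ x) : ¬ 0 ≤ x ↔ x ≤ 0 := by
  refine ⟨fun h => hx.nonneg_or_nonpos.resolve_left h, fun h h2 => hx.ne_zero (le_antisymm h h2)⟩

lemma simpleCoroot_nonneg (i : Idx b) : 0 ≤ simpleCoroot b i := by
  rw [simpleCoroot, Finsupp.single_nonneg]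
  exact zero_le_one

/-- A positive real element other than `a_i` has a positive coordinate away from `i`. -/
lemma IsReal.exists_pos {x : Lattice b} (hx : IsReal b θ x) (h0 : 0 ≤ x) {i : Idx b}
    (hi : x ≠ simpleCoroot b i) : ∃ j, j ≠ i ∧ 0 < x j := by
  by_contra! hc
  have h1 : x = x i • simpleCoroot b i := by
    ext j
    rcases eq_or_ne j i with rfl | hj
    · simp [simpleCoroot]
    · have h2 := hc j hj
      have h3 : 0 ≤ x j := h0 j
      simp only [simpleCoroot, Finsupp.smul_single, smul_eq_mul, mul_one]
      rw [Finsupp.single_eq_of_ne hj]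
      omega
  -- Both `x` and `a_i` have norm 2, so a multiple of `a_i` that is real has coefficient `±1`.
  have h2 := form_self hx
  rw [h1] at h2
  simp only [map_smul, LinearMap.smul_apply, smul_eq_mul,
    form_self (isReal_simple b θ i)] at h2
  have h3 : 0 ≤ x i := h0 i
  have h4 : x i = 1 := by nlinarith
  rw [h4, one_smul] at h1
  exact hi h1

lemma simpleReflection_self (i : Idx b) :
    simpleReflection b θ i (simpleCoroot b i) = -simpleCoroot b i := by
  rw [simpleReflection_apply, simplePairing_self]
  module

lemma simpleReflection_apply_of_ne {i j : Idx b} (h : j ≠ i) (x : Lattice b) :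
    simpleReflection b θ i x j = x j := by
  rw [simpleReflection_apply]
  simp [simpleCoroot, Finsupp.single_eq_of_ne h]

lemma simpleReflection_simpleReflection (i : Idx b) (x : Lattice b) :
    simpleReflection b θ i (simpleReflection b θ i x) = x :=
  Module.involutive_reflection (simplePairing_self b θ i) x

/-- A simple reflection permutes the positive real elements other than its own simple coroot. -/
lemma IsReal.simpleReflection_nonneg {x : Lattice b} (hx : IsReal b θ x) (h0 : 0 ≤ x) {i : Idx b}
    (hi : x ≠ simpleCoroot b i) : 0 ≤ simpleReflection b θ i x := by
  obtain ⟨j, hj, hj2⟩ := hx.exists_pos h0 hi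
  refine (isReal_simpleReflection i hx).nonneg_or_nonpos.resolve_right fun h => ?_
  -- The positive coordinate at `j ≠ i` survives the reflection, and real coroots have one sign.
  have h1 := h j
  rw [simpleReflection_apply_of_ne hj] at h1
  have h2 : x j ≤ 0 := h1
  omega

end Positivity

/-! ### Exponents as elements of the positive cone -/

section ToLattice

variable {I : Type*}

lemma toLattice_apply (n : I →₀ ℕ) (i : I) : toLattice n i = n i := rfl

lemma toLattice_injective : Function.Injective (toLattice (I := I)) := by
  intro m n h
  ext i
  have := DFunLike.congr_fun h i
  simpa [toLattice_apply] using this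

lemma toLattice_add (m n : I →₀ ℕ) : toLattice (m + n) = toLattice m + toLattice n := by
  ext i
  simp [toLattice_apply]

lemma toLattice_zero : toLattice (0 : I →₀ ℕ) = 0 := by
  ext i
  simp [toLattice_apply]

lemma toLattice_nonneg (n : I →₀ ℕ) : 0 ≤ toLattice n := fun i => by
  simp [toLattice_apply]

lemma toLattice_le_toLattice {m n : I →₀ ℕ} : toLattice m ≤ toLattice n ↔ m ≤ n := by
  simp only [Finsupp.le_def, toLattice_apply, Nat.cast_le]

lemma exists_toLattice {x : I →₀ ℤ} (hx : 0 ≤ x) : ∃ n, toLattice n = x :=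
  ⟨x.mapRange Int.toNat rfl, by
    ext i
    have : 0 ≤ x i := hx i
    simp [toLattice_apply, this]⟩

lemma toLattice_single (i : I) : toLattice (Finsupp.single i 1) = Finsupp.single i 1 := by
  simp [toLattice]

/-- The sum of the coordinates. -/
def ht : (I →₀ ℤ) →ₗ[ℤ] ℤ := Finsupp.linearCombination ℤ fun _ => 1

lemma ht_toLattice (n : I →₀ ℕ) : ht (toLattice n) = n.degree := by
  simp only [ht, Finsupp.linearCombination_apply, smul_eq_mul, mul_one, Finsupp.degree_apply, Finsupp.sum]
  rw [toLattice, Finsupp.support_mapRange_of_injective _ n Nat.cast_injective]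
  push_cast
  rfl

end ToLattice

/-! ### Length, exchange and inversion sets in the affine Weyl group -/

section Weyl
variable {ι k M N : Type*} [Finite ι] [Field k] [CharZero k] [AddCommGroup M] [Module k M]
  [AddCommGroup N] [Module k N] {P : RootPairing ι k M N} [P.IsRootSystem] [P.IsCrystallographic]
  [P.IsReduced] {b : P.Base} {θ : ι} [hS : SimplyLacedAffine b θ]

lemma weyl_inv_apply_apply (w : weyl b θ) (x : Lattice b) : (w⁻¹).1 (w.1 x) = x :=
  w.1.symm_apply_apply x

lemma weyl_apply_inv_apply (w : weyl b θ) (x : Lattice b) : w.1 ((w⁻¹).1 x) = x :=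
  w.1.apply_symm_apply x

lemma weyl_mul_apply (u w : weyl b θ) (x : Lattice b) : (u * w).1 x = u.1 (w.1 x) := rfl

lemma gen_apply (i : Idx b) (x : Lattice b) : (gen b θ i).1 x = simpleReflection b θ i x := rfl

lemma gen_mul_gen (i : Idx b) : gen b θ i * gen b θ i = 1 := by
  exact inv_eq_iff_mul_eq_one.mp (gen_inv b θ i)

lemma weyl_ext {u w : weyl b θ} (h : ∀ x, u.1 x = w.1 x) : u = w :=
  Subtype.ext (LinearEquiv.ext h)

variable (b θ) in
/-- The product of the simple reflections along a word. -/
def wprod (l : List (Idx b)) : weyl b θ := (l.map (gen b θ)).prod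

@[simp] lemma wprod_nil : wprod b θ [] = 1 := rfl

@[simp] lemma wprod_cons (i : Idx b) (l : List (Idx b)) :
    wprod b θ (i :: l) = gen b θ i * wprod b θ l := by
  simp [wprod]

@[simp] lemma wprod_append (l l' : List (Idx b)) :
    wprod b θ (l ++ l') = wprod b θ l * wprod b θ l' := by
  simp [wprod]

/-- The length of an element of the affine Weyl group. -/
def len (w : weyl b θ) : ℕ := (exists_reducedWord b θ w).choose.length

lemma len_le_length (l : List (Idx b)) : len (wprod b θ l) ≤ l.length :=
  (exists_reducedWord b θ _).choose_spec.2 l rfl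

lemma IsReducedWord.length_eq {l : List (Idx b)} {w : weyl b θ} (h : IsReducedWord b θ l w) :
    l.length = len w :=
  le_antisymm (h.2 _ (exists_reducedWord b θ w).choose_spec.1)
    ((exists_reducedWord b θ w).choose_spec.2 l h.1)

lemma isReducedWord_of_length {l : List (Idx b)} {w : weyl b θ} (h : wprod b θ l = w)
    (h2 : l.length = len w) : IsReducedWord b θ l w :=
  ⟨h, fun l' hl' => by rw [h2, ← hl']; exact len_le_length l'⟩

lemma IsReducedWord.wprod_eq {l : List (Idx b)} {w : weyl b θ} (h : IsReducedWord b θ l w) :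
    wprod b θ l = w := h.1

lemma len_mul_le (u w : weyl b θ) : len (u * w) ≤ len u + len w := by
  obtain ⟨l, hl⟩ := exists_reducedWord b θ u
  obtain ⟨l', hl'⟩ := exists_reducedWord b θ w
  rw [← hl.length_eq, ← hl'.length_eq, ← List.length_append]
  nth_rewrite 1 [← hl.wprod_eq, ← hl'.wprod_eq]
  rw [← wprod_append]
  exact len_le_length _

lemma len_gen_le (i : Idx b) : len (gen b θ i) ≤ 1 := by
  have := len_le_length (θ := θ) [i]
  simpa using this

lemma IsReducedWord.of_append {l l' : List (Idx b)} {w : weyl b θ}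
    (h : IsReducedWord b θ (l ++ l') w) :
    IsReducedWord b θ l (wprod b θ l) ∧ IsReducedWord b θ l' (wprod b θ l') := by
  have h1 := h.length_eq
  rw [← h.wprod_eq, wprod_append, List.length_append] at h1
  have h2 := len_mul_le (wprod b θ l) (wprod b θ l')
  have h3 := len_le_length (θ := θ) l
  have h4 := len_le_length (θ := θ) l'
  exact ⟨isReducedWord_of_length rfl (by omega), isReducedWord_of_length rfl (by omega)⟩

lemma finite_len_le (n : ℕ) : {w : weyl b θ | len w ≤ n}.Finite := by
  refine ((List.finite_length_le (Idx b) n).image (wprod b θ)).subset ?_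
  intro w hw
  obtain ⟨l, hl⟩ := exists_reducedWord b θ w
  exact ⟨l, by rw [Set.mem_ofPred_eq, hl.length_eq]; exact hw, hl.wprod_eq⟩

lemma weyl_realReflection (w : weyl b θ) (x y : Lattice b) :
    w.1 (realReflection b θ x y) = realReflection b θ (w.1 x) (w.1 y) := by
  simp [realReflection, form_weyl]

/-- The exchange condition. -/
lemma exists_word_of_inversion (l : List (Idx b)) {x : Lattice b} (hx : IsReal b θ x) (h0 : 0 ≤ x)
    (hl : ¬ 0 ≤ ((wprod b θ l)⁻¹).1 x) : ∃ l' : List (Idx b), l'.length + 1 = l.length ∧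
      ∀ y, (wprod b θ l').1 y = realReflection b θ x ((wprod b θ l).1 y) := by
  induction l generalizing x with
  | nil => exact absurd h0 (by simpa using hl)
  | cons i l ih =>
    -- If `x` is the coroot of the first letter, delete that letter. Otherwise carry `x` past it; it
    -- stays positive.
    by_cases hi : x = simpleCoroot b i
    · refine ⟨l, rfl, fun y => ?_⟩
      rw [wprod_cons, weyl_mul_apply, hi, realReflection_simple, gen_apply,
        simpleReflection_simpleReflection]
    · obtain ⟨l', h1, h2⟩ := ih (isReal_simpleReflection i hx)
        (hx.simpleReflection_nonneg h0 hi) (by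
          rw [wprod_cons, mul_inv_rev, gen_inv, weyl_mul_apply, gen_apply] at hl
          exact hl)
      refine ⟨i :: l', by simp [h1], fun y => ?_⟩
      rw [wprod_cons, weyl_mul_apply, h2, weyl_realReflection, gen_apply,
        simpleReflection_simpleReflection]
      rfl

lemma len_lt_of_inversion {v w : weyl b θ} {x : Lattice b} (hx : IsReal b θ x) (h0 : 0 ≤ x)
    (hw : ¬ 0 ≤ (w⁻¹).1 x) (hv : ∀ y, v.1 y = realReflection b θ x (w.1 y)) : len v < len w := by
  obtain ⟨l, hl⟩ := exists_reducedWord b θ w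
  obtain ⟨l', h1, h2⟩ := exists_word_of_inversion l hx h0 (by rwa [hl.wprod_eq])
  have h3 : v = wprod b θ l' := weyl_ext fun y => by rw [hv, h2, hl.wprod_eq]
  have h4 := len_le_length (θ := θ) l'
  rw [← h3] at h4
  have := hl.length_eq
  omega

/-- The norm `2 = ∑ x_i ⟨a_i, x⟩` has nonnegative coefficients `x_i`, so some pairing is positive.
Reflecting there lowers the height. -/
lemma exists_form_pos {x : Lattice b} (hx : IsReal b θ x) (h0 : 0 ≤ x) :
    ∃ i, 0 < simplePairing b θ i x := by
  by_contra! hc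
  have h := form_self hx
  rw [form_eq_sum] at h
  have : (x.sum fun i a => a * simplePairing b θ i x) ≤ 0 :=
    Finset.sum_nonpos fun i _ => mul_nonpos_of_nonneg_of_nonpos (h0 i) (hc i)
  omega

/-- The reflection in a positive real coroot `β` is a product of at most `2 ht β` simple
reflections. -/
lemma exists_word_realReflection (n : Idx b →₀ ℕ) (hn : IsReal b θ (toLattice n)) :
    ∃ l : List (Idx b), l.length ≤ 2 * n.degree ∧
      ∀ y, (wprod b θ l).1 y = realReflection b θ (toLattice n) y := by
  induction hd : n.degree using Nat.strong_induction_on generalizing n with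
  | _ d ih =>
    obtain ⟨i, hi⟩ := exists_form_pos hn (toLattice_nonneg n)
    by_cases hni : toLattice n = simpleCoroot b i
    · have h1 : n = Finsupp.single i 1 := toLattice_injective (by rw [hni, toLattice_single]; rfl)
      refine ⟨[i], ?_, fun y => ?_⟩
      · rw [← hd, h1]
        simp
      · rw [hni, realReflection_simple]
        simp [gen_apply]
    · obtain ⟨m, hm⟩ := exists_toLattice (hn.simpleReflection_nonneg (toLattice_nonneg n) hni)
      have hmr : IsReal b θ (toLattice m) := hm ▸ isReal_simpleReflection i hn
      have hmd : m.degree < d := by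
        have h := congrArg ht hm
        rw [simpleReflection_apply, map_sub, map_smul, ht_toLattice, ht_toLattice, hd] at h
        simp only [simpleCoroot, ht, Finsupp.linearCombination_single, smul_eq_mul, mul_one] at h
        omega
      obtain ⟨l, h1, h2⟩ := ih _ hmd m hmr rfl
      refine ⟨i :: (l ++ [i]), by simp; omega, fun y => ?_⟩
      rw [wprod_cons, wprod_append, weyl_mul_apply, weyl_mul_apply, h2, weyl_realReflection, hm]
      simp [gen_apply, simpleReflection_simpleReflection]

/-- This is the price list for the convergence estimate: a change of length by a reflection in `β`
is bounded by the degree of `e^{-β}`. -/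
lemma len_le_of_realReflection {v w : weyl b θ} {n : Idx b →₀ ℕ} (hn : IsReal b θ (toLattice n))
    (hv : ∀ y, v.1 y = realReflection b θ (toLattice n) (w.1 y)) :
    len v ≤ 2 * n.degree + len w := by
  obtain ⟨l, h1, h2⟩ := exists_word_realReflection n hn
  have h3 : v = wprod b θ l * w := weyl_ext fun y => by rw [hv, weyl_mul_apply, h2]
  rw [h3]
  exact (len_mul_le _ _).trans (by have := len_le_length (θ := θ) l; omega)

lemma mul_gen_mul_apply (u w : weyl b θ) (i : Idx b) (y : Lattice b) :
    (u * gen b θ i * w).1 y = realReflection b θ (u.1 (simpleCoroot b i)) ((u * w).1 y) := by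
  rw [weyl_mul_apply u w, ← weyl_realReflection, realReflection_simple]
  rfl

/-- The inversions of `u⁻¹`: the positive real coroots which `u⁻¹` makes negative. -/
def invSet (u : weyl b θ) : Set (Idx b →₀ ℕ) :=
  {n | IsReal b θ (toLattice n) ∧ ¬ 0 ≤ (u⁻¹).1 (toLattice n)}

lemma notMem_invSet_of_eq {u : weyl b θ} {i : Idx b} {n : Idx b →₀ ℕ}
    (hn : u.1 (simpleCoroot b i) = toLattice n) : n ∉ invSet u := by
  intro h
  apply h.2
  rw [← hn, weyl_inv_apply_apply]
  exact simpleCoroot_nonneg i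

/-- A simple reflection permutes the positive real coroots other than its own, so the only sign that
changes is that of `u a_i`. -/
lemma invSet_mul_gen {u : weyl b θ} {i : Idx b} {n : Idx b →₀ ℕ}
    (hn : u.1 (simpleCoroot b i) = toLattice n) : invSet (u * gen b θ i) = insert n (invSet u) := by
  ext m
  have hu : ((u * gen b θ i)⁻¹).1 (toLattice m) =
      simpleReflection b θ i ((u⁻¹).1 (toLattice m)) := by
    rw [mul_inv_rev, gen_inv, weyl_mul_apply, gen_apply]
  rw [Set.mem_insert_iff]
  simp only [invSet, Set.mem_ofPred_eq, hu]
  by_cases hmn : m = n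
  · subst hmn
    simp only [true_or, iff_true]
    refine ⟨hn ▸ isReal_weyl u (isReal_simple b θ i), ?_⟩
    rw [← hn, weyl_inv_apply_apply, simpleReflection_self,
      (isReal_simple b θ i).neg.not_nonneg_iff, neg_nonpos]
    exact simpleCoroot_nonneg i
  · simp only [hmn, false_or]
    refine and_congr_right fun hr => ?_
    have hr' := isReal_weyl u⁻¹ hr
    refine not_congr ⟨fun h => ?_, fun h => ?_⟩
    · have h1 : simpleReflection b θ i ((u⁻¹).1 (toLattice m)) ≠ simpleCoroot b i := by
        intro h2
        have h3 := congrArg (simpleReflection b θ i) h2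
        rw [simpleReflection_simpleReflection, simpleReflection_self] at h3
        have h4 := congrArg u.1 h3
        rw [weyl_apply_inv_apply, map_neg, hn] at h4
        have h5 := toLattice_nonneg m
        rw [h4, neg_nonneg] at h5
        have h6 := le_antisymm h5 (toLattice_nonneg n)
        rw [h6, neg_zero] at h4
        exact hr.ne_zero h4
      have := (isReal_simpleReflection i hr').simpleReflection_nonneg h h1
      rwa [simpleReflection_simpleReflection] at this
    · refine hr'.simpleReflection_nonneg h fun h1 => hmn (toLattice_injective ?_)
      rw [← hn, ← h1, weyl_apply_inv_apply]

lemma invSet_one : invSet (1 : weyl b θ) = ∅ := by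
  ext m
  simp only [invSet, Set.mem_ofPred_eq, Set.mem_empty_iff_false, iff_false, not_and, not_not]
  intro _
  rw [inv_one]
  exact toLattice_nonneg m

lemma exists_weyl_simple_eq (u : weyl b θ) (i : Idx b) :
    ∃ n : Idx b →₀ ℕ, u.1 (simpleCoroot b i) = toLattice n ∨
      (u * gen b θ i).1 (simpleCoroot b i) = toLattice n := by
  rcases (isReal_weyl u (isReal_simple b θ i)).nonneg_or_nonpos with h | h
  · obtain ⟨n, hn⟩ := exists_toLattice h
    exact ⟨n, Or.inl hn.symm⟩
  · obtain ⟨n, hn⟩ := exists_toLattice (neg_nonneg.mpr h)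
    refine ⟨n, Or.inr ?_⟩
    rw [weyl_mul_apply, gen_apply, simpleReflection_self, map_neg, hn]

lemma mul_gen_mul_gen (u : weyl b θ) (i : Idx b) : u * gen b θ i * gen b θ i = u := by
  rw [mul_assoc, gen_mul_gen, mul_one]

lemma gen_mul_gen_mul (u : weyl b θ) (i : Idx b) : gen b θ i * (gen b θ i * u) = u := by
  rw [← mul_assoc, gen_mul_gen, one_mul]

lemma wprod_induction {p : weyl b θ → Prop} (h1 : p 1)
    (h2 : ∀ u i, p u → p (u * gen b θ i)) (u : weyl b θ) : p u := by
  obtain ⟨l, rfl⟩ := exists_word b θ u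
  change p (wprod b θ l)
  induction l using List.reverseRecOn with
  | nil => exact h1
  | append_singleton l i ih =>
    rw [wprod_append]
    have := h2 _ i ih
    simpa using this

lemma invSet_finite (u : weyl b θ) : (invSet u).Finite := by
  induction u using wprod_induction with
  | h1 => rw [invSet_one]; exact Set.finite_empty
  | h2 u i ih =>
    obtain ⟨n, hn | hn⟩ := exists_weyl_simple_eq u i
    · rw [invSet_mul_gen hn]
      exact ih.insert n
    · have h := invSet_mul_gen hn
      rw [mul_gen_mul_gen] at h
      rw [h] at ih
      exact ih.subset (Set.subset_insert _ _)

/-- Along a reduced word each new letter adds exactly one inversion: were `u a_i` negative for a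
prefix `u`, the exchange condition would make `u s_i` shorter than `u`. -/
lemma ncard_invSet (u : weyl b θ) : (invSet u).ncard = len u := by
  obtain ⟨l, hl⟩ := exists_reducedWord b θ u
  rw [← hl.length_eq]
  induction l using List.reverseRecOn generalizing u with
  | nil => rw [← hl.wprod_eq, wprod_nil, invSet_one]; simp
  | append_singleton l i ih =>
    have h1 := ih _ hl.of_append.1
    have h2 := hl.wprod_eq
    rw [wprod_append, wprod_cons, wprod_nil, mul_one] at h2
    have h3 : 0 ≤ (wprod b θ l).1 (simpleCoroot b i) := by
      by_contra hc
      have hr := isReal_weyl (wprod b θ l) (isReal_simple b θ i)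
      have hlt := len_lt_of_inversion (v := wprod b θ l * gen b θ i) (w := wprod b θ l)
        (x := -(wprod b θ l).1 (simpleCoroot b i)) hr.neg
        (neg_nonneg.mpr (hr.not_nonneg_iff.mp hc)) (by
          rw [map_neg, weyl_inv_apply_apply, (isReal_simple b θ i).neg.not_nonneg_iff, neg_nonpos]
          exact simpleCoroot_nonneg i) (fun y => by
          have := mul_gen_mul_apply (wprod b θ l) 1 i y
          rw [mul_one, mul_one] at this
          rw [this, realReflection, realReflection]
          simp)
      rw [h2, ← hl.length_eq, List.length_append] at hlt
      have := len_le_length (θ := θ) l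
      omega
    obtain ⟨n, hn⟩ := exists_toLattice h3
    rw [← h2, invSet_mul_gen hn.symm,
      Set.ncard_insert_of_notMem (notMem_invSet_of_eq hn.symm) (invSet_finite _), h1,
      List.length_append]
    rfl

lemma len_mul_gen {u : weyl b θ} {i : Idx b} (h : 0 ≤ u.1 (simpleCoroot b i)) :
    len (u * gen b θ i) = len u + 1 := by
  obtain ⟨n, hn⟩ := exists_toLattice h
  rw [← ncard_invSet, ← ncard_invSet, invSet_mul_gen hn.symm,
    Set.ncard_insert_of_notMem (notMem_invSet_of_eq hn.symm) (invSet_finite _)]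

lemma mul_gen_apply_simple (u : weyl b θ) (i : Idx b) :
    (u * gen b θ i).1 (simpleCoroot b i) = -u.1 (simpleCoroot b i) := by
  rw [weyl_mul_apply, gen_apply, simpleReflection_self, map_neg]

lemma len_gen_mul_lt {u : weyl b θ} {i : Idx b} (h : ¬ 0 ≤ (u⁻¹).1 (simpleCoroot b i)) :
    len (gen b θ i * u) + 1 = len u := by
  have h1 := len_lt_of_inversion (v := gen b θ i * u) (isReal_simple b θ i) (simpleCoroot_nonneg i)
    h fun y => by rw [realReflection_simple]; rfl
  have h2 := len_mul_le (gen b θ i) (gen b θ i * u)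
  rw [gen_mul_gen_mul] at h2
  have := len_gen_le (θ := θ) i
  omega

lemma inv_gen_mul_apply_simple (u : weyl b θ) (i : Idx b) :
    ((gen b θ i * u)⁻¹).1 (simpleCoroot b i) = -(u⁻¹).1 (simpleCoroot b i) := by
  rw [mul_inv_rev, gen_inv, mul_gen_apply_simple]

lemma len_gen_mul {u : weyl b θ} {i : Idx b} (h : 0 ≤ (u⁻¹).1 (simpleCoroot b i)) :
    len (gen b θ i * u) = len u + 1 := by
  have h1 : ¬ 0 ≤ ((gen b θ i * u)⁻¹).1 (simpleCoroot b i) := by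
    rw [inv_gen_mul_apply_simple,
      (isReal_weyl u⁻¹ (isReal_simple b θ i)).neg.not_nonneg_iff, neg_nonpos]
    exact h
  have h2 := len_gen_mul_lt h1
  rw [gen_mul_gen_mul] at h2
  exact h2.symm

end Weyl

/-! ### Rational function identities behind the braid relation -/

section RatFun

variable {I : Type*}

lemma rexp_add (x y : I →₀ ℤ) : rexp (x + y) = rexp x * rexp y := by
  rw [rexp, rexp, rexp, ← map_mul, AddMonoidAlgebra.single_mul_single, mul_one]

lemma rexp_zero : rexp (0 : I →₀ ℤ) = 1 := by
  rw [rexp]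
  exact map_one _

lemma rexp_neg_mul (x : I →₀ ℤ) : rexp (-x) * rexp x = 1 := by
  rw [← rexp_add, neg_add_cancel, rexp_zero]

lemma rexp_ne_zero (x : I →₀ ℤ) : rexp x ≠ 0 := fun h => by
  have := rexp_neg_mul x
  rw [h, mul_zero] at this
  exact zero_ne_one this

lemma rexp_neg (x : I →₀ ℤ) : rexp (-x) = (rexp x)⁻¹ :=
  eq_inv_of_mul_eq_one_left (rexp_neg_mul x)

lemma rexp_injective : Function.Injective (rexp (I := I)) := by
  intro x y h
  have h2 := IsFractionRing.injective (Laurent I) (RatFun I) h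
  have h3 := congrArg (fun p => p.coeff x) h2
  by_contra hxy
  simp [Finsupp.single_eq_of_ne hxy] at h3

lemma one_sub_rexp_ne_zero {x : I →₀ ℤ} (hx : x ≠ 0) : 1 - rexp x ≠ 0 := by
  rw [sub_ne_zero, ← rexp_zero]
  exact fun h => hx (rexp_injective h).symm

lemma smul_algebraMap_laurent (g : (I →₀ ℤ) ≃ₗ[ℤ] (I →₀ ℤ)) (p : Laurent I) :
    g • algebraMap (Laurent I) (RatFun I) p = algebraMap (Laurent I) (RatFun I) (g • p) := by
  change IsFractionRing.ringEquivOfRingEquiv _ _ = _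
  rw [IsFractionRing.ringEquivOfRingEquiv_algebraMap]
  rfl

lemma smul_single_laurent (g : (I →₀ ℤ) ≃ₗ[ℤ] (I →₀ ℤ)) (x : I →₀ ℤ) (r : ℂ[X]) :
    g • (AddMonoidAlgebra.single x r : Laurent I) = AddMonoidAlgebra.single (g x) r := by
  change AddMonoidAlgebra.domCongr ℂ[X] ℂ[X] g.toAddEquiv _ = _
  rw [AddMonoidAlgebra.domCongr_single]
  rfl

lemma coeff_smul_laurent (g : (I →₀ ℤ) ≃ₗ[ℤ] (I →₀ ℤ)) (p : Laurent I) (x : I →₀ ℤ) :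
    (g • p).coeff (g x) = p.coeff x := by
  change (AddMonoidAlgebra.domCongr ℂ[X] ℂ[X] g.toAddEquiv p).coeff (g x) = _
  rw [AddMonoidAlgebra.coeff_domCongr]
  exact congrArg p.coeff (g.symm_apply_apply x)

lemma smul_rexp (g : (I →₀ ℤ) ≃ₗ[ℤ] (I →₀ ℤ)) (x : I →₀ ℤ) : g • rexp x = rexp (g x) := by
  rw [rexp, smul_algebraMap_laurent, smul_single_laurent, rexp]

lemma smul_vinv (g : (I →₀ ℤ) ≃ₗ[ℤ] (I →₀ ℤ)) : g • (vinv : RatFun I) = vinv := by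
  rw [vinv, smul_algebraMap_laurent, smul_single_laurent, map_zero]

lemma smul_cFun (g : (I →₀ ℤ) ≃ₗ[ℤ] (I →₀ ℤ)) (x : I →₀ ℤ) : g • cFun x = cFun (g x) := by
  simp only [cFun, div_eq_mul_inv, smul_mul', smul_inv'', smul_sub, smul_one, smul_rexp, smul_vinv,
    map_neg]

lemma smul_bFun (g : (I →₀ ℤ) ≃ₗ[ℤ] (I →₀ ℤ)) (x : I →₀ ℤ) : g • bFun x = bFun (g x) := by
  simp only [bFun, div_eq_mul_inv, smul_mul', smul_inv'', smul_sub, smul_one, smul_rexp, smul_vinv]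

/-- In `T_i T_j T_i` the group element `s_i` arises in two ways; this merges the two contributions.
-/
lemma bFun_braid {x y : I →₀ ℤ} (hx : x ≠ 0) (hy : y ≠ 0) (hxy : x + y ≠ 0) :
    bFun (x + y) * bFun (-x) + bFun x * bFun y = bFun y * bFun (x + y) := by
  have h1 := one_sub_rexp_ne_zero hx
  have h2 := one_sub_rexp_ne_zero hy
  have h3 := one_sub_rexp_ne_zero hxy
  have h4 := one_sub_rexp_ne_zero (neg_ne_zero.mpr hx)
  have h5 := rexp_ne_zero x
  simp only [bFun, rexp_add, rexp_neg] at *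
  have h6 : (1 - (rexp x)⁻¹) = -(1 - rexp x) / rexp x := by field_simp; ring
  rw [h6]
  field_simp
  ring

/-- The coefficient of the identity in `T_i T_j T_i` is symmetric in `i` and `j`. -/
lemma cFun_bFun_braid {x y : I →₀ ℤ} (hx : x ≠ 0) (hy : y ≠ 0) (hxy : x + y ≠ 0) :
    cFun x * bFun (x + y) * cFun (-x) + bFun x * bFun y * bFun x =
      cFun y * bFun (x + y) * cFun (-y) + bFun y * bFun x * bFun y := by
  have h1 := one_sub_rexp_ne_zero hx
  have h2 := one_sub_rexp_ne_zero hy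
  have h3 := one_sub_rexp_ne_zero hxy
  have h4 := rexp_ne_zero x
  have h5 := rexp_ne_zero y
  simp only [bFun, cFun, rexp_add, rexp_neg, neg_neg] at *
  have h6 : (1 - (rexp x)⁻¹) = -(1 - rexp x) / rexp x := by field_simp; ring
  have h7 : (1 - (rexp y)⁻¹) = -(1 - rexp y) / rexp y := by field_simp; ring
  rw [h6, h7]
  field_simp
  ring

end RatFun

/-! ### Braid relations and independence of the reduced word -/

section Hecke
variable {ι k M N : Type*} [Finite ι] [Field k] [CharZero k] [AddCommGroup M] [Module k M]
  [AddCommGroup N] [Module k N] {P : RootPairing ι k M N} [P.IsRootSystem] [P.IsCrystallographic]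
  [P.IsReduced] {b : P.Base} {θ : ι} [hS : SimplyLacedAffine b θ]

open SkewMonoidAlgebra

lemma weyl_smul_cFun (w : weyl b θ) (x : Lattice b) : w • cFun x = cFun (w.1 x) := smul_cFun w.1 x

lemma weyl_smul_bFun (w : weyl b θ) (x : Lattice b) : w • bFun x = bFun (w.1 x) := smul_bFun w.1 x

lemma simpleCoroot_ne_zero (i : Idx b) : simpleCoroot b i ≠ 0 := by simp [simpleCoroot]

lemma simplePairing_simple_comm (i j : Idx b) : simplePairing b θ i (simpleCoroot b j) =
    simplePairing b θ j (simpleCoroot b i) := by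
  rw [← form_simple, ← form_simple, form_comm]

lemma gen_comm {i j : Idx b} (h : simplePairing b θ i (simpleCoroot b j) = 0) :
    gen b θ i * gen b θ j = gen b θ j * gen b θ i := by
  refine weyl_ext fun x => ?_
  have h' := simplePairing_simple_comm (θ := θ) i j
  simp only [weyl_mul_apply, gen_apply, simpleReflection_apply, map_sub, map_smul, ← h', h]
  module

lemma simpleT_comm {i j : Idx b} (h : simplePairing b θ i (simpleCoroot b j) = 0) :
    simpleT b θ i * simpleT b θ j = simpleT b θ j * simpleT b θ i := by
  have h' := simplePairing_simple_comm (θ := θ) i j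
  have h1 : simpleReflection b θ i (simpleCoroot b j) = simpleCoroot b j := by
    rw [simpleReflection_apply, h, zero_smul, sub_zero]
  have h2 : simpleReflection b θ j (simpleCoroot b i) = simpleCoroot b i := by
    rw [simpleReflection_apply, ← h', h, zero_smul, sub_zero]
  simp only [simpleT, mul_add, add_mul, single_mul_single, weyl_smul_cFun, weyl_smul_bFun,
    gen_apply, h1, h2, one_smul, mul_one, one_mul, gen_comm h]
  rw [mul_comm (cFun (simpleCoroot b i)), mul_comm (bFun (simpleCoroot b i)),
    mul_comm (bFun (simpleCoroot b i)), mul_comm (cFun (simpleCoroot b i))]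
  abel

lemma gen_braid {i j : Idx b} (h : simplePairing b θ i (simpleCoroot b j) = -1) :
    gen b θ i * gen b θ j * gen b θ i = gen b θ j * gen b θ i * gen b θ j := by
  refine weyl_ext fun x => ?_
  have h' := simplePairing_simple_comm (θ := θ) i j
  simp only [weyl_mul_apply, gen_apply, simpleReflection_apply, map_sub, map_smul, ← h', h,
    simplePairing_self]
  module

/-- In this form exchanging `i` and `j` visibly permutes the terms, except for the coefficient of
`1`, which `cFun_bFun_braid` handles. -/
lemma simpleT_mul_mul {i j : Idx b} (h : simplePairing b θ i (simpleCoroot b j) = -1) :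
    simpleT b θ i * simpleT b θ j * simpleT b θ i =
      single (gen b θ i * gen b θ j * gen b θ i) (cFun (simpleCoroot b i) *
        cFun (simpleCoroot b j) * cFun (simpleCoroot b i + simpleCoroot b j)) +
      single (gen b θ i * gen b θ j) (cFun (simpleCoroot b i) *
        bFun (simpleCoroot b j) * cFun (simpleCoroot b i + simpleCoroot b j)) +
      single (gen b θ j * gen b θ i) (cFun (simpleCoroot b j) *
        bFun (simpleCoroot b i) * cFun (simpleCoroot b i + simpleCoroot b j)) +
      single (gen b θ i) (cFun (simpleCoroot b i) *
        bFun (simpleCoroot b j) * bFun (simpleCoroot b i + simpleCoroot b j)) +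
      single (gen b θ j) (cFun (simpleCoroot b j) *
        bFun (simpleCoroot b i) * bFun (simpleCoroot b i + simpleCoroot b j)) +
      single 1 (cFun (simpleCoroot b i) * bFun (simpleCoroot b i + simpleCoroot b j) *
        cFun (-simpleCoroot b i) + bFun (simpleCoroot b i) * bFun (simpleCoroot b j) *
          bFun (simpleCoroot b i)) := by
  have h' := simplePairing_simple_comm (θ := θ) i j
  have h1 : simpleReflection b θ i (simpleCoroot b j) = simpleCoroot b i + simpleCoroot b j := by
    rw [simpleReflection_apply, h]
    module
  have h2 : simpleReflection b θ j (simpleCoroot b i) = simpleCoroot b i + simpleCoroot b j := by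
    rw [simpleReflection_apply, ← h', h]
    module
  have h3 := simpleReflection_self (θ := θ) i
  have h0 : simpleCoroot b i + simpleCoroot b j ≠ 0 := by
    intro h0
    have h4 := congrArg (simplePairing b θ i) h0
    rw [map_add, simplePairing_self, h, map_zero] at h4
    omega
  have hb := bFun_braid (simpleCoroot_ne_zero i) (simpleCoroot_ne_zero j) h0
  simp only [simpleT, mul_add, add_mul, single_mul_single, weyl_smul_cFun, weyl_smul_bFun,
    gen_apply, weyl_mul_apply, h1, h2, h3, map_add, one_smul, mul_one, one_mul, gen_mul_gen,
    single_add]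
  rw [neg_add_cancel_left]
  have e1 : single (gen b θ i) (cFun (simpleCoroot b i) *
        bFun (simpleCoroot b j) * bFun (simpleCoroot b i + simpleCoroot b j)) =
      single (gen b θ i) (cFun (simpleCoroot b i) * bFun (simpleCoroot b i + simpleCoroot b j) *
        bFun (-simpleCoroot b i)) + single (gen b θ i) (bFun (simpleCoroot b i) *
          bFun (simpleCoroot b j) * cFun (simpleCoroot b i)) := by
    rw [← single_add]
    congr 1
    rw [mul_assoc, ← hb]
    ring
  rw [e1, mul_right_comm (cFun (simpleCoroot b i)) (cFun (simpleCoroot b j)),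
    mul_right_comm (cFun (simpleCoroot b i)) (bFun (simpleCoroot b j)),
    mul_comm (cFun (simpleCoroot b j)) (bFun (simpleCoroot b i))]
  abel

lemma simpleT_braid {i j : Idx b} (h : simplePairing b θ i (simpleCoroot b j) = -1) :
    simpleT b θ i * simpleT b θ j * simpleT b θ i =
      simpleT b θ j * simpleT b θ i * simpleT b θ j := by
  have h' := simplePairing_simple_comm (θ := θ) i j
  have h0 : simpleCoroot b i + simpleCoroot b j ≠ 0 := by
    intro h0
    have h4 := congrArg (simplePairing b θ i) h0
    rw [map_add, simplePairing_self, h, map_zero] at h4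
    omega
  have hc := cFun_bFun_braid (simpleCoroot_ne_zero i) (simpleCoroot_ne_zero j) h0
  rw [simpleT_mul_mul h, simpleT_mul_mul (h' ▸ h), hc, gen_braid h,
    add_comm (simpleCoroot b j) (simpleCoroot b i),
    mul_comm (cFun (simpleCoroot b j)) (cFun (simpleCoroot b i))]
  abel

lemma wordT_cons (i : Idx b) (l : List (Idx b)) :
    wordT b θ (i :: l) = simpleT b θ i * wordT b θ l := by
  simp [wordT]

lemma wordT_append_singleton (l : List (Idx b)) (i : Idx b) :
    wordT b θ (l ++ [i]) = wordT b θ l * simpleT b θ i := by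
  simp [wordT]

/-- If two distinct simple reflections both shorten `w` on the left, their coroots pair to `0` or
`-1`. -/
lemma simplePairing_mem_of_descents {i j : Idx b} (hij : i ≠ j) {w : weyl b θ}
    (hi : ¬ 0 ≤ (w⁻¹).1 (simpleCoroot b i)) (hj : ¬ 0 ≤ (w⁻¹).1 (simpleCoroot b j)) :
    simplePairing b θ i (simpleCoroot b j) = 0 ∨ simplePairing b θ i (simpleCoroot b j) = -1 := by
  have hne : simpleCoroot b j ≠ simpleCoroot b i := by
    intro h
    exact hij (Finsupp.single_left_injective one_ne_zero h).symm
  have h1 : simplePairing b θ i (simpleCoroot b j) ≤ 0 := by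
    have h2 := (isReal_simple b θ j).simpleReflection_nonneg (simpleCoroot_nonneg j) hne i
    rw [simpleReflection_apply] at h2
    simp [simpleCoroot, Finsupp.single_eq_of_ne hij] at h2
    exact h2
  have h2 : -2 < simplePairing b θ i (simpleCoroot b j) := by
    by_contra hc
    have hri := isReal_weyl w⁻¹ (isReal_simple b θ i)
    have hrj := isReal_weyl w⁻¹ (isReal_simple b θ j)
    have hA : P.pairingIn ℤ (node b θ i) (node b θ j) = simplePairing b θ i (simpleCoroot b j) := by
      simp [simplePairing, simpleCoroot]
    have hB : P.pairingIn ℤ (node b θ j) (node b θ i) = simplePairing b θ i (simpleCoroot b j) := by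
      rw [simplePairing_simple_comm]
      simp [simplePairing, simpleCoroot]
    have h3 := P.pairingIn_pairingIn_mem_set_of_isCrystal_of_isRed (node b θ i) (node b θ j)
    rw [hA, hB] at h3
    have h4 : simplePairing b θ i (simpleCoroot b j) = -2 := by
      simp only [Set.mem_insert_iff, Prod.mk.injEq, Set.mem_singleton_iff] at h3
      omega
    rw [h4] at hA
    have h5 : P.pairing (node b θ i) (node b θ j) = -2 := by
      rw [← P.algebraMap_pairingIn ℤ, hA]
      simp
    rw [h4] at hB
    have h5' : P.pairing (node b θ j) (node b θ i) = -2 := by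
      rw [← P.algebraMap_pairingIn ℤ, hB]
      simp
    -- Pairing `-2` makes the finite parts opposite, so `a_i^∨ + a_j^∨` is imaginary and fixed by
    -- `w⁻¹`, although `w⁻¹` makes both summands negative.
    have h6 : P.coroot (node b θ i) = -P.coroot (node b θ j) := by
      exact (P.flip.pairing_neg_two_neg_two_iff (node b θ i) (node b θ j)).mp ⟨h5', h5⟩
    have h7 : finPart b θ (simpleCoroot b i + simpleCoroot b j) = 0 := by
      rw [map_add, finPart_simple, finPart_simple, h6, neg_add_cancel]
    have h8 := weyl_apply_of_finPart_eq_zero w⁻¹ h7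
    rw [map_add] at h8
    have h9 : simpleCoroot b i + simpleCoroot b j ≤ 0 := by
      rw [← h8]
      exact add_nonpos (hri.not_nonneg_iff.mp hi) (hrj.not_nonneg_iff.mp hj)
    have h10 := h9 i
    simp [simpleCoroot, Finsupp.single_eq_of_ne hij] at h10
  omega

lemma IsReducedWord.cons {i : Idx b} {l : List (Idx b)} {w : weyl b θ}
    (hl : IsReducedWord b θ l (gen b θ i * w)) (h : ¬ 0 ≤ (w⁻¹).1 (simpleCoroot b i)) :
    IsReducedWord b θ (i :: l) w :=
  isReducedWord_of_length (by rw [wprod_cons, hl.wprod_eq, gen_mul_gen_mul])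
    (by rw [List.length_cons, hl.length_eq, len_gen_mul_lt h])

lemma IsReducedWord.tail {i : Idx b} {l : List (Idx b)} {w : weyl b θ}
    (hl : IsReducedWord b θ (i :: l) w) : IsReducedWord b θ l (gen b θ i * w) := by
  have h1 := (IsReducedWord.of_append (l := [i]) hl).2
  rw [← hl.wprod_eq, wprod_cons, gen_mul_gen_mul]
  exact h1

lemma IsReducedWord.not_nonneg {i : Idx b} {l : List (Idx b)} {w : weyl b θ}
    (hl : IsReducedWord b θ (i :: l) w) : ¬ 0 ≤ (w⁻¹).1 (simpleCoroot b i) := by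
  intro h
  have h1 := len_gen_mul h
  have h2 := hl.length_eq
  have h3 := hl.tail.length_eq
  rw [List.length_cons] at h2
  omega

/-- The product of the `T_a` along a reduced word depends only on the group element. -/
lemma wordT_eq_of_isReducedWord {w : weyl b θ} {l l' : List (Idx b)}
    (hl : IsReducedWord b θ l w) (hl' : IsReducedWord b θ l' w) :
    wordT b θ l = wordT b θ l' := by
  induction hn : len w using Nat.strong_induction_on generalizing w l l' with
  | _ n ih =>
    have e1 := hl.length_eq
    have e2 := hl'.length_eq
    match l, l' with
    | [], [] => rfl
    | [], j :: l' => simp at e1 e2; omega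
    | i :: l, [] => simp at e1 e2; omega
    | i :: l, j :: l' =>
      have hi := hl.not_nonneg
      have hj := hl'.not_nonneg
      have hli := len_gen_mul_lt hi
      have hlj := len_gen_mul_lt hj
      by_cases hij : i = j
      · subst hij
        rw [wordT_cons, wordT_cons, ih (len (gen b θ i * w)) (by omega) hl.tail hl'.tail rfl]
      -- Both first letters are descents, so `w` also has reduced words beginning with the two sides
      -- of the braid relation of `i` and `j` and ending in a common `m`. Induction compares each
      -- given word with the one sharing its first letter.
      rcases simplePairing_mem_of_descents hij hi hj with h | h
      · have hji := (simplePairing_simple_comm (θ := θ) i j).symm.trans h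
        have h1 : ¬ 0 ≤ ((gen b θ i * w)⁻¹).1 (simpleCoroot b j) := by
          rwa [mul_inv_rev, gen_inv, weyl_mul_apply, gen_apply, simpleReflection_apply, h,
            zero_smul, sub_zero]
        have h2 : ¬ 0 ≤ ((gen b θ j * w)⁻¹).1 (simpleCoroot b i) := by
          rwa [mul_inv_rev, gen_inv, weyl_mul_apply, gen_apply, simpleReflection_apply, hji,
            zero_smul, sub_zero]
        obtain ⟨m, hm⟩ := exists_reducedWord b θ (gen b θ j * (gen b θ i * w))
        have hm' : IsReducedWord b θ m (gen b θ i * (gen b θ j * w)) := by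
          rwa [← mul_assoc, gen_comm h, mul_assoc]
        rw [wordT_cons, wordT_cons, ih _ (by omega) hl.tail (hm.cons h1) rfl,
          ih _ (by omega) hl'.tail (hm'.cons h2) rfl, wordT_cons, wordT_cons, ← mul_assoc,
          ← mul_assoc, simpleT_comm h]
      · have hji := (simplePairing_simple_comm (θ := θ) i j).symm.trans h
        have hri := isReal_weyl w⁻¹ (isReal_simple b θ i)
        have hrj := isReal_weyl w⁻¹ (isReal_simple b θ j)
        have hsij : simpleReflection b θ i (simpleCoroot b j) =
            simpleCoroot b i + simpleCoroot b j := by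
          rw [simpleReflection_apply, h]
          module
        have hsji : simpleReflection b θ j (simpleCoroot b i) =
            simpleCoroot b i + simpleCoroot b j := by
          rw [simpleReflection_apply, hji]
          module
        have hsum : ¬ 0 ≤ (w⁻¹).1 (simpleCoroot b i + simpleCoroot b j) := by
          have h3 : IsReal b θ (simpleCoroot b i + simpleCoroot b j) := by
            rw [← hsij]
            exact isReal_simpleReflection i (isReal_simple b θ j)
          rw [(isReal_weyl w⁻¹ h3).not_nonneg_iff, map_add]
          exact add_nonpos (hri.not_nonneg_iff.mp hi) (hrj.not_nonneg_iff.mp hj)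
        have h1 : ¬ 0 ≤ ((gen b θ i * w)⁻¹).1 (simpleCoroot b j) := by
          rwa [mul_inv_rev, gen_inv, weyl_mul_apply, gen_apply, hsij]
        have h2 : ¬ 0 ≤ ((gen b θ j * w)⁻¹).1 (simpleCoroot b i) := by
          rwa [mul_inv_rev, gen_inv, weyl_mul_apply, gen_apply, hsji]
        have h3 : ¬ 0 ≤ ((gen b θ j * (gen b θ i * w))⁻¹).1 (simpleCoroot b i) := by
          rwa [mul_inv_rev, mul_inv_rev, gen_inv, gen_inv, weyl_mul_apply, weyl_mul_apply,
            gen_apply, gen_apply, hsji, map_add, simpleReflection_self, hsij, neg_add_cancel_left]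
        have h4 : ¬ 0 ≤ ((gen b θ i * (gen b θ j * w))⁻¹).1 (simpleCoroot b j) := by
          rwa [mul_inv_rev, mul_inv_rev, gen_inv, gen_inv, weyl_mul_apply, weyl_mul_apply,
            gen_apply, gen_apply, hsij, map_add, simpleReflection_self, hsji,
            add_neg_cancel_right]
        obtain ⟨m, hm⟩ := exists_reducedWord b θ (gen b θ i * (gen b θ j * (gen b θ i * w)))
        have hm' : IsReducedWord b θ m (gen b θ j * (gen b θ i * (gen b θ j * w))) := by
          rwa [← mul_assoc, ← mul_assoc, ← gen_braid h, mul_assoc, mul_assoc]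
        rw [wordT_cons, wordT_cons, ih _ (by omega) hl.tail ((hm.cons h3).cons h1) rfl,
          ih _ (by omega) hl'.tail ((hm'.cons h4).cons h2) rfl, wordT_cons, wordT_cons, wordT_cons,
          wordT_cons, ← mul_assoc, ← mul_assoc, ← mul_assoc, ← mul_assoc, simpleT_braid h]

lemma wordT_eq_elemT {w : weyl b θ} {l : List (Idx b)} (hl : IsReducedWord b θ l w) :
    wordT b θ l = elemT b θ w :=
  wordT_eq_of_isReducedWord hl (exists_reducedWord b θ w).choose_spec

lemma elemT_gen_mul {w : weyl b θ} {i : Idx b} (h : 0 ≤ (w⁻¹).1 (simpleCoroot b i)) :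
    elemT b θ (gen b θ i * w) = simpleT b θ i * elemT b θ w := by
  obtain ⟨l, hl⟩ := exists_reducedWord b θ w
  rw [← wordT_eq_elemT hl, ← wordT_cons]
  refine (wordT_eq_elemT (isReducedWord_of_length ?_ ?_)).symm
  · rw [wprod_cons, hl.wprod_eq]
  · rw [List.length_cons, hl.length_eq, len_gen_mul h]

end Hecke

/-! ### Expansions of the basic rational functions -/

section Series

variable {I : Type*}

/-- The monomial `e^{-n}`. -/
def mono (n : I →₀ ℕ) : Qfin I := MvPowerSeries.monomial n 1

/-- The constant `v⁻¹`. -/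
def qC : Qfin I := MvPowerSeries.C X

/-- The expansion of `(1 - e^{-n})⁻¹`. -/
def geom (n : I →₀ ℕ) : Qfin I := MvPowerSeries.invOfUnit (1 - mono n) 1

lemma mono_add (m n : I →₀ ℕ) : mono (m + n) = mono m * mono n := by
  rw [mono, mono, mono, MvPowerSeries.monomial_mul_monomial, mul_one]

lemma mono_zero : mono (0 : I →₀ ℕ) = 1 := rfl

lemma mono_ne_zero (n : I →₀ ℕ) : mono n ≠ 0 := fun h => by
  classical
  have := congrArg (MvPowerSeries.coeff n) h
  simp [mono] at this

lemma one_sub_mono_mul_geom {n : I →₀ ℕ} (hn : n ≠ 0) : (1 - mono n) * geom n = 1 := by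
  classical
  refine MvPowerSeries.mul_invOfUnit _ _ ?_
  rw [map_sub, map_one, mono, ← MvPowerSeries.coeff_zero_eq_constantCoeff_apply,
    MvPowerSeries.coeff_monomial, if_neg hn.symm]
  simp

lemma le_of_coeff_mono_mul_ne_zero {m n : I →₀ ℕ} {f : Qfin I}
    (h : MvPowerSeries.coeff m (mono n * f) ≠ 0) : n ≤ m := by
  by_contra hc
  rw [mono, MvPowerSeries.coeff_monomial_mul, if_neg hc] at h
  exact h rfl

lemma exists_coeff_ne_zero_of_mul {n : I →₀ ℕ} {f g : Qfin I}
    (h : MvPowerSeries.coeff n (f * g) ≠ 0) : ∃ m₁ m₂, m₁ + m₂ = n ∧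
      MvPowerSeries.coeff m₁ f ≠ 0 ∧ MvPowerSeries.coeff m₂ g ≠ 0 := by
  classical
  rw [MvPowerSeries.coeff_mul] at h
  obtain ⟨p, hp, hp2⟩ := Finset.exists_ne_zero_of_sum_ne_zero h
  exact ⟨p.1, p.2, Finset.HasAntidiagonal.mem_antidiagonal.mp hp, left_ne_zero_of_mul hp2,
    right_ne_zero_of_mul hp2⟩

lemma laurentToFrac_single (x : I →₀ ℤ) (r : ℂ[X]) :
    laurentToFrac (AddMonoidAlgebra.single x r) = r • expo (Multiplicative.ofAdd x) :=
  AddMonoidAlgebra.lift_single _ _ _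

lemma ratToFrac_algebraMap (p : Laurent I) :
    ratToFrac (algebraMap (Laurent I) (RatFun I) p) = laurentToFrac p :=
  IsFractionRing.lift_algebraMap _ _

lemma expo_neg_toLattice (n : I →₀ ℕ) : expo (Multiplicative.ofAdd (-toLattice n)) =
    algebraMap (Qfin I) (FractionRing (Qfin I)) (mono n) := by
  have h := expo_mul_pow (-toLattice n) 0 n.support (by
    intro i hi
    simpa [toLattice_apply] using hi) (fun i => by simp [toLattice_apply])
  simp only [pow_zero, Finset.prod_const_one, mul_one] at h
  have h2 : (Finsupp.indicator n.support fun i _ => (((0 : ℕ) : ℤ) - (-toLattice n) i).toNat) =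
      n := by
    ext i
    by_cases hi : i ∈ n.support
    · simp [Finsupp.indicator_of_mem hi, toLattice_apply]
    · rw [Finsupp.indicator_of_notMem hi]
      simpa using (Finsupp.notMem_support_iff.mp hi).symm
  rw [h, mono, h2]

lemma expands_rexp (n : I →₀ ℕ) : Expands (rexp (-toLattice n)) (mono n) := by
  rw [Expands, rexp, ratToFrac_algebraMap, laurentToFrac_single, expo_neg_toLattice, one_smul]

lemma expands_vinv : Expands (vinv : RatFun I) qC := by
  rw [Expands, vinv, ratToFrac_algebraMap, laurentToFrac_single, ofAdd_zero, map_one, qC,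
    Algebra.smul_def, mul_one, IsScalarTower.algebraMap_apply ℂ[X] (Qfin I)]
  rfl

lemma Expands.add {f f' : RatFun I} {g g' : Qfin I} (h : Expands f g) (h' : Expands f' g') :
    Expands (f + f') (g + g') := by
  rw [Expands, map_add, map_add, h, h']

lemma Expands.sub {f f' : RatFun I} {g g' : Qfin I} (h : Expands f g) (h' : Expands f' g') :
    Expands (f - f') (g - g') := by
  rw [Expands, map_sub, map_sub, h, h']

lemma Expands.neg {f : RatFun I} {g : Qfin I} (h : Expands f g) : Expands (-f) (-g) := by
  rw [Expands, map_neg, map_neg, h]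

lemma Expands.mul {f f' : RatFun I} {g g' : Qfin I} (h : Expands f g) (h' : Expands f' g') :
    Expands (f * f') (g * g') := by
  rw [Expands, map_mul, map_mul, h, h']

lemma expands_one : Expands (1 : RatFun I) 1 := by
  rw [Expands, map_one, map_one]

lemma expands_zero : Expands (0 : RatFun I) 0 := by
  rw [Expands, map_zero, map_zero]

lemma Expands.unique {f : RatFun I} {g g' : Qfin I} (h : Expands f g) (h' : Expands f g') :
    g = g' :=
  IsFractionRing.injective (Qfin I) (FractionRing (Qfin I)) (h.symm.trans h')

lemma Expands.expansion {f : RatFun I} {g : Qfin I} (h : Expands f g) : Expands f (expansion f) := by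
  have h' : ∃ g, Expands f g := ⟨g, h⟩
  rw [AffineCS.expansion, dif_pos h']
  exact h'.choose_spec

lemma Expands.expansion_eq {f : RatFun I} {g : Qfin I} (h : Expands f g) : AffineCS.expansion f = g :=
  h.expansion.unique h

/-- An expansion can be computed after multiplication by a nonzero series. -/
lemma Expands.of_mul_left {f a : RatFun I} {g c : Qfin I} (ha : Expands a c) (hc : c ≠ 0)
    (h : Expands (a * f) (c * g)) : Expands f g := by
  rw [Expands, map_mul, map_mul, ha] at h
  exact mul_left_cancel₀ ((map_ne_zero_iff _
    (IsFractionRing.injective (Qfin I) (FractionRing (Qfin I)))).mpr hc) h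

lemma one_sub_mono_ne_zero {n : I →₀ ℕ} (hn : n ≠ 0) : (1 - mono n : Qfin I) ≠ 0 := fun h => by
  have := one_sub_mono_mul_geom hn
  rw [h, zero_mul] at this
  exact zero_ne_one this

lemma toLattice_ne_zero {n : I →₀ ℕ} (hn : n ≠ 0) : toLattice n ≠ 0 := fun h =>
  hn (toLattice_injective (h.trans toLattice_zero.symm))

lemma expands_inv_one_sub_rexp_neg {n : I →₀ ℕ} (hn : n ≠ 0) :
    Expands (1 - rexp (-toLattice n))⁻¹ (geom n) := by
  refine Expands.of_mul_left (expands_one.sub (expands_rexp n)) (one_sub_mono_ne_zero hn) ?_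
  rw [one_sub_mono_mul_geom hn, mul_inv_cancel₀ (one_sub_rexp_ne_zero
    (neg_ne_zero.mpr (toLattice_ne_zero hn)))]
  exact expands_one

lemma expands_inv_one_sub_rexp {n : I →₀ ℕ} (hn : n ≠ 0) :
    Expands (1 - rexp (toLattice n))⁻¹ (-mono n * geom n) := by
  have h0 := one_sub_rexp_ne_zero (toLattice_ne_zero hn)
  have h1 := one_sub_rexp_ne_zero (neg_ne_zero.mpr (toLattice_ne_zero hn))
  have h2 := rexp_ne_zero (toLattice n)
  have : (1 - rexp (toLattice n))⁻¹ = -rexp (-toLattice n) * (1 - rexp (-toLattice n))⁻¹ := by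
    have h3 : 1 - (rexp (toLattice n))⁻¹ = -(1 - rexp (toLattice n)) / rexp (toLattice n) := by
      field_simp
      ring
    rw [rexp_neg, h3]
    field_simp
  rw [this]
  exact (expands_rexp n).neg.mul (expands_inv_one_sub_rexp_neg hn)

lemma expands_bFun {n : I →₀ ℕ} (hn : n ≠ 0) :
    Expands (bFun (toLattice n)) ((1 - qC) * mono n * geom n) := by
  have h : (1 - qC) * mono n * geom n = (qC - 1) * (-mono n * geom n) := by ring
  rw [bFun, div_eq_mul_inv, h]
  exact (expands_vinv.sub expands_one).mul (expands_inv_one_sub_rexp hn)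

lemma expands_bFun_neg {n : I →₀ ℕ} (hn : n ≠ 0) :
    Expands (bFun (-toLattice n)) (-(1 - qC) * geom n) := by
  rw [bFun, div_eq_mul_inv, neg_sub]
  exact (expands_vinv.sub expands_one).mul (expands_inv_one_sub_rexp_neg hn)

lemma expands_cFun {n : I →₀ ℕ} (hn : n ≠ 0) :
    Expands (cFun (toLattice n)) (-mono n * ((1 - qC * mono n) * geom n)) := by
  rw [cFun, div_eq_mul_inv, mul_left_comm]
  exact (expands_one.sub (expands_vinv.mul (expands_rexp n))).mul (expands_inv_one_sub_rexp hn)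

/-- `c(-β)` contains the positive power `e^β` and has no expansion in the completion by itself. The
factor `-e^{-β}` that cures this comes from the change of `invWt` along the step. -/
lemma expands_mono_mul_cFun_neg {n : I →₀ ℕ} (hn : n ≠ 0) :
    Expands (-rexp (-toLattice n) * cFun (-toLattice n)) ((qC - mono n) * geom n) := by
  have h1 := rexp_neg_mul (toLattice n)
  have h2 : -rexp (-toLattice n) * cFun (-toLattice n) =
      (vinv - rexp (-toLattice n)) * (1 - rexp (-toLattice n))⁻¹ := by
    rw [cFun, neg_neg, div_eq_mul_inv, ← mul_assoc]
    congr 1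
    linear_combination vinv * h1
  rw [h2]
  exact (expands_vinv.sub (expands_rexp n)).mul (expands_inv_one_sub_rexp_neg hn)

end Series

/-! ### Path expansion of `T_w`, its finiteness and its symmetry -/

section Paths
variable {ι k M N : Type*} [Finite ι] [Field k] [CharZero k] [AddCommGroup M] [Module k M]
  [AddCommGroup N] [Module k N] {P : RootPairing ι k M N} [P.IsRootSystem] [P.IsCrystallographic]
  [P.IsReduced] {b : P.Base} {θ : ι} [hS : SimplyLacedAffine b θ]

/-- The positive one of `± u a_i`. -/
def posImage (u : weyl b θ) (i : Idx b) : Idx b →₀ ℕ :=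
  (u.1 (simpleCoroot b i)).mapRange Int.natAbs rfl

lemma toLattice_posImage_of_nonneg {u : weyl b θ} {i : Idx b} (h : 0 ≤ u.1 (simpleCoroot b i)) :
    toLattice (posImage u i) = u.1 (simpleCoroot b i) := by
  ext j
  have h1 : 0 ≤ u.1 (simpleCoroot b i) j := h j
  simp [toLattice_apply, posImage, abs_of_nonneg h1]

lemma posImage_mul_gen (u : weyl b θ) (i : Idx b) :
    posImage (u * gen b θ i) i = posImage u i := by
  ext j
  simp only [posImage, mul_gen_apply_simple]
  simp

lemma toLattice_posImage_of_not_nonneg {u : weyl b θ} {i : Idx b}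
    (h : ¬ 0 ≤ u.1 (simpleCoroot b i)) :
    toLattice (posImage u i) = -u.1 (simpleCoroot b i) := by
  rw [← posImage_mul_gen, toLattice_posImage_of_nonneg, mul_gen_apply_simple]
  rw [mul_gen_apply_simple, neg_nonneg]
  exact (isReal_weyl u (isReal_simple b θ i)).not_nonneg_iff.mp h

lemma not_nonneg_mul_gen_iff {u : weyl b θ} {i : Idx b} :
    ¬ 0 ≤ (u * gen b θ i).1 (simpleCoroot b i) ↔ 0 ≤ u.1 (simpleCoroot b i) := by
  rw [mul_gen_apply_simple, (isReal_weyl u (isReal_simple b θ i)).neg.not_nonneg_iff, neg_nonpos]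

lemma isReal_posImage (u : weyl b θ) (i : Idx b) : IsReal b θ (toLattice (posImage u i)) := by
  have hr := isReal_weyl u (isReal_simple b θ i)
  by_cases h : 0 ≤ u.1 (simpleCoroot b i)
  · rwa [toLattice_posImage_of_nonneg h]
  · rw [toLattice_posImage_of_not_nonneg h]
    exact hr.neg

lemma posImage_ne_zero (u : weyl b θ) (i : Idx b) : posImage u i ≠ 0 := fun h => by
  have := (isReal_posImage u i).ne_zero
  rw [h, toLattice_zero] at this
  exact this rfl

open Classical in
/-- The weight of a path moving from `u` to `u s_i`. -/
def moveWt (u : weyl b θ) (i : Idx b) : Qfin (Idx b) :=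
  if 0 ≤ u.1 (simpleCoroot b i) then (1 - qC * mono (posImage u i)) * geom (posImage u i)
  else (qC - mono (posImage u i)) * geom (posImage u i)

open Classical in
/-- The weight of a path staying at `u` when reading the letter `i`. -/
def stayWt (u : weyl b θ) (i : Idx b) : Qfin (Idx b) :=
  if 0 ≤ u.1 (simpleCoroot b i) then (1 - qC) * mono (posImage u i) * geom (posImage u i)
  else -(1 - qC) * geom (posImage u i)

/-- One step of the path expansion. -/
def pathStep (φ : weyl b θ → Qfin (Idx b)) (i : Idx b) (t : weyl b θ) : Qfin (Idx b) :=
  φ t * stayWt t i + φ (t * gen b θ i) * moveWt (t * gen b θ i) i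

open Classical in
/-- The sum of the weights of all paths from `1` along the word `l`, by end point. -/
def pathSum (l : List (Idx b)) : weyl b θ → Qfin (Idx b) := l.foldl pathStep (Pi.single 1 1)

lemma pathSum_append_singleton (l : List (Idx b)) (i : Idx b) :
    pathSum (θ := θ) (l ++ [i]) = pathStep (pathSum l) i := by
  simp [pathSum]

/-- The product of the `-e^{-β}` over the inversions `β`. -/
def invWt (u : weyl b θ) : Qfin (Idx b) := ∏ n ∈ (invSet_finite u).toFinset, -mono n

lemma invWt_one : invWt (1 : weyl b θ) = 1 := by
  have : (invSet_finite (1 : weyl b θ)).toFinset = ∅ := by simp [invSet_one]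
  rw [invWt, this, Finset.prod_empty]

lemma invWt_mul_gen {u : weyl b θ} {i : Idx b} (h : 0 ≤ u.1 (simpleCoroot b i)) :
    invWt (u * gen b θ i) = -mono (posImage u i) * invWt u := by
  classical
  have hn := (toLattice_posImage_of_nonneg h).symm
  have : (invSet_finite (u * gen b θ i)).toFinset =
      insert (posImage u i) (invSet_finite u).toFinset := by
    ext m
    simp [invSet_mul_gen hn]
  rw [invWt, this, Finset.prod_insert, invWt]
  simpa using notMem_invSet_of_eq hn

lemma invWt_ne_zero (u : weyl b θ) : invWt u ≠ 0 :=
  Finset.prod_ne_zero_iff.mpr fun n _ => neg_ne_zero.mpr (mono_ne_zero n)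

lemma coeff_mul_simpleT (Y : RW b θ) (i : Idx b) (t : weyl b θ) :
    (Y * simpleT b θ i).coeff t = Y.coeff t * bFun (t.1 (simpleCoroot b i)) +
      Y.coeff (t * gen b θ i) * cFun (-t.1 (simpleCoroot b i)) := by
  rw [simpleT, mul_add, SkewMonoidAlgebra.coeff_add, Finsupp.add_apply,
    SkewMonoidAlgebra.coeff_mul_single, SkewMonoidAlgebra.coeff_mul_single_one, gen_inv,
    weyl_smul_cFun, weyl_smul_bFun, mul_gen_apply_simple, add_comm]

/-- The coefficients of `T_w` expand as sums over paths. -/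
lemma expands_wordT_coeff (l : List (Idx b)) (t : weyl b θ) :
    Expands ((wordT b θ l).coeff t) (invWt t * pathSum l t) := by
  classical
  induction l using List.reverseRecOn generalizing t with
  | nil =>
    have h1 : wordT b θ ([] : List (Idx b)) = 1 := rfl
    rw [h1, SkewMonoidAlgebra.coeff_one, pathSum, List.foldl_nil]
    by_cases ht : t = 1
    · subst ht
      simpa [invWt_one] using expands_one
    · simpa [ht, Finsupp.single_eq_of_ne ht] using expands_zero
  | append_singleton l i ih =>
    rw [wordT_append_singleton, coeff_mul_simpleT, pathSum_append_singleton, pathStep, mul_add]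
    have hn0 := posImage_ne_zero t i
    by_cases h : 0 ≤ t.1 (simpleCoroot b i)
    · have hn := toLattice_posImage_of_nonneg h
      refine Expands.add ?_ ?_
      · have h2 := (ih t).mul (expands_bFun hn0)
        rw [hn] at h2
        rw [stayWt, if_pos h, ← mul_assoc]
        exact h2
      -- The path descends from `t s_i` to `t`, where `invWt` loses a factor `-e^{-β}`; multiplying
      -- by this factor makes `c(-β)` expandable, and it is cancelled afterwards.
      · refine Expands.of_mul_left ((expands_rexp (posImage t i)).neg)
          (neg_ne_zero.mpr (mono_ne_zero _)) ?_
        have h2 := (ih (t * gen b θ i)).mul (expands_mono_mul_cFun_neg hn0)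
        rw [invWt_mul_gen h, mul_left_comm, hn, mul_assoc, mul_assoc] at h2
        rw [moveWt, if_neg (not_nonneg_mul_gen_iff.mpr h), posImage_mul_gen, hn]
        exact h2
    · have hn := toLattice_posImage_of_not_nonneg h
      have h' : 0 ≤ (t * gen b θ i).1 (simpleCoroot b i) := by
        by_contra hc
        have := not_nonneg_mul_gen_iff.mp hc
        exact h this
      have hw := invWt_mul_gen h'
      rw [mul_gen_mul_gen, posImage_mul_gen] at hw
      refine Expands.add ?_ ?_
      · have h2 := (ih t).mul (expands_bFun_neg hn0)
        rw [hn, neg_neg] at h2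
        rw [stayWt, if_neg h, ← mul_assoc]
        exact h2
      · have h2 := (ih (t * gen b θ i)).mul (expands_cFun hn0)
        rw [hn, mul_assoc, mul_left_comm (pathSum l (t * gen b θ i)), ← mul_assoc,
          mul_comm (invWt (t * gen b θ i)), ← hw] at h2
        rw [moveWt, if_pos h', posImage_mul_gen]
        exact h2

/-- The finiteness estimate, along the remaining part of a reduced word. -/
lemma le_of_coeff_foldl_ne_zero {L : ℕ} (l : List (Idx b))
    (hl : IsReducedWord b θ l (wprod b θ l)) (φ : weyl b θ → Qfin (Idx b))
    (hφ : ∀ u n, MvPowerSeries.coeff n (φ u) ≠ 0 → L ≤ len (u * wprod b θ l) + 2 * n.degree)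
    (u : weyl b θ) (n : Idx b →₀ ℕ)
    (h : MvPowerSeries.coeff n (l.foldl pathStep φ u) ≠ 0) : L ≤ len u + 2 * n.degree := by
  induction l generalizing φ u n with
  | nil => simpa using hφ u n h
  | cons i l ih =>
    refine ih (IsReducedWord.of_append (l := [i]) hl).2 (pathStep φ i) ?_ u n h
    clear h u n
    intro t n h
    rw [pathStep, map_add] at h
    have hy : 0 ≤ ((wprod b θ l)⁻¹).1 (simpleCoroot b i) := by
      have h1 := hl.not_nonneg
      rw [wprod_cons, inv_gen_mul_apply_simple,
        (isReal_weyl (wprod b θ l)⁻¹ (isReal_simple b θ i)).neg.not_nonneg_iff, neg_nonpos] at h1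
      exact h1
    rw [wprod_cons] at hφ
    -- A moving step leaves the product of position and remaining word unchanged; only a staying
    -- step needs an argument.
    by_cases h1 : MvPowerSeries.coeff n (φ t * stayWt t i) = 0
    · rw [h1, zero_add] at h
      obtain ⟨m₁, m₂, hm, h2, -⟩ := exists_coeff_ne_zero_of_mul h
      have h3 := hφ _ _ h2
      rw [← mul_assoc, mul_gen_mul_gen] at h3
      rw [← hm, map_add]
      omega
    · obtain ⟨m₁, m₂, hm, h2, h3⟩ := exists_coeff_ne_zero_of_mul h1
      have h4 := hφ _ _ h2
      rw [← mul_assoc] at h4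
      -- Staying deletes `s_i`, which multiplies the product by the reflection in `β = ± t a_i`. For
      -- `t a_i > 0` the weight contains `e^{-β}`, which pays for the possible loss of length.
      by_cases h5 : 0 ≤ t.1 (simpleCoroot b i)
      · rw [stayWt, if_pos h5, mul_comm (1 - qC), mul_assoc] at h3
        obtain ⟨d, hd⟩ := exists_add_of_le (le_of_coeff_mono_mul_ne_zero h3)
        have h6 := len_le_of_realReflection (v := t * gen b θ i * wprod b θ l)
          (w := t * wprod b θ l)
          (isReal_posImage t i) (fun y => by
            rw [mul_gen_mul_apply, toLattice_posImage_of_nonneg h5])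
        rw [← hm, hd, map_add, map_add]
        omega
      · have hr := isReal_weyl t (isReal_simple b θ i)
        -- Here the weight contains no `e^{-β}`, but the unread word is reduced, so `β` is an
        -- inversion of `t y`, with `y` the remaining product, and staying only increases the
        -- length.
        have h6 := len_lt_of_inversion (v := t * gen b θ i * wprod b θ l) (w := t * wprod b θ l)
          hr.neg (neg_nonneg.mpr (hr.not_nonneg_iff.mp h5)) (by
            rw [mul_inv_rev, weyl_mul_apply, map_neg, weyl_inv_apply_apply, map_neg,
              (isReal_weyl _ (isReal_simple b θ i)).neg.not_nonneg_iff, neg_nonpos]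
            exact hy) (fun y => by
            rw [mul_gen_mul_apply, realReflection, realReflection]
            simp)
        rw [← hm, map_add]
        omega

/-- Only finitely many `T_w` contribute to a given monomial. -/
lemma len_le_of_coeff_pathSum_ne_zero {l : List (Idx b)} {w : weyl b θ}
    (hl : IsReducedWord b θ l w) {u : weyl b θ} {n : Idx b →₀ ℕ}
    (h : MvPowerSeries.coeff n (pathSum l u) ≠ 0) : len w ≤ len u + 2 * n.degree := by
  classical
  have hw := hl.wprod_eq
  subst hw
  refine le_of_coeff_foldl_ne_zero l hl _ ?_ u n h
  intro u n h
  by_cases hu : u = 1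
  · subst hu
    rw [one_mul]
    omega
  · rw [Pi.single_eq_of_ne hu] at h
    exact absurd rfl h

/-- The path sum along a reduced word of `w`. -/
def pathC (w : weyl b θ) : weyl b θ → Qfin (Idx b) := pathSum (exists_reducedWord b θ w).choose

lemma expands_elemT_coeff (w u : weyl b θ) :
    Expands ((elemT b θ w).coeff u) (invWt u * pathC w u) :=
  expands_wordT_coeff _ u

lemma coeffC_eq (u w : weyl b θ) : coeffC b θ u w = invWt u * pathC w u :=
  (expands_elemT_coeff w u).expansion_eq

lemma pathSum_eq_pathC {l : List (Idx b)} {w : weyl b θ} (hl : IsReducedWord b θ l w) :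
    pathSum l = pathC w := by
  funext u
  refine mul_left_cancel₀ (invWt_ne_zero u) ?_
  refine (expands_wordT_coeff l u).unique ?_
  rw [wordT_eq_elemT hl]
  exact expands_elemT_coeff w u

lemma pathC_mul_gen {w : weyl b θ} {i : Idx b} (h : 0 ≤ w.1 (simpleCoroot b i)) :
    pathC (w * gen b θ i) = pathStep (pathC w) i := by
  obtain ⟨l, hl⟩ := exists_reducedWord b θ w
  rw [← pathSum_eq_pathC hl, ← pathSum_append_singleton]
  refine (pathSum_eq_pathC (isReducedWord_of_length ?_ ?_)).symm
  · rw [wprod_append, hl.wprod_eq]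
    simp
  · rw [List.length_append, hl.length_eq, len_mul_gen h]
    rfl

/-- This simple relation, valid for both signs of `u a_i`, is the purpose of the normalization by
`invWt`. -/
lemma one_add_stayWt (t : weyl b θ) (i : Idx b) :
    1 + stayWt t i = moveWt t i := by
  have h := one_sub_mono_mul_geom (posImage_ne_zero t i)
  rw [stayWt, moveWt]
  split_ifs with h1
  · linear_combination -h
  · linear_combination -h

/-- By `one_add_stayWt` both sides equal `φ(t) move(t) + φ(t s_i) move(t s_i)`. -/
lemma add_pathStep_symm (φ : weyl b θ → Qfin (Idx b)) (i : Idx b) (t : weyl b θ) :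
    φ (t * gen b θ i) + pathStep φ i (t * gen b θ i) = φ t + pathStep φ i t := by
  have h1 := one_add_stayWt t i
  have h2 := one_add_stayWt (t * gen b θ i) i
  rw [pathStep, pathStep, mul_gen_mul_gen]
  linear_combination φ (t * gen b θ i) * h2 - φ t * h1

lemma pathC_add_symm (w : weyl b θ) (i : Idx b) (t : weyl b θ) :
    pathC w (t * gen b θ i) + pathC (w * gen b θ i) (t * gen b θ i) =
      pathC w t + pathC (w * gen b θ i) t := by
  by_cases h : 0 ≤ w.1 (simpleCoroot b i)
  · rw [pathC_mul_gen h]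
    exact add_pathStep_symm _ i t
  · have h' : 0 ≤ (w * gen b θ i).1 (simpleCoroot b i) := by
      by_contra hc
      exact h (not_nonneg_mul_gen_iff.mp hc)
    have h2 := pathC_mul_gen h'
    rw [mul_gen_mul_gen] at h2
    have h3 := add_pathStep_symm (pathC (w * gen b θ i)) i t
    rw [h2]
    linear_combination h3

end Paths

/-! ### Formal convergence, and symmetry of coefficient functions on the lattice -/

section Topology

open scoped MvPowerSeries.WithPiTopology
open Filter

/-- Coefficients carry the discrete topology, so that convergence of series is coefficientwise
stabilization. -/
local instance instTopologicalSpaceCoeff : TopologicalSpace ℂ[X] := ⊥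

local instance instDiscreteTopologyCoeff : DiscreteTopology ℂ[X] := ⟨rfl⟩

variable {I J : Type*}

lemma hasFormalProd_iff_hasProd {f : J → Qfin I} {F : Qfin I} :
    HasFormalProd f F ↔ HasProd f F := by
  rw [HasProd, MvPowerSeries.WithPiTopology.tendsto_iff_coeff_tendsto]
  simp only [nhds_discrete, tendsto_pure, SummationFilter.unconditional_filter]
  rfl

lemma formalProd_eq {f : J → Qfin I} {F : Qfin I} (h : HasProd f F) : formalProd f = F := by
  have h' : ∃ F, HasFormalProd f F := ⟨F, hasFormalProd_iff_hasProd.mpr h⟩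
  rw [formalProd, dif_pos h']
  exact (hasFormalProd_iff_hasProd.mp h'.choose_spec).unique h

lemma summable_of_finite_coeff {f : J → Qfin I}
    (h : ∀ n, {j | MvPowerSeries.coeff n (f j) ≠ 0}.Finite) : Summable f :=
  MvPowerSeries.WithPiTopology.summable_iff_summable_coeff.mpr fun n =>
    summable_of_hasFiniteSupport (h n)

lemma hasFormalSum_of_hasSum {f : J → Qfin I} {F : Qfin I} (h : HasSum f F) :
    HasFormalSum f (toQv F) := by
  intro n d
  have h1 := MvPowerSeries.WithPiTopology.hasSum_iff_hasSum_coeff.mp h n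
  have h2 : {j | MvPowerSeries.coeff n (f j) ≠ 0}.Finite :=
    h1.summable.hasFiniteSupport_of_discreteTopology
  refine ⟨h2.subset fun j hj hj2 => hj (by rw [hj2, Polynomial.coeff_zero]), ?_⟩
  have h3 : MvPowerSeries.coeff n F = ∑ᶠ j, MvPowerSeries.coeff n (f j) := by
    rw [← h1.tsum_eq, tsum_eq_finsum h2]
  have h4 : (MvPowerSeries.coeff n F).coeff d = ∑ᶠ j, (MvPowerSeries.coeff n (f j)).coeff d := by
    rw [h3]
    exact (Polynomial.lcoeff ℂ d).toAddMonoidHom.map_finsum h2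
  rw [← h4, toQv, MvPowerSeries.coeff_map]
  exact Polynomial.coeff_coe _ _

/-- Expand the product over finite sets of indices: below a given exponent `n` only finitely many `e
j` occur, so only finitely many subsets contribute. -/
lemma multipliable_of_mono_dvd {f : J → Qfin I} (e : J → (I →₀ ℕ)) (he : Function.Injective e)
    (hf : ∀ j, mono (e j) ∣ f j - 1) : Multipliable f := by
  classical
  have h1 : ∀ n, {j | e j ≤ n}.Finite := fun n =>
    ((Set.finite_Icc 0 n).subset fun m hm => ⟨zero_le, hm⟩).preimage he.injOn
  have h2 : Summable fun s : Finset J => ∏ j ∈ s, (f j - 1) := by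
    refine summable_of_finite_coeff fun n => ((h1 n).toFinset.powerset.finite_toSet).subset ?_
    intro s hs
    simp only [Finset.coe_powerset, Set.mem_preimage, Set.mem_powerset_iff]
    intro j hj
    have h3 : mono (e j) ∣ ∏ j ∈ s, (f j - 1) :=
      (hf j).trans (Finset.dvd_prod_of_mem (fun j => f j - 1) hj)
    obtain ⟨g, hg⟩ := h3
    change MvPowerSeries.coeff n (∏ j ∈ s, (f j - 1)) ≠ 0 at hs
    rw [hg] at hs
    simpa using le_of_coeff_mono_mul_ne_zero hs
  have h3 := multipliable_one_add_of_summable_prod h2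
  simpa using h3

/-! ### Coefficients indexed by the lattice -/

lemma coeffExp_neg_toLattice (f : Qfin I) (n : I →₀ ℕ) :
    coeffExp f (-toLattice n) = MvPowerSeries.coeff n f := by
  have h : ∃ m : I →₀ ℕ, toLattice m = - -toLattice n := ⟨n, (neg_neg _).symm⟩
  rw [coeffExp, dif_pos h]
  exact congrArg (fun m => MvPowerSeries.coeff m f)
    (toLattice_injective (h.choose_spec.trans (neg_neg _)))

lemma coeffExp_of_not_nonpos (f : Qfin I) {x : I →₀ ℤ} (hx : ¬ x ≤ 0) : coeffExp f x = 0 := by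
  rw [coeffExp, dif_neg]
  rintro ⟨n, hn⟩
  refine hx (neg_nonneg.mp ?_)
  rw [← hn]
  exact toLattice_nonneg n

lemma nonpos_of_coeffExp_ne_zero {f : Qfin I} {x : I →₀ ℤ} (hx : coeffExp f x ≠ 0) : x ≤ 0 := by
  by_contra h
  exact hx (coeffExp_of_not_nonpos f h)

lemma exists_eq_neg_toLattice {x : I →₀ ℤ} (hx : x ≤ 0) : ∃ n, x = -toLattice n := by
  obtain ⟨n, hn⟩ := exists_toLattice (neg_nonneg.mpr hx)
  exact ⟨n, by rw [hn, neg_neg]⟩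

/-- The coefficient of `e^x` as an additive map. -/
def coeffExpHom (x : I →₀ ℤ) : Qfin I →+ ℂ[X] where
  toFun f := coeffExp f x
  map_zero' := by
    by_cases hx : x ≤ 0
    · obtain ⟨n, rfl⟩ := exists_eq_neg_toLattice hx
      rw [coeffExp_neg_toLattice, map_zero]
    · exact coeffExp_of_not_nonpos _ hx
  map_add' f g := by
    by_cases hx : x ≤ 0
    · obtain ⟨n, rfl⟩ := exists_eq_neg_toLattice hx
      simp only [coeffExp_neg_toLattice, map_add]
    · simp only [coeffExp_of_not_nonpos _ hx, add_zero]

lemma continuous_coeffExpHom (x : I →₀ ℤ) : Continuous (coeffExpHom x) := by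
  by_cases hx : x ≤ 0
  · obtain ⟨n, rfl⟩ := exists_eq_neg_toLattice hx
    have : (coeffExpHom (-toLattice n) : Qfin I → ℂ[X]) = MvPowerSeries.coeff n :=
      funext fun f => coeffExp_neg_toLattice f n
    rw [this]
    exact MvPowerSeries.WithPiTopology.continuous_coeff ℂ[X] n
  · have : (coeffExpHom x : Qfin I → ℂ[X]) = fun _ => 0 :=
      funext fun f => coeffExp_of_not_nonpos f hx
    rw [this]
    exact continuous_const

lemma coeffExp_add (f g : Qfin I) (x : I →₀ ℤ) :
    coeffExp (f + g) x = coeffExp f x + coeffExp g x := map_add (coeffExpHom x) f g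

lemma coeffExp_sub (f g : Qfin I) (x : I →₀ ℤ) :
    coeffExp (f - g) x = coeffExp f x - coeffExp g x := map_sub (coeffExpHom x) f g

lemma coeffExp_neg (f : Qfin I) (x : I →₀ ℤ) : coeffExp (-f) x = -coeffExp f x :=
  map_neg (coeffExpHom x) f

lemma coeffExp_C_mul (r : ℂ[X]) (f : Qfin I) (x : I →₀ ℤ) :
    coeffExp (MvPowerSeries.C r * f) x = r * coeffExp f x := by
  by_cases hx : x ≤ 0
  · obtain ⟨n, rfl⟩ := exists_eq_neg_toLattice hx
    rw [coeffExp_neg_toLattice, coeffExp_neg_toLattice, MvPowerSeries.coeff_C_mul]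
  · rw [coeffExp_of_not_nonpos _ hx, coeffExp_of_not_nonpos _ hx, mul_zero]

lemma coeffExp_mono_mul (n : I →₀ ℕ) (f : Qfin I) (x : I →₀ ℤ) :
    coeffExp (mono n * f) x = coeffExp f (x + toLattice n) := by
  classical
  by_cases hx : x ≤ 0
  · obtain ⟨m, rfl⟩ := exists_eq_neg_toLattice hx
    rw [coeffExp_neg_toLattice, mono, MvPowerSeries.coeff_monomial_mul]
    split_ifs with h
    · obtain ⟨d, rfl⟩ := exists_add_of_le h
      rw [one_mul, add_tsub_cancel_left, toLattice_add, neg_add, neg_add_cancel_comm,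
        coeffExp_neg_toLattice]
    · rw [coeffExp_of_not_nonpos]
      intro h2
      rw [neg_add_nonpos_iff] at h2
      exact h (toLattice_le_toLattice.mp h2)
  · rw [coeffExp_of_not_nonpos _ hx, coeffExp_of_not_nonpos]
    exact fun h => hx ((le_add_of_nonneg_right (toLattice_nonneg n)).trans h)

lemma coeffExp_one [DecidableEq I] (x : I →₀ ℤ) :
    coeffExp (1 : Qfin I) x = if x = 0 then 1 else 0 := by
  by_cases hx : x ≤ 0
  · obtain ⟨n, rfl⟩ := exists_eq_neg_toLattice hx
    rw [coeffExp_neg_toLattice, MvPowerSeries.coeff_one]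
    refine if_congr ?_ rfl rfl
    rw [neg_eq_zero, ← toLattice_zero, toLattice_injective.eq_iff]
  · rw [coeffExp_of_not_nonpos _ hx, if_neg]
    rintro rfl
    exact hx le_rfl

lemma coeffExp_mul (f g : Qfin I) (x : I →₀ ℤ) :
    coeffExp (f * g) x = ∑ᶠ y, coeffExp f y * coeffExp g (x - y) := by
  classical
  by_cases hx : x ≤ 0
  · obtain ⟨n, rfl⟩ := exists_eq_neg_toLattice hx
    rw [coeffExp_neg_toLattice, MvPowerSeries.coeff_mul]
    rw [finsum_eq_sum_of_support_subset (s := (Finset.HasAntidiagonal.antidiagonal n).image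
      fun p => -toLattice p.1), Finset.sum_image]
    · refine Finset.sum_congr rfl fun p hp => ?_
      rw [← Finset.HasAntidiagonal.mem_antidiagonal.mp hp, toLattice_add, coeffExp_neg_toLattice]
      congr 1
      rw [← coeffExp_neg_toLattice]
      congr 1
      abel
    · intro p hp p' hp' h
      have h1 : p.1 = p'.1 := toLattice_injective (neg_injective h)
      have h2 := Finset.HasAntidiagonal.mem_antidiagonal.mp hp
      have h3 := Finset.HasAntidiagonal.mem_antidiagonal.mp hp'
      refine Prod.ext h1 ?_
      rw [← h3, h1] at h2
      exact add_left_cancel h2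
    · intro y hy
      obtain ⟨m, rfl⟩ := exists_eq_neg_toLattice (nonpos_of_coeffExp_ne_zero (left_ne_zero_of_mul hy))
      obtain ⟨d, hd⟩ := exists_eq_neg_toLattice
        (nonpos_of_coeffExp_ne_zero (right_ne_zero_of_mul hy))
      simp only [Finset.coe_image, Set.mem_image, Finset.mem_coe]
      refine ⟨(m, d), ?_, rfl⟩
      rw [Finset.HasAntidiagonal.mem_antidiagonal]
      apply toLattice_injective
      rw [toLattice_add]
      have := congrArg Neg.neg hd
      rw [neg_neg] at this
      rw [← this]
      abel
  · rw [coeffExp_of_not_nonpos _ hx, finsum_eq_zero_of_forall_eq_zero]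
    intro y
    by_contra hy
    refine hx ?_
    have h1 := nonpos_of_coeffExp_ne_zero (left_ne_zero_of_mul hy)
    have h2 := nonpos_of_coeffExp_ne_zero (right_ne_zero_of_mul hy)
    have := add_nonpos h1 h2
    rwa [add_sub_cancel] at this

/-! ### Series related by a lattice automorphism -/

/-- `g` is the translate of `f` by `s⁻¹`. -/
def Translates (s : (I →₀ ℤ) ≃ₗ[ℤ] (I →₀ ℤ)) (f g : Qfin I) : Prop :=
  ∀ x, coeffExp f (s x) = coeffExp g x

variable {s : (I →₀ ℤ) ≃ₗ[ℤ] (I →₀ ℤ)}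

lemma Translates.mul {f g f' g' : Qfin I} (h : Translates s f g) (h' : Translates s f' g') :
    Translates s (f * f') (g * g') := by
  intro x
  rw [coeffExp_mul, coeffExp_mul, ← finsum_comp_equiv s.toEquiv]
  refine finsum_congr fun y => ?_
  have h1 := h y
  have h2 := h' (x - y)
  rw [map_sub] at h2
  rw [← h1, ← h2]
  rfl

lemma Translates.sub {f g f' g' : Qfin I} (h : Translates s f g) (h' : Translates s f' g') :
    Translates s (f - f') (g - g') := fun x => by
  rw [coeffExp_sub, coeffExp_sub, h, h']

lemma translates_one : Translates s 1 1 := fun x => by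
  classical
  rw [coeffExp_one, coeffExp_one]
  simp

lemma Translates.pow {f g : Qfin I} (h : Translates s f g) (m : ℕ) :
    Translates s (f ^ m) (g ^ m) := by
  induction m with
  | zero => simpa using translates_one
  | succ m ih => rw [pow_succ, pow_succ]; exact ih.mul h

lemma Translates.C_mul {f g : Qfin I} (h : Translates s f g) (r : ℂ[X]) :
    Translates s (MvPowerSeries.C r * f) (MvPowerSeries.C r * g) := fun x => by
  rw [coeffExp_C_mul, coeffExp_C_mul, h]

lemma Translates.prod {f g : J → Qfin I} (h : ∀ j, Translates s (f j) (g j)) (t : Finset J) :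
    Translates s (∏ j ∈ t, f j) (∏ j ∈ t, g j) := by
  classical
  induction t using Finset.induction_on with
  | empty => simpa using translates_one
  | insert j t hj ih =>
    rw [Finset.prod_insert hj, Finset.prod_insert hj]
    exact (h j).mul ih

lemma translates_mono {n m : I →₀ ℕ} (h : s (toLattice m) = toLattice n) :
    Translates s (mono n) (mono m) := fun x => by
  have h1 := coeffExp_mono_mul n 1 (s x)
  have h2 := coeffExp_mono_mul m 1 x
  rw [mul_one] at h1 h2
  rw [h1, h2, ← h, ← map_add]
  exact translates_one _

lemma Translates.hasProd {f g : J → Qfin I} (h : ∀ j, Translates s (f j) (g j)) {F G : Qfin I}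
    (hF : HasProd f F) (hG : HasProd g G) : Translates s F G := by
  intro x
  have h1 := ((continuous_coeffExpHom (s x)).tendsto F).comp hF
  have h2 := ((continuous_coeffExpHom x).tendsto G).comp hG
  refine tendsto_nhds_unique h1 (h2.congr fun t => ?_)
  exact (Translates.prod h t x).symm

/-- Division of invariant series: if `f` and `f g` are invariant under the reflection `s` in the
variable `i` and `f` has constant coefficient `1`, then `g` is invariant. -/
lemma Translates.of_mul_left [Fintype I] {i : I} (hs : ∀ x j, j ≠ i → s x j = x j)
    (hsi : s (Finsupp.single i 1) = -Finsupp.single i 1) {f g : Qfin I}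
    (hf : Translates s f f) (hf0 : MvPowerSeries.coeff 0 f = 1) (hfg : Translates s (f * g) (f * g)) :
    Translates s g g := by
  classical
  set φ : Qfin I := 1 - f with hφ
  have hφs : Translates s φ φ := translates_one.sub hf
  have hg : g = f * g + φ * g := by rw [hφ]; ring
  -- The height away from `i` is unchanged by `s`. The series `1 - f` has only terms of positive
  -- height, so `g = f g + (1 - f) g` determines `g` recursively in this grading.
  set h : (I →₀ ℤ) → ℤ := fun x => ∑ j ∈ Finset.univ.erase i, -x j with hh
  have hsx : ∀ x, h (s x) = h x := fun x =>
    Finset.sum_congr rfl fun j hj => by rw [hs x j (Finset.ne_of_mem_erase hj)]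
  have hsub : ∀ x y, h (x - y) = h x - h y := fun x y => by
    simp only [hh, Finsupp.sub_apply, ← Finset.sum_sub_distrib]
    exact Finset.sum_congr rfl fun j _ => by ring
  have hnn : ∀ x, x ≤ 0 → 0 ≤ h x := fun x hx =>
    Finset.sum_nonneg fun j _ => neg_nonneg.mpr (hx j)
  have hpos : ∀ y, coeffExp φ y ≠ 0 → 0 < h y := by
    intro y hy
    have hy0 := nonpos_of_coeffExp_ne_zero hy
    refine lt_of_le_of_ne (hnn y hy0) fun h0 => hy ?_
    have h1 : ∀ j ≠ i, y j = 0 := by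
      intro j hj
      have h2 := (Finset.sum_eq_zero_iff_of_nonneg
        (fun j _ => neg_nonneg.mpr (hy0 j))).mp h0.symm j (Finset.mem_erase.mpr ⟨hj, Finset.mem_univ j⟩)
      exact neg_eq_zero.mp h2
    have h2 : y = y i • Finsupp.single i 1 := by
      ext j
      by_cases hj : j = i
      · subst hj
        simp
      · simp [h1 j hj, Finsupp.single_eq_of_ne hj]
    by_cases hyi : y i = 0
    · rw [h2, hyi, zero_smul, ← neg_zero, ← toLattice_zero, coeffExp_neg_toLattice, hφ, map_sub, hf0]
      simp
    -- A nonzero multiple of `a_i` in the support would have its mirror image in the support as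
    -- well, but that image is positive.
    · rw [← hφs y]
      apply coeffExp_of_not_nonpos
      intro h3
      have h4 := h3 i
      have h5 : y i ≤ 0 := hy0 i
      rw [h2, map_smul, hsi] at h4
      simp at h4
      omega
  have key : ∀ N : ℕ, ∀ x, h x < N → coeffExp g (s x) = coeffExp g x := by
    intro N
    induction N with
    | zero =>
      intro x hx
      rw [coeffExp_of_not_nonpos, coeffExp_of_not_nonpos]
      · exact fun h1 => absurd (hnn x h1) (by simpa using hx)
      · exact fun h1 => absurd (hsx x ▸ hnn _ h1) (by simpa using hx)
    | succ N ih =>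
      intro x hx
      have e : ∀ z, coeffExp g z = coeffExp (f * g) z + ∑ᶠ y, coeffExp φ y * coeffExp g (z - y) := by
        intro z
        rw [← coeffExp_mul, ← coeffExp_add, ← hg]
      rw [e x, e (s x), hfg x]
      congr 1
      rw [← finsum_comp_equiv s.toEquiv]
      refine finsum_congr fun y => ?_
      change coeffExp φ (s y) * coeffExp g (s x - s y) = _
      rw [hφs y, ← map_sub]
      by_cases hy : coeffExp φ y = 0
      · rw [hy, zero_mul, zero_mul]
      · rw [ih (x - y)]
        rw [hsub]
        have := hpos y hy
        push_cast at hx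
        omega
  intro x
  exact key (h x + 1).toNat x (by omega)

/-- `f` becomes anti-invariant under `s` after a shift by half of `e^{a_i}`. -/
def IsSkew (s : (I →₀ ℤ) ≃ₗ[ℤ] (I →₀ ℤ)) (i : I) (f : Qfin I) : Prop :=
  ∀ x, coeffExp f (s x - Finsupp.single i 1) = -coeffExp f x

lemma IsSkew.hasSum {i : I} {f g : J → Qfin I} {F : Qfin I}
    (h : ∀ j x, coeffExp (g j) (s x - Finsupp.single i 1) = -coeffExp (f j) x)
    (hf : HasSum f F) (hg : HasSum g F) : IsSkew s i F := by
  intro x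
  have h1 := hg.map (coeffExpHom (s x - Finsupp.single i 1)) (continuous_coeffExpHom _)
  have h2 := (hf.map (coeffExpHom x) (continuous_coeffExpHom _)).neg
  have h3 : ⇑(coeffExpHom (s x - Finsupp.single i 1)) ∘ g = fun j => -(⇑(coeffExpHom x) ∘ f) j :=
    funext fun j => h j x
  rw [h3] at h1
  exact h1.unique h2

/-- Skewness makes the defect `G x = g(s x) - g(x)` periodic along `a_i`. Going far in either
direction kills one of its two terms, and the two surviving values are coefficients at the same
point with opposite signs, so `G = -G`. -/
lemma IsSkew.translates {i : I} {p : (I →₀ ℤ) → ℤ} (hs : ∀ x, s x = x - p x • Finsupp.single i 1)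
    (hsi : s (Finsupp.single i 1) = -Finsupp.single i 1) {g : Qfin I}
    (h : IsSkew s i ((1 - mono (Finsupp.single i 1)) * g)) : Translates s g g := by
  classical
  set a : I →₀ ℤ := Finsupp.single i 1 with ha
  have e : ∀ x, coeffExp ((1 - mono (Finsupp.single i 1)) * g) x =
      coeffExp g x - coeffExp g (x + a) := by
    intro x
    rw [sub_mul, one_mul, coeffExp_sub, coeffExp_mono_mul, toLattice_single]
  set G : (I →₀ ℤ) → ℂ[X] := fun x => coeffExp g (s x) - coeffExp g x with hG
  have hper : ∀ x, G (x + a) = G x := by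
    intro x
    have h1 := h x
    rw [e, e, sub_add_cancel] at h1
    simp only [hG, map_add, hsi, ← sub_eq_add_neg]
    linear_combination h1
  have hper2 : ∀ (m : ℕ) x, G (x + (m : ℤ) • a) = G x := by
    intro m x
    induction m with
    | zero => simp
    | succ m ih =>
      rw [← ih, ← hper (x + (m : ℤ) • a)]
      congr 1
      push_cast
      rw [add_smul, one_smul, add_assoc]
  have hbig : ∀ x, 0 < x i → coeffExp g x = 0 := by
    intro x hx
    apply coeffExp_of_not_nonpos
    intro h1
    have := h1 i
    simp at this
    omega
  intro x
  have hai : a i = 1 := by simp [ha]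
  -- Both shifts are large enough to leave the support, and `m' = m + p x` makes `s x - m a` and `x
  -- - m' a` coincide.
  obtain ⟨m, m', h1, h2, h3⟩ : ∃ m m' : ℕ, 0 < x i + m ∧ 0 < x i - p x + m' ∧ (m' : ℤ) = m + p x := by
    refine ⟨((x i).natAbs + (p x).natAbs + 1), ((x i).natAbs + (p x).natAbs + 1 + p x).toNat, ?_, ?_,
      ?_⟩ <;> omega
  have e1 : G x = coeffExp g (s x - (m : ℤ) • a) := by
    rw [← hper2 m x, hG]
    simp only [map_add, map_smul, hsi, smul_neg, ← sub_eq_add_neg]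
    rw [hbig (x + (m : ℤ) • a), sub_zero]
    simp [hai]
    omega
  have e2 : G x = -coeffExp g (x - (m' : ℤ) • a) := by
    have h4 := hper2 m' (x - (m' : ℤ) • a)
    rw [sub_add_cancel] at h4
    rw [h4, hG]
    simp only [map_sub, map_smul, hsi, smul_neg, sub_neg_eq_add]
    rw [hbig (s x + (m' : ℤ) • a), zero_sub]
    rw [hs]
    simp [hai]
    omega
  have e3 : s x - (m : ℤ) • a = x - (m' : ℤ) • a := by
    rw [hs, h3]
    module
  rw [e3] at e1
  have e4 : G x = 0 := by
    have : G x = -G x := by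
      conv_lhs => rw [e2]
      rw [e1]
    exact self_eq_neg.mp this
  exact sub_eq_zero.mp e4

end Topology

/-! ### The limit of the path sums and the product formulas for the denominators -/

section Topology

open scoped MvPowerSeries.WithPiTopology
open Filter

attribute [local instance] instTopologicalSpaceCoeff instDiscreteTopologyCoeff

section Constants

variable {I J : Type*}

lemma constantCoeff_eq_one_of_hasProd {f : J → Qfin I} {F : Qfin I} (h : HasProd f F)
    (hf : ∀ j, MvPowerSeries.constantCoeff (f j) = 1) : MvPowerSeries.constantCoeff F = 1 := by
  have h1 := h.map (MvPowerSeries.constantCoeff (σ := I) (R := ℂ[X]))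
    (MvPowerSeries.WithPiTopology.continuous_constantCoeff ℂ[X])
  have h2 : ⇑(MvPowerSeries.constantCoeff (σ := I) (R := ℂ[X])) ∘ f = fun _ => 1 := funext hf
  rw [h2] at h1
  exact h1.unique hasProd_one

lemma constantCoeff_mono {n : I →₀ ℕ} (hn : n ≠ 0) : MvPowerSeries.constantCoeff (mono n) = 0 := by
  classical
  rw [mono, ← MvPowerSeries.coeff_zero_eq_constantCoeff_apply, MvPowerSeries.coeff_monomial,
    if_neg hn.symm]

lemma constantCoeff_eq_one_of_dvd {n : I →₀ ℕ} (hn : n ≠ 0) {f : Qfin I} (h : mono n ∣ f - 1) :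
    MvPowerSeries.constantCoeff f = 1 := by
  obtain ⟨g, hg⟩ := h
  rw [sub_eq_iff_eq_add.mp hg, map_add, map_mul, constantCoeff_mono hn, zero_mul, zero_add, map_one]

lemma two_ne_zero_qfin : (2 : Qfin I) ≠ 0 := fun h => by
  have h1 := congrArg MvPowerSeries.constantCoeff h
  rw [map_ofNat, map_zero] at h1
  exact two_ne_zero h1

lemma monomial_X_eq (n : I →₀ ℕ) : (MvPowerSeries.monomial n X : Qfin I) = qC * mono n := by
  rw [qC, mono, ← MvPowerSeries.monomial_zero_eq_C, MvPowerSeries.monomial_mul_monomial, zero_add,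
    mul_one]

lemma dvd_pow_sub_one {a f : Qfin I} (h : a ∣ f - 1) (m : ℕ) : a ∣ f ^ m - 1 := by
  have := sub_dvd_pow_sub_pow f 1 m
  rw [one_pow] at this
  exact h.trans this

lemma mono_dvd_geom_sub_one {n : I →₀ ℕ} (hn : n ≠ 0) : mono n ∣ geom n - 1 :=
  ⟨geom n, by linear_combination one_sub_mono_mul_geom hn⟩

end Constants

variable {ι k M N : Type*} [Finite ι] [Field k] [CharZero k] [AddCommGroup M] [Module k M]
  [AddCommGroup N] [Module k N] {P : RootPairing ι k M N} [P.IsRootSystem] [P.IsCrystallographic]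
  [P.IsReduced] {b : P.Base} {θ : ι} [hS : SimplyLacedAffine b θ]

/-! ### The sum of the path expansions -/

lemma finite_coeff_pathC_ne_zero (u : weyl b θ) (n : Idx b →₀ ℕ) :
    {w | MvPowerSeries.coeff n (pathC w u) ≠ 0}.Finite := by
  refine (finite_len_le (b := b) (θ := θ) (len u + 2 * n.degree)).subset ?_
  intro w hw
  rw [Set.mem_ofPred_eq] at hw ⊢
  exact len_le_of_coeff_pathSum_ne_zero (exists_reducedWord b θ w).choose_spec hw

lemma summable_pathC (u : weyl b θ) : Summable fun w => pathC w u :=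
  summable_of_finite_coeff (finite_coeff_pathC_ne_zero u)

variable (b θ) in
/-- The sum of all path expansions ending at `1`. -/
def pathLimit : Qfin (Idx b) := ∑' w : weyl b θ, pathC w 1

/-- Summing `pathC w t + pathC (w s_i) t` over all `w` counts the total at `t` twice, and the
summand is symmetric under `t ↔ t s_i`. -/
lemma tsum_pathC_mul_gen (u : weyl b θ) (i : Idx b) :
    ∑' w, pathC w (u * gen b θ i) = ∑' w, pathC w u := by
  have h : ∀ t : weyl b θ, HasSum (fun w => pathC w t + pathC (w * gen b θ i) t)
      ((∑' w, pathC w t) + ∑' w, pathC w t) := by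
    intro t
    have h1 := (summable_pathC t).hasSum
    have h2 := (Equiv.mulRight (gen b θ i)).hasSum_iff.mpr h1
    exact h1.add h2
  have h1 := h (u * gen b θ i)
  simp only [pathC_add_symm _ i u] at h1
  have h2 := h1.unique (h u)
  rw [← two_mul, ← two_mul] at h2
  exact mul_left_cancel₀ two_ne_zero_qfin h2

lemma tsum_pathC (u : weyl b θ) : ∑' w, pathC w u = pathLimit b θ := by
  induction u using wprod_induction with
  | h1 => rfl
  | h2 u i ih => rw [tsum_pathC_mul_gen, ih]

lemma hasSum_pathC (u : weyl b θ) : HasSum (fun w => pathC w u) (pathLimit b θ) :=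
  tsum_pathC u ▸ (summable_pathC u).hasSum

lemma hasSum_coeffC (u : weyl b θ) :
    HasSum (fun w => coeffC b θ u w) (invWt u * pathLimit b θ) := by
  simp only [coeffC_eq]
  exact (hasSum_pathC u).mul_left _

/-! ### The infinite products -/

lemma PosCoroot.ne_zero (n : PosCoroot b θ) : n.1 ≠ 0 := fun h =>
  n.2.1 (by rw [h, toLattice_zero])

lemma mono_dvd_denomFactor_sub_one (n : PosCoroot b θ) : mono n.1 ∣ denomFactor b θ n - 1 :=
  dvd_pow_sub_one ⟨-qC, by rw [monomial_X_eq]; ring⟩ _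

lemma hasProd_denomV : HasProd (denomFactor b θ) (denomV b θ) := by
  have h := (multipliable_of_mono_dvd _ Subtype.val_injective
    (mono_dvd_denomFactor_sub_one (b := b) (θ := θ))).hasProd
  rwa [← formalProd_eq h] at h

lemma constantCoeff_denomV : MvPowerSeries.constantCoeff (denomV b θ) = 1 :=
  constantCoeff_eq_one_of_hasProd hasProd_denomV fun n =>
    constantCoeff_eq_one_of_dvd n.ne_zero (mono_dvd_denomFactor_sub_one n)

lemma mono_dvd_one_sub_pow_sub_one (n : PosCoroot b θ) :
    mono n.1 ∣ (1 - mono n.1) ^ mult b θ n - 1 :=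
  dvd_pow_sub_one ⟨-1, by ring⟩ _

variable (b θ) in
/-- The Weyl-Kac denominator `∏ (1 - e^{-β})^{m(β)}`. -/
def denom : Qfin (Idx b) := ∏' n : PosCoroot b θ, (1 - mono n.1) ^ mult b θ n

lemma hasProd_denom :
    HasProd (fun n : PosCoroot b θ => (1 - mono n.1) ^ mult b θ n) (denom b θ) :=
  (multipliable_of_mono_dvd _ Subtype.val_injective
    (mono_dvd_one_sub_pow_sub_one (b := b) (θ := θ))).hasProd

variable (b θ) in
/-- The inverse `∏ (1 - e^{-β})^{-m(β)}` of the Weyl-Kac denominator. -/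
def denomInv : Qfin (Idx b) := ∏' n : PosCoroot b θ, geom n.1 ^ mult b θ n

lemma hasProd_denomInv :
    HasProd (fun n : PosCoroot b θ => geom n.1 ^ mult b θ n) (denomInv b θ) :=
  (multipliable_of_mono_dvd _ Subtype.val_injective
    (fun n => dvd_pow_sub_one (mono_dvd_geom_sub_one (PosCoroot.ne_zero n)) _)).hasProd

lemma denom_mul_denomInv : denom b θ * denomInv b θ = 1 := by
  have h := (hasProd_denom (b := b) (θ := θ)).mul hasProd_denomInv
  simp only [← mul_pow, one_sub_mono_mul_geom (PosCoroot.ne_zero _), one_pow] at h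
  exact h.unique hasProd_one

/-! ### The translates of the inverse denominator -/

lemma IsAffineCoroot.nonneg_or_nonpos_weyl (w : weyl b θ) (n : PosCoroot b θ) :
    0 ≤ w.1 (toLattice n.1) ∨ (w.1 (toLattice n.1) ≤ 0 ∧ IsReal b θ (toLattice n.1)) := by
  rcases n.2.2 with h | h
  · exact (isReal_weyl w (x := toLattice n.1) h).nonneg_or_nonpos.imp_right fun h1 => ⟨h1, h⟩
  · left
    rw [weyl_apply_of_finPart_eq_zero w h]
    exact toLattice_nonneg _

/-- The positive one of `± w n`. -/
def absImage (w : weyl b θ) (n : Idx b →₀ ℕ) : Idx b →₀ ℕ :=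
  (w.1 (toLattice n)).mapRange Int.natAbs rfl

lemma toLattice_absImage_of_nonneg {w : weyl b θ} {n : Idx b →₀ ℕ} (h : 0 ≤ w.1 (toLattice n)) :
    toLattice (absImage w n) = w.1 (toLattice n) := by
  ext j
  have h1 : 0 ≤ w.1 (toLattice n) j := h j
  simp [toLattice_apply, absImage, abs_of_nonneg h1]

lemma toLattice_absImage_of_nonpos {w : weyl b θ} {n : Idx b →₀ ℕ} (h : w.1 (toLattice n) ≤ 0) :
    toLattice (absImage w n) = -w.1 (toLattice n) := by
  ext j
  have h1 : w.1 (toLattice n) j ≤ 0 := h j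
  simp [toLattice_apply, absImage, abs_of_nonpos h1]

lemma toLattice_absImage (w : weyl b θ) (n : PosCoroot b θ) :
    toLattice (absImage w n.1) = w.1 (toLattice n.1) ∨
      toLattice (absImage w n.1) = -w.1 (toLattice n.1) :=
  (IsAffineCoroot.nonneg_or_nonpos_weyl w n).imp toLattice_absImage_of_nonneg
    fun h => toLattice_absImage_of_nonpos h.1

lemma absImage_inv_absImage (w : weyl b θ) (n : PosCoroot b θ) :
    absImage w⁻¹ (absImage w n.1) = n.1 := by
  ext j
  rw [absImage, Finsupp.mapRange_apply]
  rcases toLattice_absImage w n with h | h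
  · rw [h, weyl_inv_apply_apply]
    simp [toLattice_apply]
  · rw [h, map_neg, weyl_inv_apply_apply]
    simp [toLattice_apply]

lemma isAffineCoroot_absImage (w : weyl b θ) (n : PosCoroot b θ) :
    IsAffineCoroot b θ (toLattice (absImage w n.1)) := by
  have h1 : ∀ x : Lattice b, IsAffineCoroot b θ x → IsAffineCoroot b θ (w.1 x) := fun x hx =>
    ⟨fun h => hx.1 (w.1.map_eq_zero_iff.mp h), hx.2.imp (isReal_weyl w)
      (finPart_weyl_eq_zero w).mpr⟩
  have h2 : ∀ x : Lattice b, IsAffineCoroot b θ x → IsAffineCoroot b θ (-x) := fun x hx =>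
    ⟨neg_ne_zero.mpr hx.1, hx.2.imp (fun h => IsReal.neg (x := x) h)
      (fun h => by rw [map_neg, h, neg_zero])⟩
  rcases toLattice_absImage w n with h | h <;> rw [h]
  · exact h1 _ n.2
  · exact h2 _ (h1 _ n.2)

/-- The permutation of the positive affine coroots induced by `w`, up to signs. -/
def absPerm (w : weyl b θ) : Equiv.Perm (PosCoroot b θ) where
  toFun n := ⟨absImage w n.1, isAffineCoroot_absImage w n⟩
  invFun n := ⟨absImage w⁻¹ n.1, isAffineCoroot_absImage w⁻¹ n⟩
  left_inv n := Subtype.ext (absImage_inv_absImage w n)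
  right_inv n := Subtype.ext (by
    have := absImage_inv_absImage w⁻¹ n
    rwa [inv_inv] at this)

lemma mult_absPerm (w : weyl b θ) (n : PosCoroot b θ) : mult b θ (absPerm w n) = mult b θ n := by
  classical
  have : finPart b θ (toLattice (absPerm w n).1) = 0 ↔ finPart b θ (toLattice n.1) = 0 := by
    change finPart b θ (toLattice (absImage w n.1)) = 0 ↔ _
    rcases toLattice_absImage w n with h | h <;> rw [h]
    · exact finPart_weyl_eq_zero w
    · rw [map_neg, neg_eq_zero, finPart_weyl_eq_zero]
  simp only [mult, this]

lemma mult_of_isReal {n : PosCoroot b θ} (h : IsReal b θ (toLattice n.1)) : mult b θ n = 1 :=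
  if_neg h.finPart_ne_zero

lemma absImage_mem_invSet_iff (w : weyl b θ) (n : PosCoroot b θ) :
    absImage w n.1 ∈ invSet w ↔ ¬ 0 ≤ w.1 (toLattice n.1) := by
  constructor
  · intro h h0
    apply h.2
    rw [toLattice_absImage_of_nonneg h0, weyl_inv_apply_apply]
    exact toLattice_nonneg _
  · intro h0
    obtain ⟨h, hr⟩ := (IsAffineCoroot.nonneg_or_nonpos_weyl w n).resolve_left h0
    refine ⟨?_, ?_⟩ <;> rw [toLattice_absImage_of_nonpos h]
    · exact (isReal_weyl w hr).neg
    · rw [map_neg, weyl_inv_apply_apply, hr.neg.not_nonneg_iff, neg_nonpos]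
      exact toLattice_nonneg _

lemma invFactorRat_eq (w : weyl b θ) (n : PosCoroot b θ) :
    invFactorRat b θ w n = (1 - rexp (-w.1 (toLattice n.1)))⁻¹ := by
  change w.1 • (1 - rexp (-toLattice n.1))⁻¹ = _
  rw [smul_inv'', smul_sub, smul_one, smul_rexp, map_neg]

open Classical in
lemma expands_invFactorRat (w : weyl b θ) (n : PosCoroot b θ) :
    Expands (invFactorRat b θ w n)
      ((if absImage w n.1 ∈ invSet w then -mono (absImage w n.1) else 1) *
        geom (absImage w n.1)) := by
  have h0 : absImage w n.1 ≠ 0 := (absPerm w n).ne_zero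
  rw [invFactorRat_eq]
  by_cases h : 0 ≤ w.1 (toLattice n.1)
  · rw [if_neg (fun h1 => (absImage_mem_invSet_iff w n).mp h1 h), one_mul,
      ← toLattice_absImage_of_nonneg h]
    exact expands_inv_one_sub_rexp_neg h0
  · rw [if_pos ((absImage_mem_invSet_iff w n).mpr h), ← toLattice_absImage_of_nonpos
      ((IsAffineCoroot.nonneg_or_nonpos_weyl w n).resolve_left h).1]
    exact expands_inv_one_sub_rexp h0

-- When `w n` is negative, `n` is real and has multiplicity one, so exactly one factor `-e^{-β}`
-- appears, `β` being the inversion `-w n`.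
open Classical in
lemma invFactor_eq (w : weyl b θ) (n : PosCoroot b θ) : invFactor b θ w n =
    (if (absPerm w n).1 ∈ invSet w then -mono (absPerm w n).1 else 1) *
      geom (absPerm w n).1 ^ mult b θ (absPerm w n) := by
  rw [invFactor, (expands_invFactorRat w n).expansion_eq, mult_absPerm]
  change _ = (if absImage w n.1 ∈ invSet w then -mono (absImage w n.1) else 1) *
    geom (absImage w n.1) ^ _
  by_cases h : absImage w n.1 ∈ invSet w
  · have h1 : IsReal b θ (toLattice (absPerm w n).1) := h.1
    rw [← mult_absPerm w n, mult_of_isReal h1, pow_one, pow_one]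
  · rw [if_neg h, one_mul, one_mul]

/-- Up to signs `w` permutes the positive coroots. The sign changes occur at the finitely many
inversions, whose factors assemble to `invWt w`. -/
lemma hasProd_invFactor (w : weyl b θ) :
    HasProd (invFactor b θ w) (invWt w * denomInv b θ) := by
  classical
  have h1 : HasProd (fun n : PosCoroot b θ => if n.1 ∈ invSet w then -mono n.1 else 1)
      (invWt w) := by
    have h2 := hasProd_prod_of_ne_finset_one (L := SummationFilter.unconditional _)
      (f := fun n : PosCoroot b θ => if n.1 ∈ invSet w then -mono n.1 else (1 : Qfin (Idx b)))
      (s := (invSet_finite w).toFinset.subtype fun n => IsAffineCoroot b θ (toLattice n))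
      (fun n hn => if_neg fun h => hn (by simpa using h))
    have h3 : invWt w = ∏ n ∈ (invSet_finite w).toFinset.subtype fun n =>
        IsAffineCoroot b θ (toLattice n), if n.1 ∈ invSet w then -mono n.1 else 1 := by
      rw [Finset.prod_subtype_of_mem
        (f := fun n => if n ∈ invSet w then -mono n else (1 : Qfin (Idx b))), invWt]
      · exact Finset.prod_congr rfl fun n hn => (if_pos (by simpa using hn)).symm
      · intro n hn
        have h4 : n ∈ invSet w := by simpa using hn
        exact ⟨h4.1.ne_zero, Or.inl h4.1⟩
    rw [h3]
    exact h2
  have h2 := h1.mul (hasProd_denomInv (b := b) (θ := θ))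
  have h3 := (absPerm w).hasProd_iff.mpr h2
  have h4 : invFactor b θ w = _ := funext (invFactor_eq w)
  rw [h4]
  exact h3

lemma invDenom_eq (w : weyl b θ) : invDenom b θ w = invWt w * denomInv b θ :=
  formalProd_eq (hasProd_invFactor w)

end Topology

/-! ### Invariant series, the alternating sum and partial invariance of the products -/

section Topology

open scoped MvPowerSeries.WithPiTopology
open Filter

attribute [local instance] instTopologicalSpaceCoeff instDiscreteTopologyCoeff

variable {ι k M N : Type*} [Finite ι] [Field k] [CharZero k] [AddCommGroup M] [Module k M]
  [AddCommGroup N] [Module k N] {P : RootPairing ι k M N} [P.IsRootSystem] [P.IsCrystallographic]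
  [P.IsReduced] {b : P.Base} {θ : ι} [hS : SimplyLacedAffine b θ]

/-! ### Series invariant under the affine Weyl group -/

lemma finPart_eq_zero_of_simplePairing {x : Lattice b} (h : ∀ i, simplePairing b θ i x = 0) :
    finPart b θ x = 0 := by
  have h1 : P.toLinearMap.flip (finPart b θ x) = 0 := by
    refine b.toWeightBasis.ext fun i => ?_
    have h2 := form_cast (θ := θ) (simpleCoroot b (some i)) x
    rw [form_simple, h, finPart_simple, symm_coroot (θ := θ)] at h2
    rw [b.toWeightBasis_apply, LinearMap.flip_apply, LinearMap.zero_apply]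
    simpa [node] using h2.symm
  exact (LinearMap.IsPerfPair.bijective_right (p := P.toLinearMap)).1 (h1.trans (map_zero _).symm)

/-- Pairing with the imaginary coroot gives `∑ c_i ⟨a_i, x⟩ = 0` with all `c_i ≥ 1`, so nonpositive
pairings vanish. -/
lemma finPart_eq_zero_of_simplePairing_nonpos {x : Lattice b}
    (h : ∀ i, simplePairing b θ i x ≤ 0) : finPart b θ x = 0 := by
  have h1 := form_eq_zero_of_finPart (θ := θ) (finPart_minImag b θ) x
  rw [form_eq_sum, Finsupp.sum_fintype _ _ (by simp)] at h1
  refine finPart_eq_zero_of_simplePairing fun i => ?_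
  have h2 := (Finset.sum_eq_zero_iff_of_nonpos fun i _ =>
    mul_nonpos_of_nonneg_of_nonpos (minImag_nonneg (b := b) (θ := θ) i) (h i)).mp h1 i
      (Finset.mem_univ i)
  have h3 := one_le_minImag (b := b) (θ := θ) i
  exact (mul_eq_zero.mp h2).resolve_left (by omega)

/-- The orbit of an exponent stays in the positive cone, so it has an element of least height. No
simple reflection lowers that element, so all its simple pairings are nonpositive and it is
imaginary, hence fixed by `W`. -/
lemma isImagSeries_of_invariant {c : Qfin (Idx b)}
    (h : ∀ (w : weyl b θ) x, coeffExp c (w.1 x) = coeffExp c x) : IsImagSeries b θ c := by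
  classical
  intro n hn
  have hpos : ∀ w : weyl b θ, ∃ m, toLattice m = w.1 (toLattice n) := by
    intro w
    apply exists_toLattice
    rw [← coeffExp_neg_toLattice, ← h w] at hn
    have := nonpos_of_coeffExp_ne_zero hn
    rwa [map_neg, neg_nonpos] at this
  choose m hm using hpos
  obtain ⟨w, hw⟩ : ∃ w, ∀ w', (m w).degree ≤ (m w').degree :=
    ⟨_, fun w' => Function.argmin_le (fun w => (m w).degree) w'⟩
  have h1 : finPart b θ (toLattice (m w)) = 0 := by
    refine finPart_eq_zero_of_simplePairing_nonpos fun i => ?_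
    have h2 := hw (gen b θ i * w)
    have h3 := congrArg ht (hm (gen b θ i * w))
    rw [weyl_mul_apply, gen_apply, simpleReflection_apply, ← hm w, map_sub, map_smul,
      ht_toLattice, ht_toLattice, simpleCoroot, ht, Finsupp.linearCombination_single] at h3
    simp only [smul_eq_mul, mul_one] at h3
    omega
  rw [hm w, finPart_weyl_eq_zero] at h1
  refine ⟨n none, ?_⟩
  rw [← natCast_zsmul]
  exact eq_smul_minImag h1

/-! ### The alternating sum over inversion sets -/

lemma exists_invWt_eq (u : weyl b θ) :
    ∃ g, invWt u = mono (∑ n ∈ (invSet_finite u).toFinset, n) * g := by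
  classical
  rw [invWt]
  generalize (invSet_finite u).toFinset = S
  induction S using Finset.induction_on with
  | empty => exact ⟨1, by rw [Finset.prod_empty, Finset.sum_empty, mono_zero, mul_one]⟩
  | insert n S hn ih =>
    obtain ⟨g, hg⟩ := ih
    refine ⟨-g, ?_⟩
    rw [Finset.prod_insert hn, Finset.sum_insert hn, mono_add, hg]
    ring

lemma len_le_of_coeff_invWt_ne_zero {u : weyl b θ} {n : Idx b →₀ ℕ}
    (h : MvPowerSeries.coeff n (invWt u) ≠ 0) : len u ≤ n.degree := by
  obtain ⟨g, hg⟩ := exists_invWt_eq u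
  rw [hg] at h
  obtain ⟨d, hd⟩ := exists_add_of_le (le_of_coeff_mono_mul_ne_zero h)
  rw [hd, map_add, map_sum, ← ncard_invSet, Set.ncard_eq_toFinset_card _ (invSet_finite u),
    Finset.card_eq_sum_ones]
  refine (Finset.sum_le_sum fun m hm => ?_).trans (Nat.le_add_right _ _)
  rw [Nat.one_le_iff_ne_zero, Ne, Finsupp.degree_eq_zero_iff]
  rintro rfl
  have h1 : (0 : Idx b →₀ ℕ) ∈ invSet u := by simpa using hm
  exact h1.1.ne_zero toLattice_zero

lemma eq_one_of_len_eq_zero {u : weyl b θ} (h : len u = 0) : u = 1 := by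
  obtain ⟨l, hl⟩ := exists_reducedWord b θ u
  have h1 := hl.length_eq
  rw [h, List.length_eq_zero_iff] at h1
  rw [← hl.wprod_eq, h1, wprod_nil]

lemma coeffExp_invWt_mul_gen (u : weyl b θ) (i : Idx b) (x : Lattice b) :
    coeffExp (invWt (u * gen b θ i)) x = -coeffExp (invWt u) (x + u.1 (simpleCoroot b i)) := by
  by_cases h : 0 ≤ u.1 (simpleCoroot b i)
  · rw [invWt_mul_gen h, neg_mul, coeffExp_neg, coeffExp_mono_mul, toLattice_posImage_of_nonneg h]
  · have h' : 0 ≤ (u * gen b θ i).1 (simpleCoroot b i) := by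
      by_contra hc
      exact h (not_nonneg_mul_gen_iff.mp hc)
    have h1 := invWt_mul_gen h'
    rw [mul_gen_mul_gen] at h1
    rw [h1, neg_mul, coeffExp_neg, coeffExp_mono_mul, toLattice_posImage_of_nonneg h',
      mul_gen_apply_simple, neg_neg, add_neg_cancel_right]

/-- This is the rule for `(-1)^{ℓ(u)} e^{uρ-ρ}` with `s_i ρ = ρ - a_i`, stated without `ρ`. The
induction multiplies on the right, where inversion sets change by one element. -/
lemma coeffExp_invWt_gen_mul (i : Idx b) (u : weyl b θ) (x : Lattice b) :
    coeffExp (invWt (gen b θ i * u)) (simpleReflection b θ i x - simpleCoroot b i) =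
      -coeffExp (invWt u) x := by
  induction u using wprod_induction generalizing x with
  | h1 =>
    have h := coeffExp_invWt_mul_gen (1 : weyl b θ) i
      (simpleReflection b θ i x - simpleCoroot b i)
    rw [one_mul] at h
    rw [mul_one, h, invWt_one]
    change -coeffExp 1 (simpleReflection b θ i x - simpleCoroot b i + simpleCoroot b i) = _
    rw [sub_add_cancel, translates_one]
  | h2 u j ih =>
    rw [← mul_assoc, coeffExp_invWt_mul_gen, coeffExp_invWt_mul_gen, weyl_mul_apply, gen_apply,
      sub_add_eq_add_sub, ← map_add, ih]

lemma summable_invWt : Summable (invWt : weyl b θ → Qfin (Idx b)) := by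
  refine summable_of_finite_coeff fun n => (finite_len_le (b := b) (θ := θ) n.degree).subset ?_
  intro u hu
  rw [Set.mem_ofPred_eq] at hu ⊢
  exact len_le_of_coeff_invWt_ne_zero hu

variable (b θ) in
/-- The sum of the weights of all inversion sets. -/
def invSum : Qfin (Idx b) := ∑' u : weyl b θ, invWt u

lemma hasSum_invWt : HasSum (invWt : weyl b θ → Qfin (Idx b)) (invSum b θ) := summable_invWt.hasSum

lemma constantCoeff_invSum : MvPowerSeries.constantCoeff (invSum b θ) = 1 := by
  have h1 := (hasSum_invWt (b := b) (θ := θ)).map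
    (MvPowerSeries.constantCoeff (σ := Idx b) (R := ℂ[X]))
    (MvPowerSeries.WithPiTopology.continuous_constantCoeff ℂ[X])
  have h2 := hasSum_single (f := ⇑(MvPowerSeries.constantCoeff (σ := Idx b) (R := ℂ[X])) ∘
    (invWt : weyl b θ → Qfin (Idx b))) 1 (by
      intro u hu
      by_contra h
      have h3 := len_le_of_coeff_invWt_ne_zero (n := 0) (u := u) h
      rw [map_zero] at h3
      exact hu (eq_one_of_len_eq_zero (Nat.le_zero.mp h3)))
  rw [h1.unique h2, Function.comp_apply, invWt_one, map_one]

lemma isSkew_invSum (i : Idx b) : IsSkew (simpleReflection b θ i) i (invSum b θ) := by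
  have h0 := hasSum_invWt (b := b) (θ := θ)
  have h := (Equiv.mulLeft (gen b θ i)).hasSum_iff.mpr h0
  refine IsSkew.hasSum (fun u x => ?_) h0 h
  exact coeffExp_invWt_gen_mul i u x

/-- The quotient of the alternating sum by `1 - e^{-a_i}` is invariant under `s_i`. -/
lemma exists_invSum_eq (i : Idx b) : ∃ J, invSum b θ = (1 - mono (Finsupp.single i 1)) * J ∧
    MvPowerSeries.constantCoeff J = 1 ∧ Translates (simpleReflection b θ i) J J := by
  have h0 : (Finsupp.single i 1 : Idx b →₀ ℕ) ≠ 0 := by simp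
  have h1 : invSum b θ = (1 - mono (Finsupp.single i 1)) * (geom (Finsupp.single i 1) * invSum b θ) := by
    rw [← mul_assoc, one_sub_mono_mul_geom h0, one_mul]
  refine ⟨geom (Finsupp.single i 1) * invSum b θ, h1, ?_, ?_⟩
  · have h2 := congrArg MvPowerSeries.constantCoeff h1
    rwa [map_mul, map_sub, map_one, constantCoeff_mono h0, sub_zero, one_mul, constantCoeff_invSum,
      eq_comm] at h2
  · refine IsSkew.translates (simpleReflection_apply b θ i) (simpleReflection_self i) ?_
    rw [← h1]
    exact isSkew_invSum i

/-! ### Invariance of the products away from a simple coroot -/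

/-- Apart from `a_i`, the positive coroots are permuted by `s_i` with their multiplicities. The
parameter `r` covers `D` at `r = 1` and `D_v` at `r = v⁻¹`. -/
lemma exists_prod_eq (r : ℂ[X]) {F : Qfin (Idx b)}
    (hF : HasProd (fun n : PosCoroot b θ => (1 - MvPowerSeries.C r * mono n.1) ^ mult b θ n) F)
    (i : Idx b) : ∃ G, F = (1 - MvPowerSeries.C r * mono (Finsupp.single i 1)) * G ∧
      MvPowerSeries.constantCoeff G = 1 ∧ Translates (simpleReflection b θ i) G G := by
  classical
  have hreal : IsReal b θ (toLattice (Finsupp.single i 1)) := by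
    rw [toLattice_single]
    exact isReal_simple b θ i
  set a : PosCoroot b θ := ⟨Finsupp.single i 1, hreal.ne_zero, Or.inl hreal⟩ with ha
  set f : PosCoroot b θ → Qfin (Idx b) := fun n =>
    (1 - MvPowerSeries.C r * mono n.1) ^ mult b θ n with hf
  set g : PosCoroot b θ → Qfin (Idx b) := fun n => if n = a then 1 else f n with hg
  have hdvd : ∀ n, mono n.1 ∣ g n - 1 := by
    intro n
    by_cases hn : n = a
    · simp [hg, hn]
    · simp only [hg, if_neg hn, hf]
      exact dvd_pow_sub_one ⟨-MvPowerSeries.C r, by ring⟩ _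
  have hG := (multipliable_of_mono_dvd _ Subtype.val_injective hdvd).hasProd
  refine ⟨∏' n, g n, ?_, constantCoeff_eq_one_of_hasProd hG fun n =>
    constantCoeff_eq_one_of_dvd (PosCoroot.ne_zero n) (hdvd n), ?_⟩
  · have h1 := (hasProd_ite_eq a (f a)).mul hG
    have h2 : f = fun n => (if n = a then f a else 1) * g n := by
      funext n
      by_cases hn : n = a
      · simp [hg, hn]
      · simp [hg, hn]
    have h3 : f a = 1 - MvPowerSeries.C r * mono (Finsupp.single i 1) := by
      change (1 - MvPowerSeries.C r * mono (Finsupp.single i 1)) ^ mult b θ a = _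
      rw [mult_of_isReal (n := a) hreal, pow_one]
    rw [← h3]
    rw [h2] at hF
    exact hF.unique h1
  · have hfix : ∀ n, absPerm (gen b θ i) n = a ↔ n = a := by
      have h1 : absPerm (gen b θ i) a = a := by
        refine Subtype.ext (toLattice_injective ?_)
        change toLattice (absImage (gen b θ i) (Finsupp.single i 1)) =
          toLattice (Finsupp.single i 1)
        have h2 : (gen b θ i).1 (toLattice (Finsupp.single i 1)) = -simpleCoroot b i := by
          rw [toLattice_single]
          exact simpleReflection_self i
        rw [toLattice_absImage_of_nonpos, h2, neg_neg, toLattice_single]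
        · rfl
        · rw [h2, neg_nonpos]
          exact simpleCoroot_nonneg i
      intro n
      nth_rewrite 1 [← h1]
      exact (absPerm (gen b θ i)).injective.eq_iff
    refine Translates.hasProd (g := g ∘ absPerm (gen b θ i)) (fun n => ?_) hG
      ((absPerm (gen b θ i)).hasProd_iff.mpr hG)
    simp only [Function.comp_apply, hg, hfix]
    by_cases hn : n = a
    · simp only [if_pos hn]
      exact translates_one
    · simp only [if_neg hn, hf, mult_absPerm]
      refine Translates.pow (translates_one.sub (Translates.C_mul (translates_mono ?_) r)) _
      have h4 : 0 ≤ (gen b θ i).1 (toLattice n.1) := by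
        rcases n.2.2 with h | h
        · refine IsReal.simpleReflection_nonneg h (toLattice_nonneg _) fun h5 => hn ?_
          exact Subtype.ext (toLattice_injective (h5.trans (toLattice_single i).symm))
        · rw [weyl_apply_of_finPart_eq_zero _ h]
          exact toLattice_nonneg _
      change simpleReflection b θ i (toLattice (absImage (gen b θ i) n.1)) = _
      rw [toLattice_absImage_of_nonneg h4]
      exact simpleReflection_simpleReflection i _

end Topology

/-! ### Laurent polynomials: divisibility and coefficients of expansions -/

section LaurentExpansion

variable {I : Type*}

lemma one_sub_single_dvd_zsmul (a : I →₀ ℤ) (m : ℤ) :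
    (1 - AddMonoidAlgebra.single a 1 : Laurent I) ∣ AddMonoidAlgebra.single (m • a) 1 - 1 := by
  have hnat : ∀ m : ℕ, (1 - AddMonoidAlgebra.single a 1 : Laurent I) ∣
      1 - AddMonoidAlgebra.single ((m : ℤ) • a) 1 := by
    intro m
    have h := sub_dvd_pow_sub_pow (1 : Laurent I) (AddMonoidAlgebra.single a 1) m
    rwa [one_pow, AddMonoidAlgebra.single_pow, one_pow, ← natCast_zsmul] at h
  obtain ⟨n, rfl | rfl⟩ := m.eq_nat_or_neg
  · rw [dvd_sub_comm]
    exact hnat n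
  · have h : (AddMonoidAlgebra.single ((-(n : ℤ)) • a) 1 - 1 : Laurent I) =
        (1 - AddMonoidAlgebra.single ((n : ℤ) • a) 1) *
          AddMonoidAlgebra.single ((-(n : ℤ)) • a) 1 := by
      rw [sub_mul, one_mul, AddMonoidAlgebra.single_mul_single, neg_smul, add_neg_cancel, mul_one]
      rfl
    rw [h]
    exact (hnat n).mul_right _

/-- On a monomial, `s` multiplies by a power of `e^a`. This is why Demazure-Lusztig operators have
no denominators on Laurent polynomials. -/
lemma one_sub_single_dvd_smul_sub {s : (I →₀ ℤ) ≃ₗ[ℤ] (I →₀ ℤ)} {p : (I →₀ ℤ) → ℤ} {a : I →₀ ℤ}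
    (hs : ∀ x, s x = x - p x • a) (f : Laurent I) :
    (1 - AddMonoidAlgebra.single a 1 : Laurent I) ∣ s • f - f := by
  induction f using AddMonoidAlgebra.induction_linear with
  | zero => simp
  | add f g hf hg =>
    rw [smul_add, add_sub_add_comm]
    exact dvd_add hf hg
  | single x r =>
    have h : s • (AddMonoidAlgebra.single x r : Laurent I) - AddMonoidAlgebra.single x r =
        (AddMonoidAlgebra.single ((-p x) • a) 1 - 1) * AddMonoidAlgebra.single x r := by
      rw [smul_single_laurent, hs, sub_mul, one_mul, AddMonoidAlgebra.single_mul_single, one_mul,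
        neg_smul, neg_add_eq_sub]
    rw [h]
    exact (one_sub_single_dvd_zsmul a (-p x)).mul_right _

lemma expands_C (r : ℂ[X]) :
    Expands (algebraMap (Laurent I) (RatFun I) (AddMonoidAlgebra.single 0 r))
      (MvPowerSeries.C r) := by
  rw [Expands, ratToFrac_algebraMap, laurentToFrac_single, ofAdd_zero, map_one,
    Algebra.smul_def, mul_one, IsScalarTower.algebraMap_apply ℂ[X] (Qfin I)]
  rfl

/-- A Laurent polynomial need not lie in the completion, so a factor `e^{-m}` first moves its
support into `Q^∨_-`. -/
lemma exists_expands_laurent (p : Laurent I) : ∃ (m : I →₀ ℕ) (g : Qfin I),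
    Expands (rexp (-toLattice m) * algebraMap (Laurent I) (RatFun I) p) g ∧
      ∀ x, coeffExp g (x - toLattice m) = p.coeff x := by
  classical
  induction p using AddMonoidAlgebra.induction_linear with
  | zero =>
    refine ⟨0, 0, ?_, fun x => map_zero (coeffExpHom _)⟩
    rw [map_zero, mul_zero]
    exact expands_zero
  | add p p' h h' =>
    obtain ⟨m, g, h1, h2⟩ := h
    obtain ⟨m', g', h1', h2'⟩ := h'
    refine ⟨m + m', mono m' * g + mono m * g', ?_, fun x => ?_⟩
    · have h3 := ((expands_rexp m').mul h1).add ((expands_rexp m).mul h1')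
      have h4 : rexp (-toLattice (m + m')) * algebraMap (Laurent I) (RatFun I) (p + p') =
          rexp (-toLattice m') * (rexp (-toLattice m) * algebraMap (Laurent I) (RatFun I) p) +
          rexp (-toLattice m) * (rexp (-toLattice m') * algebraMap (Laurent I) (RatFun I) p') := by
        rw [toLattice_add, neg_add, rexp_add, map_add]
        ring
      rwa [h4]
    · rw [coeffExp_add, coeffExp_mono_mul, coeffExp_mono_mul, toLattice_add,
        AddMonoidAlgebra.coeff_add, Finsupp.add_apply, ← h2, ← h2']
      congr 2 <;> abel
  | single x r =>
    obtain ⟨m, hm⟩ := exists_toLattice (x := x ⊔ 0) le_sup_right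
    obtain ⟨n, hn⟩ := exists_eq_neg_toLattice (x := x - toLattice m) (by
      rw [hm, sub_nonpos]
      exact le_sup_left)
    refine ⟨m, MvPowerSeries.C r * mono n, ?_, fun y => ?_⟩
    · have h : rexp (-toLattice m) * algebraMap (Laurent I) (RatFun I) (AddMonoidAlgebra.single x r) =
          algebraMap (Laurent I) (RatFun I) (AddMonoidAlgebra.single 0 r) * rexp (-toLattice n) := by
        rw [← hn, rexp, rexp, ← map_mul, ← map_mul, AddMonoidAlgebra.single_mul_single,
          AddMonoidAlgebra.single_mul_single, one_mul, mul_one, zero_add, neg_add_eq_sub]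
      rw [h]
      exact (expands_C r).mul (expands_rexp n)
    · have h1 := coeffExp_mono_mul n 1 (y - toLattice m)
      rw [mul_one] at h1
      rw [coeffExp_C_mul, h1, coeffExp_one, AddMonoidAlgebra.coeff_single, Finsupp.single_apply]
      have h2 : y - toLattice m + toLattice n = 0 ↔ x = y := by
        rw [← neg_eq_iff_eq_neg.mpr hn, neg_sub, sub_add_sub_cancel, sub_eq_zero, eq_comm]
      simp only [h2, mul_ite, mul_one, mul_zero]

/-- The expansion of a Laurent polynomial has the same coefficients. -/
lemma coeffExp_of_expands_laurent {p : Laurent I} {g : Qfin I}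
    (h : Expands (algebraMap (Laurent I) (RatFun I) p) g) (x : I →₀ ℤ) :
    coeffExp g x = p.coeff x := by
  obtain ⟨m, g', h1, h2⟩ := exists_expands_laurent p
  have h3 := h1.unique ((expands_rexp m).mul h)
  rw [← h2, h3, coeffExp_mono_mul, sub_add_cancel]

end LaurentExpansion

/-! ### The action of `T_w` on the constant function `1` -/

section Augmentation
variable {ι k M N : Type*} [Finite ι] [Field k] [CharZero k] [AddCommGroup M] [Module k M]
  [AddCommGroup N] [Module k N] {P : RootPairing ι k M N} [P.IsRootSystem] [P.IsCrystallographic]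
  [P.IsReduced] {b : P.Base} {θ : ι} [hS : SimplyLacedAffine b θ]

/-- The sum of the coefficients of an element of the twisted group algebra. -/
def aug : RW b θ →+ RatFun (Idx b) where
  toFun Y := Y.coeff.sum fun _ r => r
  map_zero' := Finsupp.sum_zero_index
  map_add' Y Z := by
    rw [SkewMonoidAlgebra.coeff_add]
    exact Finsupp.sum_add_index' (h := fun _ r => r) (fun _ => rfl) fun _ _ _ => rfl

lemma aug_single (w : weyl b θ) (r : RatFun (Idx b)) :
    aug (SkewMonoidAlgebra.single w r : RW b θ) = r := by
  change (SkewMonoidAlgebra.single w r : RW b θ).coeff.sum (fun _ r => r) = _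
  rw [SkewMonoidAlgebra.coeff_single]
  exact Finsupp.sum_single_index (h := fun _ r => r) rfl

/-- `aug Y` is `Y` applied to `1`, so left multiplication by `T_i` becomes the Demazure-Lusztig
operator on functions. -/
lemma aug_simpleT_mul (i : Idx b) (Y : RW b θ) : aug (simpleT b θ i * Y) =
    cFun (simpleCoroot b i) * (simpleReflection b θ i • aug Y) +
      bFun (simpleCoroot b i) * aug Y := by
  induction Y using SkewMonoidAlgebra.induction_on with
  | zero => rw [mul_zero, map_zero, smul_zero, mul_zero, mul_zero, add_zero]
  | single w r =>
    rw [simpleT, add_mul, SkewMonoidAlgebra.single_mul_single, SkewMonoidAlgebra.single_mul_single,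
      map_add, aug_single, aug_single, aug_single, one_smul]
    rfl
  | add Y Z hY hZ =>
    rw [mul_add, map_add, map_add, hY, hZ, smul_add]
    ring

lemma exists_aug_simpleT_mul (i : Idx b) {Y : RW b θ} {p : Laurent (Idx b)}
    (h : aug Y = algebraMap _ _ p) : 
    ∃ p', aug (simpleT b θ i * Y) = algebraMap (Laurent (Idx b)) _ p' := by
  obtain ⟨d, hd⟩ := one_sub_single_dvd_smul_sub (simpleReflection_apply b θ i) p
  set E : Laurent (Idx b) := AddMonoidAlgebra.single (simpleCoroot b i) 1 with hE
  set E' : Laurent (Idx b) := AddMonoidAlgebra.single (-simpleCoroot b i) 1 with hE'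
  set q : Laurent (Idx b) := AddMonoidAlgebra.single 0 X with hq
  have hEE : E' * E = 1 := by
    rw [hE, hE', AddMonoidAlgebra.single_mul_single, neg_add_cancel, mul_one]
    rfl
  set sp := simpleReflection b θ i • p with hsp
  -- The numerator of `T_i p` is divisible by `1 - e^{a}`, since `s_i p - p` is.
  have key : (1 - q * E') * sp + (q - 1) * p = (1 - E) * (d - q * d - q * E' * sp) := by
    linear_combination (1 - q) * hd - q * sp * hEE
  refine ⟨d - q * d - q * E' * sp, ?_⟩
  have h0 := one_sub_rexp_ne_zero (simpleCoroot_ne_zero (b := b) i)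
  rw [aug_simpleT_mul, h, smul_algebraMap_laurent, ← hsp, cFun, bFun]
  have key2 := congrArg (algebraMap (Laurent (Idx b)) (RatFun (Idx b))) key
  simp only [map_add, map_sub, map_mul, map_one] at key2
  change (1 - vinv * rexp (-simpleCoroot b i)) * _ + (vinv - 1) * _ =
    (1 - rexp (simpleCoroot b i)) * _ at key2
  field_simp
  rw [mul_comm] at key2
  simp only [map_sub, map_mul]
  linear_combination key2

lemma exists_aug_elemT (w : weyl b θ) :
    ∃ p, aug (elemT b θ w) = algebraMap (Laurent (Idx b)) _ p := by
  rw [elemT]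
  generalize (exists_reducedWord b θ w).choose = l
  induction l with
  | nil =>
    refine ⟨1, ?_⟩
    change aug (1 : RW b θ) = _
    rw [map_one (algebraMap (Laurent (Idx b)) (RatFun (Idx b))), SkewMonoidAlgebra.one_def,
      aug_single]
  | cons i l ih =>
    obtain ⟨p, hp⟩ := ih
    rw [wordT_cons]
    exact exists_aug_simpleT_mul i hp

/-- The expansion of the sum of the coefficients of `T_w`. -/
def augSeries (w : weyl b θ) : Qfin (Idx b) := ∑ u ∈ (elemT b θ w).coeff.support, coeffC b θ u w

lemma expands_aug_elemT (w : weyl b θ) : Expands (aug (elemT b θ w)) (augSeries w) := by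
  have h : aug (elemT b θ w) =
      ∑ u ∈ (elemT b θ w).coeff.support, (elemT b θ w).coeff u := rfl
  rw [h, Expands, augSeries, map_sum, map_sum]
  refine Finset.sum_congr rfl fun u _ => ?_
  exact (expands_elemT_coeff w u).expansion

lemma coeffC_eq_zero {u w : weyl b θ} (h : u ∉ (elemT b θ w).coeff.support) :
    coeffC b θ u w = 0 := by
  rw [coeffC, Finsupp.notMem_support_iff.mp h]
  exact expands_zero.expansion_eq

lemma expands_inv_one_sub_vinv {n : Idx b →₀ ℕ} {g : Qfin (Idx b)} (hg : (1 - qC * mono n) * g = 1)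
    : Expands (1 - vinv * rexp (-toLattice n))⁻¹ g := by
  have h1 := expands_one.sub ((expands_vinv (I := Idx b)).mul (expands_rexp n))
  refine h1.of_mul_left (left_ne_zero_of_mul (hg.trans_ne one_ne_zero)) ?_
  rw [hg, mul_inv_cancel₀]
  · exact expands_one
  · intro h0
    rw [h0] at h1
    rw [h1.unique expands_zero, zero_mul] at hg
    exact zero_ne_one hg

/-- The combination of `T_w` and `T_{s_i w}` that is anti-invariant after a shift. -/
lemma coeffExp_augSeries_add {i : Idx b} {g : Qfin (Idx b)}
    (hg : (1 - qC * mono (Finsupp.single i 1)) * g = 1) (w : weyl b θ) (x : Lattice b) :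
    coeffExp ((1 - mono (Finsupp.single i 1)) * (g * (augSeries w + augSeries (gen b θ i * w))))
      (simpleReflection b θ i x - simpleCoroot b i) =
    -coeffExp ((1 - mono (Finsupp.single i 1)) * (g * (augSeries w + augSeries (gen b θ i * w)))) x := by
  -- The expression is symmetric in `w` and `s_i w`, so the shorter one may be called `w`.
  wlog h : 0 ≤ (w⁻¹).1 (simpleCoroot b i) generalizing w
  · have h1 := this (gen b θ i * w) (by
      rw [inv_gen_mul_apply_simple, neg_nonneg]
      exact (isReal_weyl w⁻¹ (isReal_simple b θ i)).not_nonneg_iff.mp h)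
    rwa [gen_mul_gen_mul, add_comm (augSeries (gen b θ i * w))] at h1
  obtain ⟨p, hp⟩ := exists_aug_elemT w
  have hn : toLattice (Finsupp.single i 1) = simpleCoroot b i := toLattice_single i
  have h1 := (expands_one.sub (expands_rexp (Finsupp.single i 1))).mul
    ((expands_inv_one_sub_vinv hg).mul
      ((expands_aug_elemT w).add (expands_aug_elemT (gen b θ i * w))))
  have h2 := expands_one.sub ((expands_vinv (I := Idx b)).mul (expands_rexp (Finsupp.single i 1)))
  have h3 : 1 - vinv * rexp (-toLattice (Finsupp.single i 1 : Idx b →₀ ℕ)) ≠ 0 := by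
    intro h0
    rw [h0] at h2
    rw [h2.unique expands_zero, zero_mul] at hg
    exact zero_ne_one hg
  -- With `p = T_w(1)`, removing the factors from `(1 + T_i) p` leaves `p - e^{-a} s_i p`, whose
  -- coefficients are visibly skew.
  set r : Laurent (Idx b) := p - AddMonoidAlgebra.single (-simpleCoroot b i) 1 *
    (simpleReflection b θ i • p) with hr
  have h4 : (1 - rexp (-toLattice (Finsupp.single i 1))) *
      ((1 - vinv * rexp (-toLattice (Finsupp.single i 1)))⁻¹ *
        (aug (elemT b θ w) + aug (elemT b θ (gen b θ i * w)))) = algebraMap _ _ r := by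
    have h5 := one_sub_rexp_ne_zero (simpleCoroot_ne_zero (b := b) i)
    have h6 : algebraMap (Laurent (Idx b)) (RatFun (Idx b)) r =
        aug (elemT b θ w) - rexp (-simpleCoroot b i) *
          (simpleReflection b θ i • aug (elemT b θ w)) := by
      rw [hr, map_sub, map_mul, hp, smul_algebraMap_laurent]
      rfl
    have h7 := rexp_neg_mul (simpleCoroot b i)
    rw [h6, elemT_gen_mul h, aug_simpleT_mul, cFun, bFun]
    rw [hn] at h3 ⊢
    rw [mul_left_comm, inv_mul_eq_iff_eq_mul₀ h3]
    field_simp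
    generalize aug (elemT b θ w) = A
    generalize simpleReflection b θ i • A = B
    generalize rexp (-simpleCoroot b i) = e' at *
    generalize rexp (simpleCoroot b i) = e at *
    linear_combination (A * (1 - vinv) - B + e' * vinv * B) * h7
  rw [h4] at h1
  rw [coeffExp_of_expands_laurent h1, coeffExp_of_expands_laurent h1]
  have h8 : ∀ y, r.coeff y = p.coeff y - p.coeff (simpleReflection b θ i (y + simpleCoroot b i)) := by
    intro y
    rw [hr, AddMonoidAlgebra.coeff_sub, Finsupp.sub_apply]
    congr 1
    rw [AddMonoidAlgebra.coeff_single_mul_eq_mul_coeff (y + simpleCoroot b i), one_mul]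
    · have h9 := coeff_smul_laurent (simpleReflection b θ i) p
        (simpleReflection b θ i (y + simpleCoroot b i))
      rwa [simpleReflection_simpleReflection] at h9
    · intro z _
      rw [neg_add_eq_iff_eq_add, add_comm]
  rw [h8, h8, sub_add_cancel, simpleReflection_simpleReflection, map_add, simpleReflection_self,
    ← sub_eq_add_neg]
  ring

end Augmentation

/-! ### Invariance of the correction factor and conclusion -/

section Topology

open scoped MvPowerSeries.WithPiTopology
open Filter

attribute [local instance] instTopologicalSpaceCoeff instDiscreteTopologyCoeff

section Doubling

variable {I : Type*} {s : (I →₀ ℤ) ≃ₗ[ℤ] (I →₀ ℤ)}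

lemma Translates.of_add_self {f g : Qfin I} (h : Translates s (f + f) (g + g)) :
    Translates s f g := fun x => by
  have h1 := h x
  rw [coeffExp_add, coeffExp_add, ← two_mul, ← two_mul] at h1
  exact mul_left_cancel₀ two_ne_zero h1

lemma exists_one_sub_qC_mul (i : I) : ∃ g : Qfin I, (1 - qC * mono (Finsupp.single i 1)) * g = 1 := by
  refine ⟨MvPowerSeries.invOfUnit _ 1, MvPowerSeries.mul_invOfUnit _ _ ?_⟩
  rw [map_sub, map_mul, constantCoeff_mono (by simp), mul_zero, sub_zero, map_one, Units.val_one]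

end Doubling

variable {ι k M N : Type*} [Finite ι] [Field k] [CharZero k] [AddCommGroup M] [Module k M]
  [AddCommGroup N] [Module k N] {P : RootPairing ι k M N} [P.IsRootSystem] [P.IsCrystallographic]
  [P.IsReduced] {b : P.Base} {θ : ι} [hS : SimplyLacedAffine b θ]

/-- A monomial bounds `ℓ(u)` through `invWt u`, and then `ℓ(w)` through the path estimate, so the
double family can be summed in either order. -/
lemma summable_coeffC :
    Summable fun p : weyl b θ × weyl b θ => coeffC b θ p.1 p.2 := by
  refine summable_of_finite_coeff fun n => (((finite_len_le (b := b) (θ := θ) n.degree).prod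
    (finite_len_le (b := b) (θ := θ) (n.degree + 2 * n.degree)))).subset ?_
  rintro ⟨u, w⟩ h
  rw [Set.mem_ofPred_eq, coeffC_eq] at h
  obtain ⟨m₁, m₂, hm, h1, h2⟩ := exists_coeff_ne_zero_of_mul h
  have h3 : len u ≤ _ := len_le_of_coeff_invWt_ne_zero h1
  have h4 : len w ≤ len u + _ := len_le_of_coeff_pathSum_ne_zero (exists_reducedWord b θ w).choose_spec h2
  rw [Set.mem_prod, Set.mem_ofPred_eq, Set.mem_ofPred_eq, ← hm, map_add]
  change len u ≤ _ ∧ len w ≤ _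
  omega

/-- Summing over `w` first gives `invWt u * pathLimit` for each `u`; summing over `u` first gives
the finite sums `augSeries w`. -/
lemma hasSum_augSeries : HasSum (augSeries : weyl b θ → Qfin (Idx b))
    (invSum b θ * pathLimit b θ) := by
  have : RegularSpace (Qfin (Idx b)) :=
    inferInstanceAs (RegularSpace ((Idx b →₀ ℕ) → ℂ[X]))
  obtain ⟨S, hS'⟩ := summable_coeffC (b := b) (θ := θ)
  have h1 := hS'.prod_fiberwise fun u => hasSum_coeffC u
  have h2 := (hasSum_invWt (b := b) (θ := θ)).mul_right (pathLimit b θ)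
  have h3 := (Equiv.prodComm (weyl b θ) (weyl b θ)).hasSum_iff.mpr hS'
  have h4 : ∀ w : weyl b θ, HasSum (fun u => coeffC b θ u w) (augSeries w) := fun w =>
    hasSum_sum_of_ne_finset_zero fun u hu => coeffC_eq_zero hu
  rw [← h1.unique h2]
  exact h3.prod_fiberwise h4

/-- The value of the sum at the trivial module is invariant up to the factor of `a_i`. -/
lemma translates_mul_invSum_mul_pathLimit {i : Idx b} {g : Qfin (Idx b)}
    (hg : (1 - qC * mono (Finsupp.single i 1)) * g = 1) :
    Translates (simpleReflection b θ i) (g * (invSum b θ * pathLimit b θ))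
      (g * (invSum b θ * pathLimit b θ)) := by
  have h0 := hasSum_augSeries (b := b) (θ := θ)
  have h1 := (Equiv.mulLeft (gen b θ i)).hasSum_iff.mpr h0
  -- Adding the sum reindexed by `w ↦ s_i w` pairs each `w` with `s_i w` and doubles the total; the
  -- factor 2 is cancelled at the end.
  have h2 := ((h0.add h1).mul_left g).mul_left (1 - mono (Finsupp.single i 1))
  have h3 := IsSkew.hasSum (fun w x => coeffExp_augSeries_add hg w x) h2 h2
  rw [mul_add] at h3
  exact (IsSkew.translates (simpleReflection_apply b θ i) (simpleReflection_self i) h3).of_add_self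

lemma exists_denomV_inv : ∃ g, denomV b θ * g = 1 :=
  ⟨MvPowerSeries.invOfUnit _ 1, MvPowerSeries.mul_invOfUnit _ _ constantCoeff_denomV⟩

/-- Once the factors attached to `a_i` are cancelled, `c` times an invariant series with constant
term `1` is a product of invariant series, and division by such a series preserves invariance. -/
lemma translates_of_denomV_mul {c : Qfin (Idx b)} (hc : c * denomV b θ = pathLimit b θ * denom b θ)
    (i : Idx b) : Translates (simpleReflection b θ i) c c := by
  obtain ⟨g, hg⟩ := exists_one_sub_qC_mul i
  obtain ⟨J, hJ, hJ0, hJs⟩ := exists_invSum_eq (b := b) (θ := θ) i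
  obtain ⟨D, hD, hD0, hDs⟩ := exists_prod_eq (b := b) (θ := θ) 1 (F := denom b θ) (by
    simpa using hasProd_denom) i
  obtain ⟨V, hV, hV0, hVs⟩ := exists_prod_eq (b := b) (θ := θ) X (F := denomV b θ) (by
    have h : denomFactor b θ = fun n => (1 - MvPowerSeries.C X * mono n.1) ^ mult b θ n :=
      funext fun n => by rw [denomFactor, monomial_X_eq, qC]
    rw [← h]
    exact hasProd_denomV) i
  rw [map_one, one_mul] at hD
  have hV' : denomV b θ = (1 - qC * mono (Finsupp.single i 1)) * V := hV
  refine Translates.of_mul_left (fun x j hj => simpleReflection_apply_of_ne hj x)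
    (simpleReflection_self i) (hVs.mul hJs) ?_ ?_
  · rw [MvPowerSeries.coeff_zero_eq_constantCoeff_apply, map_mul, hV0, hJ0, mul_one]
  -- Multiplying by `J` turns the factor `1 - e^{-a}` of `denom` into `invSum`, while `g` removes
  -- the factor `1 - v⁻¹e^{-a}` of `denomV`.
  · have h : V * J * c = g * (invSum b θ * pathLimit b θ) * D := by
      rw [hV', hD] at hc
      rw [hJ]
      linear_combination g * J * hc - c * V * J * hg
    rw [h]
    exact (translates_mul_invSum_mul_pathLimit hg).mul hDs

lemma weyl_invariant_of_simpleReflection {c : Qfin (Idx b)}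
    (h : ∀ i, Translates (simpleReflection b θ i) c c) (w : weyl b θ) (x : Lattice b) :
    coeffExp c (w.1 x) = coeffExp c x := by
  induction w using wprod_induction generalizing x with
  | h1 => rfl
  | h2 u i ih =>
    rw [weyl_mul_apply, ih]
    exact h i x

variable (b θ) in
/-- The correction factor, and its relation to the sum of the `T_w`. -/
lemma exists_correction : ∃ c : Qfin (Idx b), IsImagSeries b θ c ∧
    (∀ (w : weyl b θ) (x : Lattice b), coeffExp c (w.1 x) = coeffExp c x) ∧
    ∀ u : weyl b θ, HasFormalSum (fun w => coeffC b θ u w)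
      (toQv (c * denomV b θ * invDenom b θ u)) := by
  obtain ⟨V, hV⟩ := exists_denomV_inv (b := b) (θ := θ)
  -- The correction factor is `L D / D_v`, with `V` the inverse of `D_v`.
  have hc : pathLimit b θ * denom b θ * V * denomV b θ = pathLimit b θ * denom b θ := by
    linear_combination pathLimit b θ * denom b θ * hV
  have hinv := weyl_invariant_of_simpleReflection (translates_of_denomV_mul hc)
  refine ⟨_, isImagSeries_of_invariant hinv, hinv, fun u => hasFormalSum_of_hasSum ?_⟩
  have h : pathLimit b θ * denom b θ * V * denomV b θ * invDenom b θ u =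
      invWt u * pathLimit b θ := by
    rw [hc, invDenom_eq]
    linear_combination pathLimit b θ * invWt u * denom_mul_denomInv (b := b) (θ := θ)
  rw [h]
  exact hasSum_coeffC u

lemma hasFormalProd_denomV : HasFormalProd (denomFactor b θ) (denomV b θ) :=
  hasFormalProd_iff_hasProd.mpr hasProd_denomV

lemma hasFormalProd_invDenom (w : weyl b θ) : HasFormalProd (invFactor b θ w) (invDenom b θ w) :=
  hasFormalProd_iff_hasProd.mpr (invDenom_eq w ▸ hasProd_invFactor w)

end Topology

end AffineCS

end

theorem proposition5p7 {ι k M N : Type*} [Finite ι] [Field k] [CharZero k]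
    [AddCommGroup M] [Module k M] [AddCommGroup N] [Module k N]
    -- a simply-laced irreducible finite root system, a base, and its highest root
    (P : RootPairing ι k M N) [P.IsRootSystem] [P.IsCrystallographic] [P.IsReduced]
    [P.IsIrreducible] (b : P.Base) (hsl : b.cartanMatrix.IsSimplyLaced)
    (θ : ι) (hθ : AffineCS.IsHighestRoot b θ) :
    -- `T_w` does not depend on the reduced word, and lies in `ℂ[v⁻¹][[Q^∨_-]][W]`
    (∀ (w : AffineCS.weyl b θ) (l : List (AffineCS.Idx b)), AffineCS.IsReducedWord b θ l w →
      AffineCS.wordT b θ l = AffineCS.elemT b θ w) ∧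
    (∀ u w : AffineCS.weyl b θ,
      AffineCS.Expands ((AffineCS.elemT b θ w).coeff u) (AffineCS.coeffC b θ u w)) ∧
    -- the products defining `D_v` and the translates of `1 / D` make sense
    AffineCS.HasFormalProd (AffineCS.denomFactor b θ) (AffineCS.denomV b θ) ∧
    (∀ (w : AffineCS.weyl b θ) (n : AffineCS.PosCoroot b θ),
      AffineCS.Expands (AffineCS.invFactorRat b θ w n)
        (AffineCS.expansion (AffineCS.invFactorRat b θ w n))) ∧
    (∀ w : AffineCS.weyl b θ,
      AffineCS.HasFormalProd (AffineCS.invFactor b θ w) (AffineCS.invDenom b θ w)) ∧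
    -- `P = ∑_w T_w` is well defined and equal to `c(v) D_v ∑_w [w] (1 / D)`
    ∃ c : AffineCS.Qfin (AffineCS.Idx b),
      AffineCS.IsImagSeries b θ c ∧
      (∀ (w : AffineCS.weyl b θ) (x : AffineCS.Lattice b),
        AffineCS.coeffExp c (w.1 x) = AffineCS.coeffExp c x) ∧
      ∀ u : AffineCS.weyl b θ,
        AffineCS.HasFormalSum (fun w => AffineCS.coeffC b θ u w)
          (AffineCS.toQv (c * AffineCS.denomV b θ * AffineCS.invDenom b θ u)) := by
  have : AffineCS.SimplyLacedAffine b θ := ⟨hsl, hθ⟩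
  exact ⟨fun w l hl => AffineCS.wordT_eq_elemT hl,
    fun u w => (AffineCS.expands_elemT_coeff w u).expansion,
    AffineCS.hasFormalProd_denomV,
    fun w n => (AffineCS.expands_invFactorRat w n).expansion,
    AffineCS.hasFormalProd_invDenom,
    AffineCS.exists_correction b θ⟩
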